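/- **Brane diagrams.** A brane diagram $\mathcal D$ is a finite sequence of 5-branes, drawn from left to right, each being a D5 brane or an NS5 brane, together with a multiplicity $d_X\in\mathbb Z_{\ge 0}$ for each D3 brane $X$, i.e. each gap between consecutive 5-branes; D3 branes of multiplicity $0$ are added at the two ends. For a 5-brane $Z$ let $Z^-,Z^+$ be the D3 branes directly to its left and right; for a D3 brane $X$ let $X^-,X^+$ be the 5-branes directly to its left and right. Let $V_1,\dots,V_m$ be the NS5 branes and $U_1,\dots,U_n$ the D5 branes, from left to right. The margins are $r_i=d_{V_i^+}-d_{V_i^-}+\#\{j: U_j\text{ left of }V_i\}$ and $c_j=d_{U_j^-}-d_{U_j^+}+\#\{i: V_i\text{ right of }U_j\}$. A *binary contingency table* (BCT) with margins $r,c$ is an $m\times n$ matrix with entries in $\{0,1\}$, row sums $r_i$ and column sums $c_j$. **The bow variety.** Put $W_X=\mathbb C^{d_X}$, and $\mathbb C_U=\mathbb C$ for each D5 brane $U$. Let $\mathbb M$ be the space of tuples of linear maps $A_U:W_{U^+}\to W_{U^-}$, $b_U:W_{U^+}\to\mathbb C_U$, $a_U:\mathbb C_U\to W_{U^-}$, $B_U\in\mathrm{End}(W_{U^-})$,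 $B'_U\in\mathrm{End}(W_{U^+})$ ($U$ a D5 brane), $C_V:W_{V^+}\to W_{V^-}$, $D_V:W_{V^-}\to W_{V^+}$ ($V$ an NS5 brane). Let $\mu^{-1}(0)\subset\mathbb M$ be given by $B_UA_U-A_UB'_U+a_Ub_U=0$ for every D5 brane $U$ and, for every D3 brane $X$ between two 5-branes: $B'_{X^-}-B_{X^+}=0$ if $X^-,X^+$ are both D5; $C_{X^+}D_{X^+}-D_{X^-}C_{X^-}=0$ if both are NS5; $-D_{X^-}C_{X^-}-B_{X^+}=0$ if $X^-$ is NS5 and $X^+$ is D5; $C_{X^+}D_{X^+}+B'_{X^-}=0$ if $X^-$ is D5 and $X^+$ is NS5. Let $\widetilde{\mathcal M}\subset\mu^{-1}(0)$ be the set of points such that for every D5 brane $U$: (S1) if $S\le W_{U^+}$ satisfies $B'_US\subset S$, $A_US=0$, $b_US=0$, then $S=0$; (S2) if $T\le W_{U^-}$ satisfies $B_UT\subset T$ and $\mathrm{im}A_U+\mathrm{im}\,a_U\subset T$, then $T=W_{U^-}$. The group $G=\prod_X GL(W_X)$ acts by change of bases; let $\chi(g)=\prod\det g_X$, over the D3 branes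 $X$ directly to the right of an NS5 brane. A point $m\in\widetilde{\mathcal M}$ is *stable* if for $z\in\mathbb C\setminus\{0\}$ the orbit of $(m,z)$ under $g\cdot(m,z)=(gm,\chi(g)^{-1}z)$ is closed in $\widetilde{\mathcal M}\times\mathbb C$ and the stabilizer of $(m,z)$ is finite. The bow variety is $\mathrm{Ch}(\mathcal D)=\widetilde{\mathcal M}^{s}/G$, where $\widetilde{\mathcal M}^s$ is the set of stable points. The torus $\mathbb T=(\mathbb C^\times)^{\{\text{D5 branes}\}}\times\mathbb C^\times_\hbar$ acts on $\mathrm{Ch}(\mathcal D)$: the first factor rescales the lines $\mathbb C_U$, and $\hbar\in\mathbb C^\times_\hbar$ multiplies all $b_U,B_U,B'_U,C_V$ by $\hbar$. **Tie diagrams.** A *tie diagram* of $\mathcal D$ is a set of pairs $(V,U)$ ("ties") of an NS5 brane and a D5 brane such that every D3 brane $X$ lies between the two members of exactly $d_X$ of the pairs (is "covered" by $d_X$ ties). Its *table* is the $m\times n$ matrix $M$ for which, if $V_i$ is left of $U_j$, $M_{ij}=1$ or $0$ according to whether $V_i,U_j$ are tied or not, and, if $V_i$ is right of $U_j$, $M_{ij}=0$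 or $1$ according to whether they are tied or not. **Butterfly diagrams.** Given a tie diagram, for every D5 brane $U$ (whose *butterfly* is being constructed) and every D3 brane $X$ put a column of dots below $X$, as many as there are ties at $U$ covering $X$. Columns separated by a D5 brane ($U$ included) are aligned at the bottom; right of $U$, columns separated by an NS5 brane are aligned at the top; left of $U$, for columns separated by an NS5 brane, the top of the left one is one unit below the top of the right one. The dots below $X$, in the butterflies of all $U$, form a basis of $W_X$. The maps $A$ and $D$ send a dot to the dot at the same height in the same butterfly in the target column; $-B$, $-B'$ and $C$ send it to the dot one unit lower in the same butterfly in the target column (to $0$ if there is no such dot). $a_U(1)$ is the top dot below $U^-$ in the butterfly of $U$ ($0$ if there is none), and $-b_U$ sends to $1$ the dot below $U^+$ in the butterfly of $U$ that is one unit higher than the top of the column below $U^-$ (the bottom dot below $U^+$ if the column below $U^-$ is empty), all other dots to $0$. This point of $\mathbb M$, which is determined up to the numbering of the dots, is the *butterfly diagram* of the tie diagram. **Theorem.** Let $\mathcal D$ be a brane diagram. 1. Every $\mathbb T$-fixed point of $\mathrm{Ch}(\mathcal D)$ is represented by the butterfly diagram of some tie diagram of $\mathcal D$. 2. Conversely,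 the butterfly diagram of every tie diagram of $\mathcal D$ is a stable point of $\mu^{-1}(0)$ (it lies in $\widetilde{\mathcal M}^s$), and it represents a $\mathbb T$-fixed point of $\mathrm{Ch}(\mathcal D)$. 3. Sending a tie diagram to its table is a bijection from the tie diagrams of $\mathcal D$ onto the BCTs with margins $r,c$, and there is a bijection from the $\mathbb T$-fixed points of $\mathrm{Ch}(\mathcal D)$ onto the BCTs with margins $r,c$ that sends the fixed point represented by the butterfly diagram of a tie diagram to the table of that tie diagram. -/

import Mathlib

open scoped Matrix

noncomputable section

/-! ## Brane diagrams -/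

/-- The two kinds of 5-branes. -/
inductive FiveBrane where
  | D5
  | NS5
  deriving DecidableEq

/-- A (type A) brane diagram: a finite sequence of 5-branes `0, 1, …, size - 1`, drawn from left to
right. The D3 branes are numbered by `j : ℕ`: the D3 brane `j` lies between the 5-branes `j - 1`
and `j`, so the 5-brane `i` has the D3 brane `i` directly to its left and the D3 brane `i + 1`
directly to its right. The D3 branes to the left of the first and to the right of the last
5-brane (that is, `0` and all `j ≥ size`) are formally added, with multiplicity `0`. -/
structure BraneDiagram where
  size : ℕ
  kind : Fin size → FiveBrane
  mult : ℕ → ℕ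
  mult_zero : mult 0 = 0
  mult_of_size_le : ∀ j, size ≤ j → mult j = 0

namespace BraneDiagram

/-- The D5 branes `U` of a diagram. -/
abbrev D5 (𝓓 : BraneDiagram) : Type := {i : Fin 𝓓.size // 𝓓.kind i = FiveBrane.D5}

/-- The NS5 branes `V` of a diagram. -/
abbrev NS5 (𝓓 : BraneDiagram) : Type := {i : Fin 𝓓.size // 𝓓.kind i = FiveBrane.NS5}

/-- The D3 brane `U⁻` directly to the left of the 5-brane `i`. -/
abbrev left {𝓓 : BraneDiagram} (i : Fin 𝓓.size) : ℕ := i.1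

/-- The D3 brane `U⁺` directly to the right of the 5-brane `i`. -/
abbrev right {𝓓 : BraneDiagram} (i : Fin 𝓓.size) : ℕ := i.1 + 1

/-- The charge of an NS5 brane. -/
def chargeNS5 (𝓓 : BraneDiagram) (V : 𝓓.NS5) : ℤ :=
  ((𝓓.mult (right V.1) : ℤ) - 𝓓.mult (left V.1)) +
    (Finset.univ.filter fun U : 𝓓.D5 => U.1 < V.1).card

/-- The charge of a D5 brane. -/
def chargeD5 (𝓓 : BraneDiagram) (U : 𝓓.D5) : ℤ :=
  ((𝓓.mult (left U.1) : ℤ) - 𝓓.mult (right U.1)) +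
    (Finset.univ.filter fun V : 𝓓.NS5 => U.1 < V.1).card

/-- The binary contingency tables whose margins are the charge vectors `r` (of the NS5 branes,
indexing the rows) and `c` (of the D5 branes, indexing the columns). -/
def BCT (𝓓 : BraneDiagram) : Set (Matrix 𝓓.NS5 𝓓.D5 ℤ) :=
  {M | (∀ V U, M V U = 0 ∨ M V U = 1) ∧
    (∀ V, ∑ U, M V U = 𝓓.chargeNS5 V) ∧ (∀ U, ∑ V, M V U = 𝓓.chargeD5 U)}

/-! ## The bow variety -/

/-- The vector space `W_j` of the D3 brane `j` is `W 𝓓 j → ℂ`, of dimension `mult j`. -/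
abbrev W (𝓓 : BraneDiagram) (j : ℕ) : Type := Fin (𝓓.mult j)

/-- The vector space `𝕄`. Linear maps are given by matrices; the line `ℂ_U` is `Fin 1 → ℂ`. -/
@[ext]
structure Rep (𝓓 : BraneDiagram) where
  A : ∀ U : 𝓓.D5, Matrix (𝓓.W (left U.1)) (𝓓.W (right U.1)) ℂ
  b : ∀ U : 𝓓.D5, Matrix (Fin 1) (𝓓.W (right U.1)) ℂ
  a : ∀ U : 𝓓.D5, Matrix (𝓓.W (left U.1)) (Fin 1) ℂ
  B : ∀ U : 𝓓.D5, Matrix (𝓓.W (left U.1)) (𝓓.W (left U.1)) ℂ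
  B' : ∀ U : 𝓓.D5, Matrix (𝓓.W (right U.1)) (𝓓.W (right U.1)) ℂ
  C : ∀ V : 𝓓.NS5, Matrix (𝓓.W (left V.1)) (𝓓.W (right V.1)) ℂ
  D : ∀ V : 𝓓.NS5, Matrix (𝓓.W (right V.1)) (𝓓.W (left V.1)) ℂ

variable {𝓓 : BraneDiagram}

/-- The usual topology of the finite-dimensional complex vector space `𝕄`. -/
instance : TopologicalSpace (Rep 𝓓) :=
  TopologicalSpace.induced (fun m => (m.A, m.b, m.a, m.B, m.B', m.C, m.D)) inferInstance

/-- `μ m = 0`: the component of the moment map of every D5 brane and of every D3 brane between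
two 5-branes vanishes (the spaces `W` of the two outer D3 branes are zero). -/
structure IsMomentZero (m : Rep 𝓓) : Prop where
  threeWay : ∀ U, m.B U * m.A U - m.A U * m.B' U + m.a U * m.b U = 0
  between_D5_D5 : ∀ (i : ℕ) (hi : i + 1 < 𝓓.size)
    (h : 𝓓.kind ⟨i, Nat.lt_of_succ_lt hi⟩ = FiveBrane.D5) (h' : 𝓓.kind ⟨i + 1, hi⟩ = FiveBrane.D5),
    m.B' ⟨_, h⟩ - m.B ⟨_, h'⟩ = 0
  between_NS5_NS5 : ∀ (i : ℕ) (hi : i + 1 < 𝓓.size)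
    (h : 𝓓.kind ⟨i, Nat.lt_of_succ_lt hi⟩ = FiveBrane.NS5)
    (h' : 𝓓.kind ⟨i + 1, hi⟩ = FiveBrane.NS5),
    m.C ⟨_, h'⟩ * m.D ⟨_, h'⟩ - m.D ⟨_, h⟩ * m.C ⟨_, h⟩ = 0
  between_NS5_D5 : ∀ (i : ℕ) (hi : i + 1 < 𝓓.size)
    (h : 𝓓.kind ⟨i, Nat.lt_of_succ_lt hi⟩ = FiveBrane.NS5)
    (h' : 𝓓.kind ⟨i + 1, hi⟩ = FiveBrane.D5),
    -(m.D ⟨_, h⟩ * m.C ⟨_, h⟩) - m.B ⟨_, h'⟩ = 0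
  between_D5_NS5 : ∀ (i : ℕ) (hi : i + 1 < 𝓓.size)
    (h : 𝓓.kind ⟨i, Nat.lt_of_succ_lt hi⟩ = FiveBrane.D5)
    (h' : 𝓓.kind ⟨i + 1, hi⟩ = FiveBrane.NS5),
    m.C ⟨_, h'⟩ * m.D ⟨_, h'⟩ + m.B' ⟨_, h⟩ = 0

/-- Condition (S1). -/
def S1 (m : Rep 𝓓) : Prop :=
  ∀ (U : 𝓓.D5) (S : Submodule ℂ (𝓓.W (right U.1) → ℂ)),
    (∀ s ∈ S, m.B' U *ᵥ s ∈ S) → (∀ s ∈ S, m.A U *ᵥ s = 0) → (∀ s ∈ S, m.b U *ᵥ s = 0) → S = ⊥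

/-- Condition (S2). -/
def S2 (m : Rep 𝓓) : Prop :=
  ∀ (U : 𝓓.D5) (T : Submodule ℂ (𝓓.W (left U.1) → ℂ)),
    (∀ t ∈ T, m.B U *ᵥ t ∈ T) → (∀ w, m.A U *ᵥ w ∈ T) → (∀ w, m.a U *ᵥ w ∈ T) → T = ⊤

/-- The set of points of `μ⁻¹(0)` with (S1) and (S2). -/
def MTilde (𝓓 : BraneDiagram) : Type :=
  {m : Rep 𝓓 // IsMomentZero m ∧ S1 m ∧ S2 m}

instance : TopologicalSpace (MTilde 𝓓) := instTopologicalSpaceSubtype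

/-- The gauge group `∏ GL(W_j)` over the D3 branes `j` (the factors with `mult j = 0`, hence all
with `j = 0` or `j ≥ size`, are trivial). -/
abbrev Gauge (𝓓 : BraneDiagram) : Type := ∀ j : ℕ, GL (𝓓.W j) ℂ

/-- The torus `𝕋 = 𝔸 × ℂ^×_ħ` with `𝔸 = (ℂ^×)^{D5 branes}`. -/
abbrev Torus (𝓓 : BraneDiagram) : Type := (𝓓.D5 → ℂˣ) × ℂˣ

/-- The gauge group acts by change of bases in the spaces `W_j`. -/
@[simps]
def gaugeAct (g : Gauge 𝓓) (m : Rep 𝓓) : Rep 𝓓 where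
  A := fun U => (g (left U.1)).val * m.A U * (g (right U.1))⁻¹.val
  b := fun U => m.b U * (g (right U.1))⁻¹.val
  a := fun U => (g (left U.1)).val * m.a U
  B := fun U => (g (left U.1)).val * m.B U * (g (left U.1))⁻¹.val
  B' := fun U => (g (right U.1)).val * m.B' U * (g (right U.1))⁻¹.val
  C := fun V => (g (left V.1)).val * m.C V * (g (right V.1))⁻¹.val
  D := fun V => (g (right V.1)).val * m.D V * (g (left V.1))⁻¹.val

/-- An element `(t, ħ)` of the torus multiplies the line `ℂ_U` by `t U`, and moreover it scales
the maps `b, B, B', C` by `ħ`. -/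
@[simps]
def torusAct (t : Torus 𝓓) (m : Rep 𝓓) : Rep 𝓓 where
  A := m.A
  b := fun U => ((t.2 : ℂ) * (t.1 U : ℂ)) • m.b U
  a := fun U => ((t.1 U)⁻¹ : ℂˣ).val • m.a U
  B := fun U => (t.2 : ℂ) • m.B U
  B' := fun U => (t.2 : ℂ) • m.B' U
  C := fun V => (t.2 : ℂ) • m.C V
  D := m.D

instance : MulAction (Gauge 𝓓) (Rep 𝓓) where
  smul := gaugeAct
  one_smul m := by
    change gaugeAct _ _ = _
    ext1 <;> funext U <;> simp
  mul_smul g h m := by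
    change gaugeAct _ _ = gaugeAct _ (gaugeAct _ _)
    ext1 <;> funext U <;> simp [Matrix.mul_assoc, -Matrix.coe_units_inv]

instance : MulAction (Torus 𝓓) (Rep 𝓓) where
  smul := torusAct
  one_smul m := by
    change torusAct _ _ = _
    ext1 <;> funext U <;> simp
  mul_smul s t m := by
    change torusAct _ _ = torusAct _ (torusAct _ _)
    ext1 <;> funext U <;> simp [smul_smul, mul_comm, mul_left_comm, mul_assoc]

instance : SMulCommClass (Gauge 𝓓) (Torus 𝓓) (Rep 𝓓) where
  smul_comm g t m := by
    change gaugeAct _ (torusAct _ _) = torusAct _ (gaugeAct _ _)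
    ext1 <;> funext U <;> simp

lemma gauge_smul_def (g : Gauge 𝓓) (m : Rep 𝓓) : g • m = gaugeAct g m := rfl

lemma torus_smul_def (t : Torus 𝓓) (m : Rep 𝓓) : t • m = torusAct t m := rfl

lemma gl_inv_mul_cancel {n : ℕ} {κ : Type*} (g : GL (Fin n) ℂ) (M : Matrix (Fin n) κ ℂ) :
    g⁻¹.val * (g.val * M) = M := by
  rw [← Matrix.mul_assoc, Units.inv_mul, Matrix.one_mul]

lemma IsMomentZero.gauge_smul {m : Rep 𝓓} (hm : IsMomentZero m) (g : Gauge 𝓓) :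
    IsMomentZero (g • m) where
  threeWay U := by
    have := congrArg (fun M => (g (left U.1)).val * M * (g (right U.1))⁻¹.val) (hm.threeWay U)
    simpa [gauge_smul_def, Matrix.mul_assoc, Matrix.mul_add, Matrix.add_mul, Matrix.mul_sub,
      Matrix.sub_mul, gl_inv_mul_cancel, -Matrix.coe_units_inv] using this
  between_D5_D5 i hi h h' := by
    have := congrArg (fun M => (g (i + 1)).val * M * (g (i + 1))⁻¹.val)
      (hm.between_D5_D5 i hi h h')
    simpa [gauge_smul_def, Matrix.mul_assoc, Matrix.mul_add, Matrix.add_mul, Matrix.mul_sub,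
      Matrix.sub_mul, gl_inv_mul_cancel, -Matrix.coe_units_inv] using this
  between_NS5_NS5 i hi h h' := by
    have := congrArg (fun M => (g (i + 1)).val * M * (g (i + 1))⁻¹.val)
      (hm.between_NS5_NS5 i hi h h')
    simpa [gauge_smul_def, Matrix.mul_assoc, Matrix.mul_add, Matrix.add_mul, Matrix.mul_sub,
      Matrix.sub_mul, gl_inv_mul_cancel, -Matrix.coe_units_inv] using this
  between_NS5_D5 i hi h h' := by
    have := congrArg (fun M => (g (i + 1)).val * M * (g (i + 1))⁻¹.val)
      (hm.between_NS5_D5 i hi h h')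
    simpa [gauge_smul_def, Matrix.mul_assoc, Matrix.mul_add, Matrix.add_mul, Matrix.mul_sub,
      Matrix.sub_mul, gl_inv_mul_cancel, -Matrix.coe_units_inv] using this
  between_D5_NS5 i hi h h' := by
    have := congrArg (fun M => (g (i + 1)).val * M * (g (i + 1))⁻¹.val)
      (hm.between_D5_NS5 i hi h h')
    simpa [gauge_smul_def, Matrix.mul_assoc, Matrix.mul_add, Matrix.add_mul, Matrix.mul_sub,
      Matrix.sub_mul, gl_inv_mul_cancel, -Matrix.coe_units_inv] using this

lemma IsMomentZero.torus_smul {m : Rep 𝓓} (hm : IsMomentZero m) (t : Torus 𝓓) :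
    IsMomentZero (t • m) where
  threeWay U := by
    have := congrArg (fun M => (t.2 : ℂ) • M) (hm.threeWay U)
    simpa [torus_smul_def, smul_add, smul_sub, smul_smul, mul_assoc, mul_comm, mul_left_comm]
      using this
  between_D5_D5 i hi h h' := by
    have := congrArg (fun M => (t.2 : ℂ) • M) (hm.between_D5_D5 i hi h h')
    simpa [torus_smul_def, smul_add, smul_sub] using this
  between_NS5_NS5 i hi h h' := by
    have := congrArg (fun M => (t.2 : ℂ) • M) (hm.between_NS5_NS5 i hi h h')
    simpa [torus_smul_def, smul_add, smul_sub] using this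
  between_NS5_D5 i hi h h' := by
    have := congrArg (fun M => (t.2 : ℂ) • M) (hm.between_NS5_D5 i hi h h')
    simpa [torus_smul_def, smul_add, smul_sub] using this
  between_D5_NS5 i hi h h' := by
    have := congrArg (fun M => (t.2 : ℂ) • M) (hm.between_D5_NS5 i hi h h')
    simpa [torus_smul_def, smul_add, smul_sub] using this

lemma S1.gauge_smul {m : Rep 𝓓} (hm : S1 m) (g : Gauge 𝓓) : S1 (g • m) := by
  intro U S hB hA hb
  have h := hm U (S.comap (Matrix.mulVecLin (g (right U.1)).val)) ?_ ?_ ?_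
  · rw [eq_bot_iff]
    intro s hs
    have hs' : (g (right U.1))⁻¹.val *ᵥ s ∈
        S.comap (Matrix.mulVecLin (g (right U.1)).val) := by
      simpa [Matrix.mulVec_mulVec] using hs
    rw [h, Submodule.mem_bot] at hs'
    have := congrArg (fun v => (g (right U.1)).val *ᵥ v) hs'
    simpa [Matrix.mulVec_mulVec] using this
  · intro s hs
    have := hB _ (Submodule.mem_comap.1 hs)
    rw [Submodule.mem_comap]
    simpa [gauge_smul_def, Matrix.mul_assoc, Matrix.mulVec_mulVec] using this
  · intro s hs
    have := congrArg (fun v => (g (left U.1))⁻¹.val *ᵥ v) (hA _ (Submodule.mem_comap.1 hs))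
    simpa [gauge_smul_def, Matrix.mul_assoc, Matrix.mulVec_mulVec] using this
  · intro s hs
    have := hb _ (Submodule.mem_comap.1 hs)
    simpa [gauge_smul_def, Matrix.mul_assoc, Matrix.mulVec_mulVec] using this

lemma S2.gauge_smul {m : Rep 𝓓} (hm : S2 m) (g : Gauge 𝓓) : S2 (g • m) := by
  intro U T hB hA ha
  have h := hm U (T.comap (Matrix.mulVecLin (g (left U.1)).val)) ?_ ?_ ?_
  · rw [eq_top_iff]
    intro s _
    have hs' : (g (left U.1))⁻¹.val *ᵥ s ∈
        T.comap (Matrix.mulVecLin (g (left U.1)).val) := by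
      rw [h]; trivial
    simpa [Matrix.mulVec_mulVec] using hs'
  · intro s hs
    have := hB _ (Submodule.mem_comap.1 hs)
    rw [Submodule.mem_comap]
    simpa [gauge_smul_def, Matrix.mul_assoc, Matrix.mulVec_mulVec] using this
  · intro w
    have := hA ((g (right U.1)).val *ᵥ w)
    rw [Submodule.mem_comap]
    simpa [gauge_smul_def, Matrix.mul_assoc, Matrix.mulVec_mulVec] using this
  · intro w
    have := ha w
    rw [Submodule.mem_comap]
    simpa [gauge_smul_def, Matrix.mul_assoc, Matrix.mulVec_mulVec] using this

lemma S1.torus_smul {m : Rep 𝓓} (hm : S1 m) (t : Torus 𝓓) : S1 (t • m) := by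
  intro U S hB hA hb
  refine hm U S (fun s hs => ?_) hA (fun s hs => ?_)
  · have := S.smul_mem (t.2⁻¹ : ℂˣ).val (hB s hs)
    simpa [torus_smul_def, Matrix.smul_mulVec, smul_smul] using this
  · simpa [torus_smul_def, Matrix.smul_mulVec] using hb s hs

lemma S2.torus_smul {m : Rep 𝓓} (hm : S2 m) (t : Torus 𝓓) : S2 (t • m) := by
  intro U T hB hA ha
  refine hm U T (fun s hs => ?_) hA (fun w => ?_)
  · have := T.smul_mem (t.2⁻¹ : ℂˣ).val (hB s hs)
    simpa [torus_smul_def, Matrix.smul_mulVec, smul_smul] using this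
  · have := T.smul_mem (t.1 U).val (ha w)
    simpa [torus_smul_def, Matrix.smul_mulVec, smul_smul] using this

instance : MulAction (Gauge 𝓓) (MTilde 𝓓) where
  smul g m := ⟨g • m.1, m.2.1.gauge_smul g, S1.gauge_smul m.2.2.1 g, S2.gauge_smul m.2.2.2 g⟩
  one_smul m := Subtype.ext (one_smul (Gauge 𝓓) m.1)
  mul_smul g h m := Subtype.ext (mul_smul g h m.1)

instance : MulAction (Torus 𝓓) (MTilde 𝓓) where
  smul t m := ⟨t • m.1, m.2.1.torus_smul t, S1.torus_smul m.2.2.1 t, S2.torus_smul m.2.2.2 t⟩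
  one_smul m := Subtype.ext (one_smul (Torus 𝓓) m.1)
  mul_smul s t m := Subtype.ext (mul_smul s t m.1)

instance : SMulCommClass (Gauge 𝓓) (Torus 𝓓) (MTilde 𝓓) where
  smul_comm g t m := Subtype.ext (smul_comm g t m.1)

/-- The character `χ(g) = ∏ det(g_X)`, over the D3 branes `X` directly to the right of an NS5
brane. -/
def character : Gauge 𝓓 →* ℂˣ where
  toFun g := ∏ V : 𝓓.NS5, Matrix.GeneralLinearGroup.det (g (right V.1))
  map_one' := by simp
  map_mul' g h := by simp [Finset.prod_mul_distrib]

/-- The action `g • (m, z) = (g • m, χ⁻¹(g) z)`. -/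
def liftAct (g : Gauge 𝓓) (p : MTilde 𝓓 × ℂ) : MTilde 𝓓 × ℂ :=
  (g • p.1, ((character g)⁻¹ : ℂˣ).val * p.2)

/-- Stability: for `z ≠ 0` the orbit of `(m, z)` is closed and its stabilizer is finite. (An orbit
is constructible, so being closed means the same in the usual and in the Zariski topology.) -/
def IsStable (m : MTilde 𝓓) : Prop :=
  ∀ z : ℂ, z ≠ 0 →
    IsClosed (Set.range fun g : Gauge 𝓓 => liftAct g (m, z)) ∧
      {g : Gauge 𝓓 | liftAct g (m, z) = (m, z)}.Finite

lemma liftAct_mul (g h : Gauge 𝓓) (p : MTilde 𝓓 × ℂ) :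
    liftAct (g * h) p = liftAct g (liftAct h p) := by
  simp [liftAct, mul_smul, mul_comm, mul_left_comm]

lemma liftAct_one (p : MTilde 𝓓 × ℂ) : liftAct 1 p = p := by
  simp [liftAct]

lemma IsStable.gauge_smul {m : MTilde 𝓓} (hm : IsStable m) (g : Gauge 𝓓) :
    IsStable (g • m) := by
  intro z hz
  have key : liftAct g (m, (character g).val * z) = (g • m, z) := by
    simp [liftAct]
  obtain ⟨h1, h2⟩ := hm ((character g).val * z) (by simp [hz])
  refine ⟨?_, ?_⟩
  · convert h1 using 1
    ext p
    constructor
    · rintro ⟨k, rfl⟩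
      exact ⟨k * g, by simp only [liftAct_mul, key]⟩
    · rintro ⟨k, rfl⟩
      refine ⟨k * g⁻¹, ?_⟩
      simp only [liftAct_mul, ← key]
      rw [← liftAct_mul g⁻¹ g, inv_mul_cancel, liftAct_one]
  · refine (h2.image fun k => g * k * g⁻¹).subset fun k hk => ⟨g⁻¹ * k * g, ?_, by group⟩
    change liftAct k _ = _ at hk
    change liftAct _ _ = _
    rw [liftAct_mul, liftAct_mul, key, hk, ← key, ← liftAct_mul g⁻¹ g, inv_mul_cancel, liftAct_one]

lemma continuous_torus_smul (t : Torus 𝓓) : Continuous fun m : Rep 𝓓 => t • m := by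
  have h : Continuous fun m : Rep 𝓓 => (m.A, m.b, m.a, m.B, m.B', m.C, m.D) :=
    continuous_induced_dom
  refine continuous_induced_rng.2 ?_
  simp only [continuous_prodMk] at h
  obtain ⟨hA, hb, ha, hB, hB', hC, hD⟩ := h
  simp only [Function.comp_def, torus_smul_def, torusAct, continuous_prodMk]
  refine ⟨hA, ?_, ?_, ?_, ?_, ?_, hD⟩
  · exact continuous_pi fun U => (continuous_const_smul _).comp ((continuous_apply U).comp hb)
  · exact continuous_pi fun U => (continuous_const_smul _).comp ((continuous_apply U).comp ha)
  · exact continuous_pi fun U => (continuous_const_smul _).comp ((continuous_apply U).comp hB)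
  · exact continuous_pi fun U => (continuous_const_smul _).comp ((continuous_apply U).comp hB')
  · exact continuous_pi fun U => (continuous_const_smul _).comp ((continuous_apply U).comp hC)

/-- The action of `t ∈ 𝕋` on the first factor, as a homeomorphism. -/
def torusHomeo (t : Torus 𝓓) : MTilde 𝓓 × ℂ ≃ₜ MTilde 𝓓 × ℂ where
  toFun p := (t • p.1, p.2)
  invFun p := (t⁻¹ • p.1, p.2)
  left_inv p := by simp
  right_inv p := by simp
  continuous_toFun := by
    refine Continuous.prodMk ?_ continuous_snd
    exact Continuous.subtype_mk
      ((continuous_torus_smul t).comp (continuous_subtype_val.comp continuous_fst)) _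
  continuous_invFun := by
    refine Continuous.prodMk ?_ continuous_snd
    exact Continuous.subtype_mk
      ((continuous_torus_smul t⁻¹).comp (continuous_subtype_val.comp continuous_fst)) _

lemma torusHomeo_liftAct (t : Torus 𝓓) (g : Gauge 𝓓) (p : MTilde 𝓓 × ℂ) :
    torusHomeo t (liftAct g p) = liftAct g (torusHomeo t p) := by
  simp [torusHomeo, liftAct, smul_comm]

lemma IsStable.torus_smul {m : MTilde 𝓓} (hm : IsStable m) (t : Torus 𝓓) :
    IsStable (t • m) := by
  intro z hz
  have key : (t • m, z) = torusHomeo t (m, z) := rfl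
  obtain ⟨h1, h2⟩ := hm z hz
  refine ⟨?_, ?_⟩
  · have := (torusHomeo t).isClosedMap _ h1
    rw [← Set.range_comp] at this
    simpa only [Function.comp_def, torusHomeo_liftAct, key] using this
  · simpa only [key, ← torusHomeo_liftAct, (torusHomeo t).injective.eq_iff] using h2

/-- The set of stable points. -/
def Stable (𝓓 : BraneDiagram) : Type := {m : MTilde 𝓓 // IsStable m}

instance : MulAction (Gauge 𝓓) (Stable 𝓓) where
  smul g m := ⟨g • m.1, m.2.gauge_smul g⟩
  one_smul m := Subtype.ext (one_smul (Gauge 𝓓) m.1)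
  mul_smul g h m := Subtype.ext (mul_smul g h m.1)

instance : MulAction (Torus 𝓓) (Stable 𝓓) where
  smul t m := ⟨t • m.1, m.2.torus_smul t⟩
  one_smul m := Subtype.ext (one_smul (Torus 𝓓) m.1)
  mul_smul s t m := Subtype.ext (mul_smul s t m.1)

instance : SMulCommClass (Gauge 𝓓) (Torus 𝓓) (Stable 𝓓) where
  smul_comm g t m := Subtype.ext (smul_comm g t m.1)

/-- The (set of points of the) bow variety `Ch(𝓓)`. -/
def BowVariety (𝓓 : BraneDiagram) : Type := MulAction.orbitRel.Quotient (Gauge 𝓓) (Stable 𝓓)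

/-- The point of the bow variety represented by a stable point. -/
def BowVariety.mk (m : Stable 𝓓) : BowVariety 𝓓 :=
  Quotient.mk (MulAction.orbitRel (Gauge 𝓓) (Stable 𝓓)) m

/-- The torus action on the bow variety: `t • [m] = [t • m]`. -/
instance : MulAction (Torus 𝓓) (BowVariety 𝓓) where
  smul t := Quotient.map (fun m => t • m) (by
    rintro m _ ⟨g, rfl⟩
    exact ⟨g, smul_comm g t _⟩)
  one_smul := by
    rintro ⟨m⟩
    exact congrArg BowVariety.mk (one_smul (Torus 𝓓) m)
  mul_smul s t := by
    rintro ⟨m⟩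
    exact congrArg BowVariety.mk (mul_smul s t m)

/-! ## Tie diagrams and butterfly diagrams -/

/-- The pair `(V, U)` of 5-branes covers the D3 brane `j`: the D3 brane `j` lies between them. -/
def Covers (V : 𝓓.NS5) (U : 𝓓.D5) (j : ℕ) : Prop :=
  (V.1.1 < j ∧ j ≤ U.1.1) ∨ (U.1.1 < j ∧ j ≤ V.1.1)

instance (V : 𝓓.NS5) (U : 𝓓.D5) (j : ℕ) : Decidable (Covers V U j) :=
  inferInstanceAs (Decidable (_ ∨ _))

/-- A tie diagram: a set of pairs ("ties") of an NS5 brane and a D5 brane that covers each D3 brane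
as many times as its multiplicity. -/
@[ext]
structure TieDiagram (𝓓 : BraneDiagram) where
  ties : Finset (𝓓.NS5 × 𝓓.D5)
  card_covers : ∀ j : ℕ, (ties.filter fun p => Covers p.1 p.2 j).card = 𝓓.mult j

namespace TieDiagram

/-- The table of a tie diagram: an entry `(V, U)` with `V` left of `U` is `1` if `V` and `U` are
tied and `0` otherwise; an entry with `V` right of `U` is `0` if they are tied and `1` otherwise. -/
def table (τ : TieDiagram 𝓓) : Matrix 𝓓.NS5 𝓓.D5 ℤ := fun V U =>
  if V.1 < U.1 then (if (V, U) ∈ τ.ties then 1 else 0) else (if (V, U) ∈ τ.ties then 0 else 1)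

/-- The height of the column of dots below the D3 brane `j` in the butterfly of `U`: the number of
ties at `U` that cover `j`. -/
def height (τ : TieDiagram 𝓓) (U : 𝓓.D5) (j : ℕ) : ℕ :=
  (Finset.univ.filter fun V : 𝓓.NS5 => (V, U) ∈ τ.ties ∧ Covers V U j).card

/-- The vertical position of the bottom of the column below the D3 brane `j` in the butterfly of
`U`. The columns below `U⁻` and `U⁺` have their bottoms at `0`, and the other columns are aligned
as described by the six lemmas that follow. -/
def bottom (τ : TieDiagram 𝓓) (U : 𝓓.D5) (j : ℕ) : ℤ :=
  if U.1.1 < j then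
    ∑ V : 𝓓.NS5, if U.1.1 < V.1.1 ∧ V.1.1 < j then
      (τ.height U (left V.1) : ℤ) - τ.height U (right V.1) else 0
  else
    ∑ V : 𝓓.NS5, if j ≤ V.1.1 ∧ V.1.1 < U.1.1 then
      (τ.height U (right V.1) : ℤ) - τ.height U (left V.1) - 1 else 0

/-- The vertical position of the top dot of a (non-empty) column. -/
def top (τ : TieDiagram 𝓓) (U : 𝓓.D5) (j : ℕ) : ℤ := τ.bottom U j + τ.height U j - 1

lemma bottom_left_self (τ : TieDiagram 𝓓) (U : 𝓓.D5) : τ.bottom U (left U.1) = 0 := by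
  rw [bottom, if_neg (lt_irrefl _)]
  exact Finset.sum_eq_zero fun V _ => if_neg (by simp only [left]; omega)

lemma bottom_right_self (τ : TieDiagram 𝓓) (U : 𝓓.D5) : τ.bottom U (right U.1) = 0 := by
  rw [bottom, if_pos (Nat.lt_succ_self _)]
  exact Finset.sum_eq_zero fun V _ => if_neg (by simp only [right]; omega)

/-- Right of `U`, two columns separated by a D5 brane are aligned from the bottom. -/
lemma bottom_right_of_D5 (τ : TieDiagram 𝓓) (U U' : 𝓓.D5) (h : U.1 < U'.1) :
    τ.bottom U (right U'.1) = τ.bottom U (left U'.1) := by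
  have h' : U.1.1 < U'.1.1 := h
  rw [bottom, bottom, if_pos (by simp only [right]; omega), if_pos (by simpa using h')]
  refine Finset.sum_congr rfl fun V _ => ?_
  have hne : V.1.1 ≠ U'.1.1 := fun e => by
    have := V.2; rw [Fin.ext e, U'.2] at this; cases this
  refine if_congr ?_ rfl rfl
  simp only [left, right]; omega

/-- Left of `U`, two columns separated by a D5 brane are aligned from the bottom. -/
lemma bottom_left_of_D5 (τ : TieDiagram 𝓓) (U U' : 𝓓.D5) (h : U'.1 < U.1) :
    τ.bottom U (right U'.1) = τ.bottom U (left U'.1) := by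
  have h' : U'.1.1 < U.1.1 := h
  rw [bottom, bottom, if_neg (by simp only [right]; omega), if_neg (by simp only [left]; omega)]
  refine Finset.sum_congr rfl fun V _ => ?_
  have hne : V.1.1 ≠ U'.1.1 := fun e => by
    have := V.2; rw [Fin.ext e, U'.2] at this; cases this
  refine if_congr ?_ rfl rfl
  simp only [left, right]; omega

/-- Right of `U`, two columns separated by an NS5 brane are aligned from the top. -/
lemma top_right_of_NS5 (τ : TieDiagram 𝓓) (U : 𝓓.D5) (V : 𝓓.NS5) (h : U.1 < V.1) :
    τ.top U (right V.1) = τ.top U (left V.1) := by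
  have h' : U.1.1 < V.1.1 := h
  have key : τ.bottom U (right V.1) = τ.bottom U (left V.1) +
      ((τ.height U (left V.1) : ℤ) - τ.height U (right V.1)) := by
    rw [bottom, bottom, if_pos (by simp only [right]; omega), if_pos (by simpa using h')]
    rw [← Finset.add_sum_erase _ _ (Finset.mem_univ V), ← Finset.add_sum_erase (a := V)
      (f := fun V' : 𝓓.NS5 => if U.1.1 < V'.1.1 ∧ V'.1.1 < left V.1 then
        (τ.height U (left V'.1) : ℤ) - τ.height U (right V'.1) else 0) _ (Finset.mem_univ V),
      if_pos ⟨h', Nat.lt_succ_self _⟩, if_neg (by simp only [left]; omega), zero_add, add_comm]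
    congr 1
    refine Finset.sum_congr rfl fun V' hV' => ?_
    have hne : V'.1.1 ≠ V.1.1 := fun e =>
      (Finset.mem_erase.1 hV').1 (Subtype.ext (Fin.ext e))
    refine if_congr ?_ rfl rfl
    simp only [left, right]; omega
  rw [top, top, key]; ring

/-- Left of `U`, for two columns separated by an NS5 brane, the top of the left one is one unit
below the top of the right one. -/
lemma top_left_of_NS5 (τ : TieDiagram 𝓓) (U : 𝓓.D5) (V : 𝓓.NS5) (h : V.1 < U.1) :
    τ.top U (left V.1) = τ.top U (right V.1) - 1 := by
  have h' : V.1.1 < U.1.1 := h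
  have key : τ.bottom U (left V.1) = τ.bottom U (right V.1) +
      ((τ.height U (right V.1) : ℤ) - τ.height U (left V.1) - 1) := by
    rw [bottom, bottom, if_neg (by simp only [left]; omega), if_neg (by simp only [right]; omega)]
    rw [← Finset.add_sum_erase _ _ (Finset.mem_univ V), ← Finset.add_sum_erase (a := V)
      (f := fun V' : 𝓓.NS5 => if right V.1 ≤ V'.1.1 ∧ V'.1.1 < U.1.1 then
        (τ.height U (right V'.1) : ℤ) - τ.height U (left V'.1) - 1 else 0) _ (Finset.mem_univ V),
      if_pos ⟨le_rfl, h'⟩, if_neg (by simp only [right]; omega), zero_add, add_comm]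
    congr 1
    refine Finset.sum_congr rfl fun V' hV' => ?_
    have hne : V'.1.1 ≠ V.1.1 := fun e =>
      (Finset.mem_erase.1 hV').1 (Subtype.ext (Fin.ext e))
    refine if_congr ?_ rfl rfl
    simp only [left, right]; omega
  rw [top, top, key]; ring

/-- The dots below the D3 brane `j`, in the butterflies of all D5 branes: a dot is given by the D5
brane and by its place in the column, counted from the bottom. -/
abbrev Dot (τ : TieDiagram 𝓓) (j : ℕ) : Type := Σ U : 𝓓.D5, Fin (τ.height U j)

/-- The vertical position of a dot. -/
def level {τ : TieDiagram 𝓓} {j : ℕ} (p : τ.Dot j) : ℤ := τ.bottom p.1 j + (p.2 : ℕ)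

lemma card_dot (τ : TieDiagram 𝓓) (j : ℕ) : Fintype.card (τ.Dot j) = 𝓓.mult j := by
  rw [← τ.card_covers j, Fintype.card_sigma]
  simp only [Fintype.card_fin]
  simp only [height]
  rw [← Finset.card_sigma]
  refine Finset.card_bij' (fun x _ => (x.2, x.1)) (fun p _ => ⟨p.2, p.1⟩) ?_ ?_ ?_ ?_ <;>
    simp

/-- An identification, for every D3 brane `j`, of the basis of `W_j` with the dots below `j`. -/
abbrev Labelling (τ : TieDiagram 𝓓) : Type := ∀ j : ℕ, 𝓓.W j ≃ τ.Dot j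

instance (τ : TieDiagram 𝓓) : Nonempty τ.Labelling :=
  ⟨fun j => (Fintype.equivFinOfCardEq (τ.card_dot j)).symm⟩

/-- The linear maps of the butterfly diagram of a tie diagram: `A`, `-B`, `-B'`, `C`, `D` map dots
to dots of the same butterfly along horizontal, downward, downward, left-and-down and horizontal
arrows; `a U` maps `1` to the top dot below `U⁻` in the butterfly of `U`, and `-b U` maps the dot
below `U⁺` in the butterfly of `U` that is one higher than that top dot to `1`. -/
def butterfly (τ : TieDiagram 𝓓) (e : τ.Labelling) : Rep 𝓓 where
  A := fun _ p q => if (e _ p).1 = (e _ q).1 ∧ level (e _ p) = level (e _ q) then 1 else 0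
  b := fun U _ q => if (e _ q).1 = U ∧ level (e _ q) = τ.top U (left U.1) + 1 then -1 else 0
  a := fun U p _ => if (e _ p).1 = U ∧ level (e _ p) = τ.top U (left U.1) then 1 else 0
  B := fun _ p q => if (e _ p).1 = (e _ q).1 ∧ level (e _ p) = level (e _ q) - 1 then -1 else 0
  B' := fun _ p q => if (e _ p).1 = (e _ q).1 ∧ level (e _ p) = level (e _ q) - 1 then -1 else 0
  C := fun _ p q => if (e _ p).1 = (e _ q).1 ∧ level (e _ p) = level (e _ q) - 1 then 1 else 0
  D := fun _ p q => if (e _ p).1 = (e _ q).1 ∧ level (e _ p) = level (e _ q) then 1 else 0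

end TieDiagram

/-- The point `m` of `𝕄` is a stable point of `μ⁻¹(0)` with (S1) and (S2), and it represents the
point `f` of the bow variety. -/
def Represents (m : Rep 𝓓) (f : BowVariety 𝓓) : Prop :=
  ∃ s : Stable 𝓓, s.1.1 = m ∧ BowVariety.mk s = f

end BraneDiagram

end

open scoped Matrix

noncomputable section

namespace BraneDiagram

variable {𝓓 : BraneDiagram}

section

/-! ## Graded subspaces and the numerical form of stability -/

/-! Stability is first made numerical. A point of `MTilde` is stable iff it is `Costable`: no proper
graded subspace `T` contains the images of the `a`, is invariant under the other maps, and has `A`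
injective on the quotient. Given such a `T`, the one-parameter subgroup that is `1` on `T` and `t⁻¹`
on a complement has a limit inside `MTilde`, while `χ⁻¹` tends to zero if `T` is proper
(`IsStable.costable`). Conversely, a limit of gauge transformations along an orbit either stays
invertible or, after rescaling, becomes a nonzero intertwiner whose factor on `a`, `b` is zero; the
kernel of the latter would be a forbidden `T` (`IsHom.eq_zero`, `isClosed_orbit`). The same kernel
argument shows that stabilizers are trivial.

Butterfly diagrams satisfy the equations, (S1), (S2) and the criterion by direct inspection of dots,
and a diagonal gauge transformation compensates the torus (`torus_smul_butterfly`). As stabilizers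
are trivial, the compensating transformations of two butterfly diagrams in one orbit are conjugate.
Their traces give the heights of all columns, and the heights give the ties.

For the converse, one generic torus element suffices. The gauge transformation `g` that compensates
it splits every `W_j` into generalized eigenspaces, and `a U`, `b U` see only the weights `μ U 0`,
`μ U 1`. Starting from `a_U(1)`, vectors of weights `μ U ℓ` are transported away from `U`, by `A`
and `C` to the left and by `D` and inverse images under `A` to the right. (S2) makes the inverse
images exist across D5 branes other than `U`, and (S1) makes them unique. The span of all these
vectors is a subspace of the kind tested by `Costable`, so it is everything (`wingSpan_eq_top`), and
distinct eigenvalues make the nonzero vectors a basis. In each column their levels form an interval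
whose length changes by at most one across an NS5 brane. The jumps are the ties, and the vectors
form a frame (`isFrame_wing`), which is an isomorphism with a butterfly diagram.

The statement on tables is a count: row and column sums of a table record the jumps of the covering
numbers across the 5-branes (`tableOf_mem_BCT_iff`). -/

/-- A graded subspace that contains the images of all `a U`, is invariant under all other maps, and
on whose quotient all maps `A U` are injective. -/
structure IsSub (m : Rep 𝓓) (T : ∀ j, Submodule ℂ (𝓓.W j → ℂ)) : Prop where
  a : ∀ U w, m.a U *ᵥ w ∈ T (left U.1)
  A : ∀ U : 𝓓.D5, ∀ w ∈ T (right U.1), m.A U *ᵥ w ∈ T (left U.1)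
  A_inv : ∀ U w, m.A U *ᵥ w ∈ T (left U.1) → w ∈ T (right U.1)
  B : ∀ U : 𝓓.D5, ∀ w ∈ T (left U.1), m.B U *ᵥ w ∈ T (left U.1)
  B' : ∀ U : 𝓓.D5, ∀ w ∈ T (right U.1), m.B' U *ᵥ w ∈ T (right U.1)
  C : ∀ V : 𝓓.NS5, ∀ w ∈ T (right V.1), m.C V *ᵥ w ∈ T (left V.1)
  D : ∀ V : 𝓓.NS5, ∀ w ∈ T (left V.1), m.D V *ᵥ w ∈ T (right V.1)

/-- The numerical criterion for stability. -/
def Costable (m : Rep 𝓓) : Prop :=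
  ∀ T : ∀ j, Submodule ℂ (𝓓.W j → ℂ), IsSub m T → ∀ j, T j = ⊤

/-- `φ` intertwines the maps `A, B, B', C, D` of two representations, and the maps `a`, `b` up to
the factor `c`. -/
structure IsHom (c : ℂ) (m m' : Rep 𝓓) (φ : ∀ j, Matrix (𝓓.W j) (𝓓.W j) ℂ) : Prop where
  A : ∀ U, φ (left U.1) * m.A U = m'.A U * φ (right U.1)
  b : ∀ U, m'.b U * φ (right U.1) = c • m.b U
  a : ∀ U, φ (left U.1) * m.a U = c • m'.a U
  B : ∀ U, φ (left U.1) * m.B U = m'.B U * φ (left U.1)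
  B' : ∀ U, φ (right U.1) * m.B' U = m'.B' U * φ (right U.1)
  C : ∀ V, φ (left V.1) * m.C V = m'.C V * φ (right V.1)
  D : ∀ V, φ (right V.1) * m.D V = m'.D V * φ (left V.1)

lemma isHom_gauge (g : Gauge 𝓓) (m : Rep 𝓓) : IsHom 1 m (g • m) fun j => (g j).val := by
  constructor <;> intro U <;>
    simp [gauge_smul_def, Matrix.mul_assoc, -Matrix.coe_units_inv]

lemma smul_eq_of_isHom {g : Gauge 𝓓} {m m' : Rep 𝓓} (h : IsHom 1 m m' fun j => (g j).val) :
    g • m = m' := by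
  have hinv : ∀ {j : ℕ} {κ : Type} (M : Matrix κ (𝓓.W j) ℂ),
      M * (g j).val * (g j)⁻¹.val = M := fun M => by
    rw [Matrix.mul_assoc, Units.mul_inv, Matrix.mul_one]
  rw [gauge_smul_def]
  ext1 <;> funext U
  · rw [gaugeAct_A, h.A, hinv]
  · rw [gaugeAct_b, ← one_smul ℂ (m.b U), ← h.b, hinv]
  · rw [gaugeAct_a, h.a, one_smul]
  · rw [gaugeAct_B, h.B, hinv]
  · rw [gaugeAct_B', h.B', hinv]
  · rw [gaugeAct_C, h.C, hinv]
  · rw [gaugeAct_D, h.D, hinv]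

lemma IsHom.sub {c c' : ℂ} {m m' : Rep 𝓓} {φ ψ : ∀ j, Matrix (𝓓.W j) (𝓓.W j) ℂ}
    (h : IsHom c m m' φ) (h' : IsHom c' m m' ψ) : IsHom (c - c') m m' fun j => φ j - ψ j := by
  constructor <;> intro U <;> simp only [Matrix.sub_mul, Matrix.mul_sub, sub_smul]
  · rw [h.A, h'.A]
  · rw [h.b, h'.b]
  · rw [h.a, h'.a]
  · rw [h.B, h'.B]
  · rw [h.B', h'.B']
  · rw [h.C, h'.C]
  · rw [h.D, h'.D]

lemma IsMomentZero.A_mulVec_B' {m : Rep 𝓓} (hm : IsMomentZero m) (U : 𝓓.D5)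
    (w : 𝓓.W (right U.1) → ℂ) :
    m.A U *ᵥ (m.B' U *ᵥ w) = m.B U *ᵥ (m.A U *ᵥ w) + m.a U *ᵥ (m.b U *ᵥ w) := by
  have h := congrArg (fun M => M *ᵥ w) (hm.threeWay U)
  simp only [Matrix.add_mulVec, Matrix.sub_mulVec, Matrix.zero_mulVec] at h
  simp only [Matrix.mulVec_mulVec]
  rw [← sub_eq_zero, ← neg_eq_zero, ← h]; abel

lemma mulVec_eq {κ ι ι' η : Type*} [Fintype κ] [Fintype ι] [Fintype ι'] {M : Matrix η κ ℂ}
    {N : Matrix κ ι ℂ} {M' : Matrix η ι' ℂ} {N' : Matrix ι' ι ℂ} (h : M * N = M' * N')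
    (w : ι → ℂ) : M *ᵥ (N *ᵥ w) = M' *ᵥ (N' *ᵥ w) := by
  rw [Matrix.mulVec_mulVec, h, Matrix.mulVec_mulVec]

/-- The kernels of `φ` form a subspace of the kind tested by `Costable`: the factor `0` puts the
images of `a` into them. Injectivity of `A` on the quotient comes from (S1) of the target. There `im
φ ∩ ker A` is stable under `B'`, because `A B' = B A + a b` and `b` vanishes on `im φ`. -/
lemma IsHom.eq_zero {m m' : Rep 𝓓} {φ : ∀ j, Matrix (𝓓.W j) (𝓓.W j) ℂ} (h : IsHom 0 m m' φ)
    (hm : Costable m) (hm' : IsMomentZero m') (hS : S1 m') (j : ℕ) : φ j = 0 := by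
  have key := hm (fun j => LinearMap.ker (φ j).mulVecLin) ?_ j
  · ext1 p q
    have : Pi.single q 1 ∈ LinearMap.ker (φ j).mulVecLin := key ▸ Submodule.mem_top
    simpa using congrFun this p
  · constructor <;> simp only [LinearMap.mem_ker, Matrix.mulVecLin_apply]
    · intro U w
      rw [Matrix.mulVec_mulVec, h.a, zero_smul, Matrix.zero_mulVec]
    · intro U w hw
      rw [mulVec_eq (h.A U), hw, Matrix.mulVec_zero]
    · intro U w hw
      rw [mulVec_eq (h.A U)] at hw
      have hb : ∀ w, m'.b U *ᵥ (φ (right U.1) *ᵥ w) = 0 := fun w => by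
        rw [Matrix.mulVec_mulVec, h.b, zero_smul, Matrix.zero_mulVec]
      have hmem : φ (right U.1) *ᵥ w ∈ LinearMap.range (φ (right U.1)).mulVecLin ⊓
          LinearMap.ker (m'.A U).mulVecLin := ⟨⟨w, rfl⟩, hw⟩
      have hbot := hS U (LinearMap.range (φ (right U.1)).mulVecLin ⊓
          LinearMap.ker (m'.A U).mulVecLin) ?_ ?_ ?_
      · rw [hbot] at hmem
        simpa using hmem
      · rintro _ ⟨⟨s, rfl⟩, hs⟩
        refine ⟨⟨m.B' U *ᵥ s, ?_⟩, ?_⟩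
        · simp [h.B']
        · change m'.A U *ᵥ _ = 0 at hs
          change m'.A U *ᵥ (m'.B' U *ᵥ _) = 0
          rw [hm'.A_mulVec_B', hs, Matrix.mulVecLin_apply, hb]; simp
      · exact fun s hs => hs.2
      · rintro _ ⟨⟨s, rfl⟩, -⟩
        exact hb s
    · intro U w hw
      rw [mulVec_eq (h.B U), hw, Matrix.mulVec_zero]
    · intro U w hw
      rw [mulVec_eq (h.B' U), hw, Matrix.mulVec_zero]
    · intro U w hw
      rw [mulVec_eq (h.C U), hw, Matrix.mulVec_zero]
    · intro U w hw
      rw [mulVec_eq (h.D U), hw, Matrix.mulVec_zero]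

/-- The difference of two intertwiners with factor `1` has factor `0`, hence vanishes. -/
lemma Costable.eq_of_smul_eq {m : Rep 𝓓} (hc : Costable m) (hm : IsMomentZero m) (hS : S1 m)
    {g h : Gauge 𝓓} (e : g • m = h • m) : g = h := by
  have key : IsHom 0 m (h • m) fun j => (g j).val - (h j).val := by
    have := (isHom_gauge g m).sub (e ▸ isHom_gauge h m)
    rwa [sub_self, e] at this
  funext j
  exact Units.ext (sub_eq_zero.1 (key.eq_zero hc (hm.gauge_smul h) (hS.gauge_smul h) j))

lemma mult_eq_zero {j : ℕ} (h : j = 0 ∨ 𝓓.size ≤ j) : 𝓓.mult j = 0 := by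
  rcases h with rfl | h
  · exact 𝓓.mult_zero
  · exact 𝓓.mult_of_size_le _ h

/-- A property of D3 branes that holds for the outer ones and passes from left to right
across all 5-branes holds for all D3 branes. -/
lemma induction_right {P : ℕ → Prop} (h0 : ∀ j, j = 0 ∨ 𝓓.size ≤ j → P j)
    (hD : ∀ U : 𝓓.D5, P (left U.1) → P (right U.1))
    (hN : ∀ V : 𝓓.NS5, P (left V.1) → P (right V.1)) (j : ℕ) : P j := by
  induction j with
  | zero => exact h0 _ (Or.inl rfl)
  | succ j ih =>
    rcases lt_or_ge j 𝓓.size with hj | hj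
    · rcases hk : 𝓓.kind ⟨j, hj⟩ with _ | _
      · exact hD ⟨⟨j, hj⟩, hk⟩ ih
      · exact hN ⟨⟨j, hj⟩, hk⟩ ih
    · exact h0 _ (Or.inr (by omega))

/-- The mirror image of `induction_right`. -/
lemma induction_left {P : ℕ → Prop} (h0 : ∀ j, 𝓓.size ≤ j → P j)
    (hD : ∀ U : 𝓓.D5, P (right U.1) → P (left U.1))
    (hN : ∀ V : 𝓓.NS5, P (right V.1) → P (left V.1)) (j : ℕ) : P j := by
  rcases le_or_gt 𝓓.size j with hj | hj
  · exact h0 _ hj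
  · refine Nat.decreasingInduction (n := 𝓓.size) (motive := fun j _ => P j) ?_
      (h0 _ le_rfl) hj.le
    intro j hj ih
    rcases hk : 𝓓.kind ⟨j, hj⟩ with _ | _
    · exact hD ⟨⟨j, hj⟩, hk⟩ ih
    · exact hN ⟨⟨j, hj⟩, hk⟩ ih

lemma subsingleton_of_mult {j : ℕ} (h : 𝓓.mult j = 0) : Subsingleton (𝓓.W j → ℂ) :=
  ⟨fun x y => funext fun i => absurd i.2 (by omega)⟩

/-! ### The criterion implies stability -/

lemma continuous_rep : Continuous fun m : Rep 𝓓 => (m.A, m.b, m.a, m.B, m.B', m.C, m.D) :=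
  continuous_induced_dom

lemma tendsto_mul {α : Type*} {f : Filter α} {κ ι η : Type*} [Fintype ι]
    {M : α → Matrix κ ι ℂ} {N : α → Matrix ι η ℂ} {M₀ : Matrix κ ι ℂ} {N₀ : Matrix ι η ℂ}
    (hM : Filter.Tendsto M f (nhds M₀)) (hN : Filter.Tendsto N f (nhds N₀)) :
    Filter.Tendsto (fun x => M x * N x) f (nhds (M₀ * N₀)) := by
  refine tendsto_pi_nhds.2 fun i => tendsto_pi_nhds.2 fun j => ?_
  simp only [Matrix.mul_apply]
  exact tendsto_finsetSum _ fun k _ => Filter.Tendsto.mul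
    (tendsto_pi_nhds.1 (tendsto_pi_nhds.1 hM i) k) (tendsto_pi_nhds.1 (tendsto_pi_nhds.1 hN k) j)

lemma isHom_of_tendsto {α : Type*} {f : Filter α} [f.NeBot] {c : α → ℂ} {c₀ : ℂ} {m : Rep 𝓓}
    {m' : α → Rep 𝓓} {m₀ : Rep 𝓓} {φ : α → ∀ j, Matrix (𝓓.W j) (𝓓.W j) ℂ}
    {φ₀ : ∀ j, Matrix (𝓓.W j) (𝓓.W j) ℂ} (h : ∀ x, IsHom (c x) m (m' x) (φ x))
    (hc : Filter.Tendsto c f (nhds c₀)) (hm : Filter.Tendsto m' f (nhds m₀))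
    (hφ : ∀ j, Filter.Tendsto (fun x => φ x j) f (nhds (φ₀ j))) : IsHom c₀ m m₀ φ₀ := by
  have H := (continuous_rep (𝓓 := 𝓓)).tendsto m₀ |>.comp hm
  simp only [Function.comp_def, Prod.tendsto_iff, tendsto_pi_nhds (Y := _)] at H
  have lim := fun {κ ι : Type} {F G : α → Matrix κ ι ℂ} {F₀ G₀ : Matrix κ ι ℂ}
    (hF : Filter.Tendsto F f (nhds F₀)) (hG : Filter.Tendsto G f (nhds G₀))
    (e : ∀ x, F x = G x) => tendsto_nhds_unique (hF.congr e) hG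
  constructor <;> intro U
  · exact lim (tendsto_mul (hφ _) tendsto_const_nhds)
      (tendsto_mul (H.1 U) (hφ _)) fun x => (h x).A U
  · exact lim (tendsto_mul (H.2.1 U) (hφ _))
      (hc.smul tendsto_const_nhds) fun x => (h x).b U
  · exact lim (tendsto_mul (hφ _) tendsto_const_nhds)
      (hc.smul (H.2.2.1 U)) fun x => (h x).a U
  · exact lim (tendsto_mul (hφ _) tendsto_const_nhds)
      (tendsto_mul (H.2.2.2.1 U) (hφ _)) fun x => (h x).B U
  · exact lim (tendsto_mul (hφ _) tendsto_const_nhds)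
      (tendsto_mul (H.2.2.2.2.1 U) (hφ _)) fun x => (h x).B' U
  · exact lim (tendsto_mul (hφ _) tendsto_const_nhds)
      (tendsto_mul (H.2.2.2.2.2.1 U) (hφ _)) fun x => (h x).C U
  · exact lim (tendsto_mul (hφ _) tendsto_const_nhds)
      (tendsto_mul (H.2.2.2.2.2.2 U) (hφ _)) fun x => (h x).D U

/-- This is why `IsHom` carries a factor: gauge transformations that tend to infinity, divided by
their norm, have factors that tend to zero. -/
lemma IsHom.smul {c : ℂ} {m m' : Rep 𝓓} {φ : ∀ j, Matrix (𝓓.W j) (𝓓.W j) ℂ}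
    (h : IsHom c m m' φ) (s : ℂ) : IsHom (s * c) m m' fun j => s • φ j := by
  constructor <;> intro U <;> simp only [Matrix.smul_mul, Matrix.mul_smul, mul_smul]
  · rw [h.A]
  · rw [h.b]
  · rw [h.a]
  · rw [h.B]
  · rw [h.B']
  · rw [h.C]
  · rw [h.D]

end

section

/-! ### Limits of gauge transformations along an orbit -/

/-- The entries of the matrices of a gauge transformation. -/
def entries (g : Gauge 𝓓) : ∀ j : Fin 𝓓.size, 𝓓.W j → 𝓓.W j → ℂ := fun j p q => (g j).val p q

/-- A family of matrices with given entries for the inner D3 branes. -/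
def ofEntries (x : ∀ j : Fin 𝓓.size, 𝓓.W j → 𝓓.W j → ℂ) (j : ℕ) : Matrix (𝓓.W j) (𝓓.W j) ℂ :=
  if h : j < 𝓓.size then Matrix.of (x ⟨j, h⟩) else 0

/-- Only finitely many D3 branes carry a nonzero space, so compactness can be used in the
finite-dimensional space of `entries`; the matrices left out are empty. -/
lemma tendsto_ofEntries {α : Type*} {f : Filter α} {c : α → ℂ} {g : α → Gauge 𝓓}
    {x : ∀ j : Fin 𝓓.size, 𝓓.W j → 𝓓.W j → ℂ}
    (h : Filter.Tendsto (fun s => c s • entries (g s)) f (nhds x)) (j : ℕ) :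
    Filter.Tendsto (fun s => c s • (g s j).val) f (nhds (ofEntries x j)) := by
  rw [ofEntries]
  split_ifs with hj
  · exact tendsto_pi_nhds.1 h ⟨j, hj⟩
  · have : IsEmpty (𝓓.W j) := by
      rw [W, 𝓓.mult_of_size_le j (not_lt.1 hj)]; infer_instance
    exact tendsto_pi_nhds.2 fun i => isEmptyElim i

/-- The determinants controlled by `χ` suffice. Across a D5 brane `U`, if `φ` is injective at `U⁻`,
then `ker φ` at `U⁺` is killed by `A` and by `b` and stable under `B'`, so (S1) of the source makes
it zero. -/
lemma det_ne_zero_of_isHom {m m' : Rep 𝓓} {φ : ∀ j, Matrix (𝓓.W j) (𝓓.W j) ℂ}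
    (h : IsHom 1 m m' φ) (hS : S1 m)
    (hdet : ∀ V : 𝓓.NS5, (φ (right V.1)).det ≠ 0) (j : ℕ) : (φ j).det ≠ 0 := by
  refine induction_right (P := fun j => (φ j).det ≠ 0) (fun j hj => ?_) (fun U hU => ?_)
    (fun V _ => hdet V) j
  · have : IsEmpty (𝓓.W j) := by rw [W, mult_eq_zero hj]; infer_instance
    simp
  · intro h0
    obtain ⟨v, hv, hv'⟩ := Matrix.exists_mulVec_eq_zero_iff.2 h0
    have hbot := hS U (LinearMap.ker (φ (right U.1)).mulVecLin) ?_ ?_ ?_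
    · exact hv ((Submodule.mem_bot ℂ).1 (hbot ▸
        (show v ∈ LinearMap.ker (φ (right U.1)).mulVecLin from hv')))
    · intro s hs
      change φ (right U.1) *ᵥ s = 0 at hs
      change φ (right U.1) *ᵥ (m.B' U *ᵥ s) = 0
      rw [mulVec_eq (h.B' U), hs, Matrix.mulVec_zero]
    · intro s hs
      change φ (right U.1) *ᵥ s = 0 at hs
      have : φ (left U.1) *ᵥ (m.A U *ᵥ s) = 0 := by
        rw [mulVec_eq (h.A U), hs, Matrix.mulVec_zero]
      by_contra hne
      exact hU (Matrix.exists_mulVec_eq_zero_iff.1 ⟨_, hne, this⟩)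
    · intro s hs
      change φ (right U.1) *ᵥ s = 0 at hs
      rw [← one_smul ℂ (m.b U), ← h.b, ← Matrix.mulVec_mulVec, hs, Matrix.mulVec_zero]

lemma character_val (g : Gauge 𝓓) :
    (character g).val = ∏ V : 𝓓.NS5, (g (right V.1)).val.det := by
  simp [character]

lemma isClosed_orbit {m : MTilde 𝓓} (hc : Costable m.1) {z : ℂ} (hz : z ≠ 0) :
    IsClosed (Set.range fun g : Gauge 𝓓 => liftAct g (m, z)) := by
  rw [← closure_subset_iff_isClosed]
  rintro ⟨m', z'⟩ hy
  have hne : (Filter.comap (fun g : Gauge 𝓓 => liftAct g (m, z)) (nhds (m', z'))).NeBot := by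
    refine Filter.comap_neBot_iff.2 fun t ht => ?_
    obtain ⟨_, hp, g, rfl⟩ := mem_closure_iff_nhds.1 hy t ht
    exact ⟨g, hp⟩
  -- An ultrafilter gives limits of bounded families directly and decides between the bounded and
  -- the unbounded case.
  set u := Ultrafilter.of (Filter.comap (fun g : Gauge 𝓓 => liftAct g (m, z)) (nhds (m', z')))
  have hu : Filter.Tendsto (fun g : Gauge 𝓓 => liftAct g (m, z)) u (nhds (m', z')) :=
    Filter.tendsto_comap.mono_left (Ultrafilter.of_le _)
  have hu1 : Filter.Tendsto (fun g : Gauge 𝓓 => g • m.1) u (nhds m'.1) :=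
    (continuous_subtype_val.tendsto _).comp ((continuous_fst.tendsto _).comp hu)
  have hu2 : Filter.Tendsto (fun g : Gauge 𝓓 => ((character g)⁻¹ : ℂˣ).val * z) u (nhds z') :=
    (continuous_snd.tendsto _).comp hu
  -- a limit of rescaled gauge transformations
  have lim : ∀ (c : Gauge 𝓓 → ℂ) (c₀ : ℂ), Filter.Tendsto c u (nhds c₀) →
      (∃ R : ℝ, ∀ᶠ g in (u : Filter (Gauge 𝓓)), ‖c g • entries g‖ ≤ R) →
      ∃ x, Filter.Tendsto (fun g => c g • entries g) u (nhds x) ∧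
        IsHom c₀ m.1 m'.1 (ofEntries x) := by
    rintro c c₀ hcc ⟨R, hR⟩
    obtain ⟨x, -, hx⟩ := (isCompact_closedBall (0 : ∀ j : Fin 𝓓.size, 𝓓.W j → 𝓓.W j → ℂ)
      R).ultrafilter_le_nhds (u.map fun g => c g • entries g) (by
        rw [Filter.le_principal_iff]
        exact hR.mono fun g hg => by simpa using hg)
    refine ⟨x, hx, isHom_of_tendsto (c := c) (m' := fun g => g • m.1)
      (φ := fun g j => c g • (g j).val) (fun g => ?_) hcc hu1 (tendsto_ofEntries hx)⟩
    simpa using (isHom_gauge g m.1).smul (c g)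
  -- In the bounded case the limit matrices intertwine `m` and `m'`. The second coordinate gives `z'
  -- * ∏ det = z ≠ 0`, so they are invertible and `(m', z')` lies on the orbit.
  by_cases hb : ∃ R : ℝ, ∀ᶠ g in (u : Filter (Gauge 𝓓)), ‖entries g‖ ≤ R
  · obtain ⟨x, hx, hom⟩ := lim (fun _ => 1) 1 tendsto_const_nhds (by simpa using hb)
    have hdet : Filter.Tendsto (fun g : Gauge 𝓓 => (character g).val) u
        (nhds (∏ V : 𝓓.NS5, (ofEntries x (right V.1)).det)) := by
      simp only [character_val]
      refine tendsto_finsetProd _ fun V _ => ?_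
      have := tendsto_ofEntries (c := fun _ => 1) (g := id) hx (right V.1)
      simp only [one_smul] at this
      exact (Continuous.matrix_det continuous_id |>.tendsto _).comp this
    have hprod : z' * ∏ V : 𝓓.NS5, (ofEntries x (right V.1)).det = z := by
      refine tendsto_nhds_unique ((hu2.mul hdet).congr fun g => ?_) tendsto_const_nhds
      rw [mul_right_comm, Units.inv_mul, one_mul]
    have hp0 : ∏ V : 𝓓.NS5, (ofEntries x (right V.1)).det ≠ 0 := fun h0 => by
      rw [h0, mul_zero] at hprod; exact hz hprod.symm
    have hunit := det_ne_zero_of_isHom hom m.2.2.1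
      fun V => Finset.prod_ne_zero_iff.1 hp0 V (Finset.mem_univ V)
    let g : Gauge 𝓓 := fun j => Matrix.GeneralLinearGroup.mkOfDetNeZero (ofEntries x j) (hunit j)
    refine ⟨g, Prod.ext (Subtype.ext (smul_eq_of_isHom hom)) ?_⟩
    have hg : (character g).val = ∏ V : 𝓓.NS5, (ofEntries x (right V.1)).det := character_val g
    change ((character g)⁻¹ : ℂˣ).val * z = z'
    rw [← hprod, ← hg, mul_left_comm, Units.inv_mul, mul_one]
  -- In the unbounded case the normalised matrices converge to a family of norm `1`, which is an
  -- intertwiner with factor `0` and therefore zero.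
  · exfalso
    have hinf : Filter.Tendsto (fun g : Gauge 𝓓 => ‖entries g‖) u Filter.atTop := by
      refine Filter.tendsto_atTop.2 fun R => ?_
      have : ¬ ∀ᶠ g in (u : Filter (Gauge 𝓓)), ‖entries g‖ ≤ R := fun h => hb ⟨R, h⟩
      rw [← Ultrafilter.eventually_not] at this
      exact this.mono fun g hg => (not_le.1 hg).le
    have hpos : ∀ᶠ g in (u : Filter (Gauge 𝓓)),
        ‖((‖entries g‖⁻¹ : ℝ) : ℂ) • entries g‖ = 1 := by
      filter_upwards [hinf.eventually_gt_atTop 0] with g hg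
      rw [norm_smul, Complex.norm_real, norm_inv, norm_norm, inv_mul_cancel₀ hg.ne']
    obtain ⟨x, hx, hom⟩ := lim (fun g => ((‖entries g‖⁻¹ : ℝ) : ℂ)) 0
      (by
        rw [← Complex.ofReal_zero]
        exact (Complex.continuous_ofReal.tendsto 0).comp hinf.inv_tendsto_atTop)
      ⟨1, hpos.mono fun g hg => hg.le⟩
    have hx0 : x = 0 := by
      funext j p q
      have := congrFun (congrFun (hom.eq_zero hc m'.2.1 m'.2.2.1 j) p) q
      simpa [ofEntries, j.2] using this
    have h1 : ‖x‖ = 1 := tendsto_nhds_unique hx.norm (tendsto_const_nhds.congr' (hpos.mono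
      fun g hg => hg.symm))
    rw [hx0, norm_zero] at h1
    exact zero_ne_one h1

lemma Costable.isStable {m : MTilde 𝓓} (hc : Costable m.1) : IsStable m := by
  refine fun z hz => ⟨isClosed_orbit hc hz, (Set.finite_singleton 1).subset fun g hg => ?_⟩
  have h1 : g • m.1 = m.1 := congrArg (fun p => p.1.1) hg
  exact hc.eq_of_smul_eq m.2.1 m.2.2.1 (h1.trans (one_smul _ m.1).symm)

end

section

/-! ### Stability implies the criterion -/

lemma exists_projection {n : ℕ} (T : Submodule ℂ (Fin n → ℂ)) :
    ∃ P : Matrix (Fin n) (Fin n) ℂ, (∀ w, P *ᵥ w ∈ T) ∧ ∀ w ∈ T, P *ᵥ w = w := by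
  obtain ⟨f, hf⟩ := T.subtype.exists_leftInverse_of_injective T.ker_subtype
  refine ⟨LinearMap.toMatrix' (T.subtype ∘ₗ f), fun w => ?_, fun w hw => ?_⟩
  · rw [LinearMap.toMatrix'_mulVec]
    exact (f w).2
  · rw [LinearMap.toMatrix'_mulVec]
    exact congrArg Subtype.val (LinearMap.congr_fun hf ⟨w, hw⟩)

/-! ### Degeneration to the associated graded of a subspace -/

section Degeneration

variable {κ ι η : Type} [Fintype κ] [Fintype ι] [Fintype η]
  {P : Matrix κ κ ℂ} {P' : Matrix ι ι ℂ} {P'' : Matrix η η ℂ}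

/-- The degeneration `M ↦ P M P' + t P M (1 - P') + (1 - P) M (1 - P')` of a map `M` that maps the
image of the projection `P'` to the image of `P`. -/
def degenMat (P : Matrix κ κ ℂ) (P' : Matrix ι ι ℂ) (t : ℂ) (M : Matrix κ ι ℂ) : Matrix κ ι ℂ :=
  M + M * P' - P * M + t • (P * M - M * P')

/-- At `t = 0` only the two diagonal blocks remain, and taking diagonal blocks is multiplicative on
block triangular matrices. This carries the moment map equations over to the limit. -/
lemma degenMat_zero_mul {M : Matrix κ ι ℂ} {N : Matrix ι η ℂ} (hP' : P' * P' = P')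
    (hM : P * (M * P') = M * P') (hN : P' * (N * P'') = N * P'') :
    degenMat P P' 0 M * degenMat P' P'' 0 N = degenMat P P'' 0 (M * N) := by
  have h1 : ∀ X : Matrix ι η ℂ, P * (M * (P' * X)) = M * (P' * X) := fun X => by
    rw [← Matrix.mul_assoc M, ← Matrix.mul_assoc P, hM]
  have h2 : ∀ X : Matrix ι η ℂ, P' * (P' * X) = P' * X := fun X => by
    rw [← Matrix.mul_assoc, hP']
  have h3 : P * (M * (N * P'')) = M * (N * P'') := by rw [← hN, h1]
  simp only [degenMat, zero_smul, add_zero, Matrix.add_mul, Matrix.mul_add, Matrix.sub_mul,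
    Matrix.mul_sub, Matrix.mul_assoc, hN, h1, h2, h3]
  abel

/-- The conjugation multiplies the blocks by `1`, `t`, `t⁻¹`, `1`; the block with `t⁻¹` is zero by
`hM`, so the result is polynomial in `t`. -/
lemma mul_degenMat_mul [DecidableEq κ] [DecidableEq ι] {M : Matrix κ ι ℂ}
    (hM : P * (M * P') = M * P') {t : ℂ} (ht : t ≠ 0) :
    (P + t⁻¹ • (1 - P)) * M * (P' + t • (1 - P')) = degenMat P P' t M := by
  simp only [degenMat, Matrix.add_mul, Matrix.mul_add, Matrix.sub_mul, Matrix.mul_sub,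
    Matrix.mul_assoc, hM, Matrix.smul_mul, Matrix.mul_smul, Matrix.one_mul, Matrix.mul_one,
    smul_add, smul_sub, smul_smul, mul_inv_cancel₀ ht, one_smul]
  abel

lemma projection_mul_inv [DecidableEq κ] (hP : P * P = P) {t : ℂ} (ht : t ≠ 0) :
    (P + t • (1 - P)) * (P + t⁻¹ • (1 - P)) = 1 := by
  simp only [Matrix.add_mul, Matrix.mul_add, Matrix.sub_mul, Matrix.mul_sub, hP,
    Matrix.smul_mul, Matrix.mul_smul, Matrix.one_mul, Matrix.mul_one,
    smul_add, smul_sub, smul_smul, inv_mul_cancel₀ ht, one_smul]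
  abel

end Degeneration

/-- The one-parameter subgroup of a family of projections. -/
def projectionGauge (P : ∀ j, Matrix (𝓓.W j) (𝓓.W j) ℂ) (hP : ∀ j, P j * P j = P j) (t : ℂ)
    (ht : t ≠ 0) : Gauge 𝓓 := fun j =>
  ⟨P j + t⁻¹ • (1 - P j), P j + t • (1 - P j),
    by simpa using projection_mul_inv (hP j) (inv_ne_zero ht), projection_mul_inv (hP j) ht⟩

/-- The degeneration of a representation along a family of projections. -/
@[simps]
def degenRep (P : ∀ j, Matrix (𝓓.W j) (𝓓.W j) ℂ) (m : Rep 𝓓) (t : ℂ) : Rep 𝓓 where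
  A U := degenMat (P _) (P _) t (m.A U)
  b U := m.b U * (P (right U.1) + t • (1 - P (right U.1)))
  a U := m.a U
  B U := degenMat (P _) (P _) t (m.B U)
  B' U := degenMat (P _) (P _) t (m.B' U)
  C V := degenMat (P _) (P _) t (m.C V)
  D V := degenMat (P _) (P _) t (m.D V)

lemma continuous_degenRep (P : ∀ j, Matrix (𝓓.W j) (𝓓.W j) ℂ) (m : Rep 𝓓) :
    Continuous (degenRep P m) := by
  refine continuous_induced_rng.2 ?_
  have h : ∀ {i j : ℕ} (M : Matrix (𝓓.W i) (𝓓.W j) ℂ),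
      Continuous fun t => degenMat (P i) (P j) t M := fun M =>
    continuous_const.add (continuous_id.smul continuous_const)
  have h' : ∀ {j : ℕ} (M : Matrix (Fin 1) (𝓓.W j) ℂ),
      Continuous fun t : ℂ => M * (P j + t • (1 - P j)) := fun M =>
    continuous_const.matrix_mul (continuous_const.add (continuous_id.smul continuous_const))
  exact (continuous_pi fun U => h _).prodMk <| (continuous_pi fun U => h' _).prodMk <|
    continuous_const.prodMk <| (continuous_pi fun U => h _).prodMk <|
    (continuous_pi fun U => h _).prodMk <| (continuous_pi fun U => h _).prodMk <|
    continuous_pi fun U => h _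

/-- A family of projections onto a family of subspaces. -/
structure IsProjection (P : ∀ j, Matrix (𝓓.W j) (𝓓.W j) ℂ)
    (T : ∀ j, Submodule ℂ (𝓓.W j → ℂ)) : Prop where
  mem : ∀ j w, P j *ᵥ w ∈ T j
  eq : ∀ j, ∀ w ∈ T j, P j *ᵥ w = w

section

variable {P : ∀ j, Matrix (𝓓.W j) (𝓓.W j) ℂ} {T : ∀ j, Submodule ℂ (𝓓.W j → ℂ)} {m : Rep 𝓓}

lemma IsProjection.mul_eq {κ : Type} [Fintype κ] [DecidableEq κ] (hP : IsProjection P T) {i : ℕ}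
    {M : Matrix (𝓓.W i) κ ℂ} (hM : ∀ w, M *ᵥ w ∈ T i) : P i * M = M := by
  refine Matrix.ext_of_mulVec_single fun q => ?_
  rw [← Matrix.mulVec_mulVec, hP.eq _ _ (hM _)]

lemma IsProjection.idem (hP : IsProjection P T) (j : ℕ) : P j * P j = P j :=
  hP.mul_eq (hP.mem j)

lemma IsProjection.invariant (hP : IsProjection P T) {i j : ℕ}
    {M : Matrix (𝓓.W i) (𝓓.W j) ℂ} (hM : ∀ w ∈ T j, M *ᵥ w ∈ T i) :
    P i * (M * P j) = M * P j :=
  hP.mul_eq fun w => by rw [← Matrix.mulVec_mulVec]; exact hM _ (hP.mem _ _)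

/-- Since the image of `a` lies in `T`, the factor `t⁻¹` never acts on it; on the side of `b` only
`t` occurs. So the orbit curve extends over `t = 0`. -/
lemma degenRep_eq (hP : IsProjection P T) (hT : IsSub m T) {t : ℂ} (ht : t ≠ 0) :
    projectionGauge P hP.idem t ht • m = degenRep P m t := by
  rw [gauge_smul_def]
  ext1 <;> funext U
  · exact mul_degenMat_mul (hP.invariant (hT.A U)) ht
  · rfl
  · change (P _ + t⁻¹ • (1 - P _)) * m.a U = m.a U
    rw [Matrix.add_mul, Matrix.smul_mul, Matrix.sub_mul, hP.mul_eq (hT.a U)]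
    simp
  · exact mul_degenMat_mul (hP.invariant (hT.B U)) ht
  · exact mul_degenMat_mul (hP.invariant (hT.B' U)) ht
  · exact mul_degenMat_mul (hP.invariant (hT.C U)) ht
  · exact mul_degenMat_mul (hP.invariant (hT.D U)) ht

lemma degenMat_zero_add {i j : ℕ} (M N : Matrix (𝓓.W i) (𝓓.W j) ℂ) :
    degenMat (P i) (P j) 0 (M + N) = degenMat (P i) (P j) 0 M + degenMat (P i) (P j) 0 N := by
  simp only [degenMat, zero_smul, add_zero, Matrix.add_mul, Matrix.mul_add]; abel

lemma degenMat_zero_neg {i j : ℕ} (M : Matrix (𝓓.W i) (𝓓.W j) ℂ) :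
    degenMat (P i) (P j) 0 (-M) = -degenMat (P i) (P j) 0 M := by
  simp only [degenMat, zero_smul, add_zero, Matrix.neg_mul, Matrix.mul_neg]; abel

lemma degenMat_zero_sub {i j : ℕ} (M N : Matrix (𝓓.W i) (𝓓.W j) ℂ) :
    degenMat (P i) (P j) 0 (M - N) = degenMat (P i) (P j) 0 M - degenMat (P i) (P j) 0 N := by
  rw [sub_eq_add_neg, degenMat_zero_add, degenMat_zero_neg, ← sub_eq_add_neg]

lemma degenMat_zero_zero {i j : ℕ} :
    degenMat (P i) (P j) 0 (0 : Matrix (𝓓.W i) (𝓓.W j) ℂ) = 0 := by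
  simp [degenMat]

lemma degenMat_zero_mul_of_projection (hP : IsProjection P T) {i j k : ℕ}
    {M : Matrix (𝓓.W i) (𝓓.W j) ℂ} {N : Matrix (𝓓.W j) (𝓓.W k) ℂ}
    (hM : ∀ w ∈ T j, M *ᵥ w ∈ T i) (hN : ∀ w ∈ T k, N *ᵥ w ∈ T j) :
    degenMat (P i) (P j) 0 M * degenMat (P j) (P k) 0 N = degenMat (P i) (P k) 0 (M * N) :=
  degenMat_zero_mul (hP.idem j) (hP.invariant hM) (hP.invariant hN)

lemma isMomentZero_degenRep_zero (hP : IsProjection P T) (hT : IsSub m T)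
    (hm : IsMomentZero m) : IsMomentZero (degenRep P m 0) where
  threeWay U := by
    have hab : m.a U * (m.b U * (P (right U.1) + (0 : ℂ) • (1 - P (right U.1)))) =
        degenMat (P _) (P _) 0 (m.a U * m.b U) := by
      simp only [degenMat, zero_smul, add_zero]
      rw [← Matrix.mul_assoc, ← Matrix.mul_assoc, hP.mul_eq (hT.a U)]; abel
    simp only [degenRep_A, degenRep_B, degenRep_B', degenRep_a, degenRep_b]
    rw [hab, degenMat_zero_mul_of_projection hP (hT.B U) (hT.A U),
      degenMat_zero_mul_of_projection hP (hT.A U) (hT.B' U), ← degenMat_zero_sub,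
      ← degenMat_zero_add, hm.threeWay, degenMat_zero_zero]
  between_D5_D5 i hi h h' := by
    simp only [degenRep_B, degenRep_B']
    exact (degenMat_zero_sub _ _).symm.trans
      ((congrArg _ (hm.between_D5_D5 i hi h h')).trans degenMat_zero_zero)
  between_NS5_NS5 i hi h h' := by
    simp only [degenRep_C, degenRep_D]
    rw [degenMat_zero_mul_of_projection hP (hT.C ⟨_, h'⟩) (hT.D ⟨_, h'⟩),
      degenMat_zero_mul_of_projection hP (hT.D ⟨_, h⟩) (hT.C ⟨_, h⟩)]
    exact (degenMat_zero_sub _ _).symm.trans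
      ((congrArg _ (hm.between_NS5_NS5 i hi h h')).trans degenMat_zero_zero)
  between_NS5_D5 i hi h h' := by
    simp only [degenRep_C, degenRep_D, degenRep_B]
    rw [degenMat_zero_mul_of_projection hP (hT.D ⟨_, h⟩) (hT.C ⟨_, h⟩), ← degenMat_zero_neg]
    exact (degenMat_zero_sub _ _).symm.trans
      ((congrArg _ (hm.between_NS5_D5 i hi h h')).trans degenMat_zero_zero)
  between_D5_NS5 i hi h h' := by
    simp only [degenRep_C, degenRep_D, degenRep_B']
    rw [degenMat_zero_mul_of_projection hP (hT.C ⟨_, h'⟩) (hT.D ⟨_, h'⟩)]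
    exact (degenMat_zero_add _ _).symm.trans
      ((congrArg _ (hm.between_D5_NS5 i hi h h')).trans degenMat_zero_zero)

lemma degenMat_zero_mulVec {i j : ℕ} (M : Matrix (𝓓.W i) (𝓓.W j) ℂ) (w : 𝓓.W j → ℂ) :
    degenMat (P i) (P j) 0 M *ᵥ w = M *ᵥ w + M *ᵥ (P j *ᵥ w) - P i *ᵥ (M *ᵥ w) := by
  simp [degenMat, Matrix.sub_mulVec, Matrix.add_mulVec]

lemma degenMat_zero_mulVec_of_mem (hP : IsProjection P T) {i j : ℕ}
    {M : Matrix (𝓓.W i) (𝓓.W j) ℂ} (hM : ∀ w ∈ T j, M *ᵥ w ∈ T i) {w : 𝓓.W j → ℂ}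
    (hw : w ∈ T j) : degenMat (P i) (P j) 0 M *ᵥ w = M *ᵥ w := by
  rw [degenMat_zero_mulVec, hP.eq _ _ hw, hP.eq _ _ (hM w hw), add_sub_cancel_right]

/-- Injectivity of `A` on the quotient by `T` forces a subspace killed by the degenerate `A` into
`T`, and on `T` the degeneration changes nothing, so (S1) of `m` applies. -/
lemma S1_degenRep_zero (hP : IsProjection P T) (hT : IsSub m T) (hS : S1 m) :
    S1 (degenRep P m 0) := by
  intro U S hB hA hb
  have hST : ∀ s ∈ S, s ∈ T (right U.1) := fun s hs => by
    have h := hA s hs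
    rw [degenRep_A, degenMat_zero_mulVec] at h
    refine hT.A_inv U s ?_
    -- Applying the projection isolates `A P s = 0`; what is left of `h` is `A s = P A s`, which
    -- lies in `T`.
    have h1 := congrArg (fun w => P (left U.1) *ᵥ w) h
    simp only [Matrix.mulVec_sub, Matrix.mulVec_add, Matrix.mulVec_zero] at h1
    rw [hP.eq _ _ (hP.mem _ (m.A U *ᵥ s)), hP.eq _ _ (hT.A U _ (hP.mem _ _)),
      add_sub_cancel_left] at h1
    rw [h1, add_zero, sub_eq_zero] at h
    exact h ▸ hP.mem _ _
  refine hS U S (fun s hs => ?_) (fun s hs => ?_) (fun s hs => ?_)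
  · have := hB s hs
    rwa [degenRep_B', degenMat_zero_mulVec_of_mem hP (hT.B' U) (hST s hs)] at this
  · have := hA s hs
    rwa [degenRep_A, degenMat_zero_mulVec_of_mem hP (hT.A U) (hST s hs)] at this
  · have := hb s hs
    rwa [degenRep_b, zero_smul, add_zero, ← Matrix.mulVec_mulVec, hP.eq _ _ (hST s hs)] at this

/-- (S2) of `m` is applied to `(T' ∩ T) + im A`, which is stable under `B` because `B A = A B' - a
b`. It follows that `T ≤ T'`: an element of `T` is `y + A w` with `y ∈ T' ∩ T`, so `A w ∈ T`, so `w
∈ T`, where the degenerate `A` is `A`. Modulo `T` the degenerate `A` has the same image as `A`, and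
`T'` is everything. -/
lemma S2_degenRep_zero (hP : IsProjection P T) (hT : IsSub m T) (hm : IsMomentZero m)
    (hS : S2 m) : S2 (degenRep P m 0) := by
  intro U T' hB hA ha
  have hY := hS U ((T' ⊓ T (left U.1)) ⊔ LinearMap.range (m.A U).mulVecLin) ?_ ?_ ?_
  · have hdec : ∀ x, ∃ y ∈ T' ⊓ T (left U.1), ∃ w, y + m.A U *ᵥ w = x := fun x => by
      obtain ⟨y, hy, _, ⟨w, rfl⟩, h⟩ := Submodule.mem_sup.1 (hY ▸ Submodule.mem_top (x := x))
      exact ⟨y, hy, w, h⟩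
    have hTT' : T (left U.1) ≤ T' := fun x hx => by
      obtain ⟨y, hy, w, rfl⟩ := hdec x
      have h1 : m.A U *ᵥ w ∈ T (left U.1) := by
        simpa using Submodule.sub_mem _ hx hy.2
      have h2 := hA w
      rw [degenRep_A, degenMat_zero_mulVec_of_mem hP (hT.A U) (hT.A_inv U w h1)] at h2
      exact T'.add_mem hy.1 h2
    rw [eq_top_iff]
    rintro x -
    obtain ⟨y, hy, w, rfl⟩ := hdec x
    refine T'.add_mem hy.1 ?_
    have h : m.A U *ᵥ w = (degenRep P m 0).A U *ᵥ w +
        (P _ *ᵥ (m.A U *ᵥ w) - m.A U *ᵥ (P _ *ᵥ w)) := by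
      rw [degenRep_A, degenMat_zero_mulVec]; abel
    rw [h]
    exact T'.add_mem (hA w) (hTT' (Submodule.sub_mem _ (hP.mem _ _) (hT.A U _ (hP.mem _ _))))
  · have haY : ∀ w, m.a U *ᵥ w ∈ T' ⊓ T (left U.1) := fun w => ⟨ha w, hT.a U w⟩
    intro x hx
    obtain ⟨y, hy, _, ⟨w, rfl⟩, rfl⟩ := Submodule.mem_sup.1 hx
    rw [Matrix.mulVec_add]
    refine Submodule.add_mem _ (Submodule.mem_sup_left ⟨?_, hT.B U _ hy.2⟩) ?_
    · have := hB y hy.1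
      rwa [degenRep_B, degenMat_zero_mulVec_of_mem hP (hT.B U) hy.2] at this
    · have h := hm.A_mulVec_B' U w
      rw [Matrix.mulVecLin_apply, ← sub_eq_iff_eq_add.2 h]
      exact Submodule.sub_mem _ (Submodule.mem_sup_right ⟨_, rfl⟩)
        (Submodule.mem_sup_left (haY _))
  · exact fun w => Submodule.mem_sup_right ⟨w, rfl⟩
  · exact fun w => Submodule.mem_sup_left ⟨ha w, hT.a U w⟩

lemma degenRep_mem (hP : IsProjection P T) (hT : IsSub m T)
    (hm : IsMomentZero m ∧ S1 m ∧ S2 m) (t : ℂ) :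
    IsMomentZero (degenRep P m t) ∧ S1 (degenRep P m t) ∧ S2 (degenRep P m t) := by
  rcases eq_or_ne t 0 with rfl | ht
  · exact ⟨isMomentZero_degenRep_zero hP hT hm.1, S1_degenRep_zero hP hT hm.2.1,
      S2_degenRep_zero hP hT hm.1 hm.2.2⟩
  · rw [← degenRep_eq hP hT ht]
    exact ⟨hm.1.gauge_smul _, hm.2.1.gauge_smul _, hm.2.2.gauge_smul _⟩

/-- Injectivity of `A` on the quotient carries `T = ⊤` from left to right across D5 branes. So
properness of `T` is visible at one of the D3 branes that enter `χ`. -/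
lemma eq_top_of_right_NS5 (hT : IsSub m T) (h : ∀ V : 𝓓.NS5, T (right V.1) = ⊤) (j : ℕ) :
    T j = ⊤ := by
  refine induction_right (P := fun j => T j = ⊤) (fun j hj => ?_) (fun U hU => ?_)
    (fun V _ => h V) j
  · have := subsingleton_of_mult (mult_eq_zero hj)
    exact Subsingleton.elim _ _
  · rw [eq_top_iff]
    exact fun w _ => hT.A_inv U w (hU ▸ Submodule.mem_top)

end

lemma IsStable.costable {m : MTilde 𝓓} (hm : IsStable m) : Costable m.1 := by
  intro T hT
  choose P hP1 hP2 using fun j => exists_projection (T j)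
  have hP : IsProjection P T := ⟨hP1, hP2⟩
  refine eq_top_of_right_NS5 hT fun V => ?_
  by_contra hV
  let c : ℂ → ℂ := fun t => ∏ V : 𝓓.NS5, (P (right V.1) + t • (1 - P (right V.1))).det
  have hc0 : c 0 = 0 := by
    refine Finset.prod_eq_zero (Finset.mem_univ V) ?_
    rw [zero_smul, add_zero]
    by_contra hdet
    refine hV (eq_top_iff.2 fun w _ => ?_)
    have hu : IsUnit (P (right V.1)).det := isUnit_iff_ne_zero.2 hdet
    rw [← Matrix.one_mulVec w, ← Matrix.mul_nonsing_inv _ hu, ← Matrix.mulVec_mulVec]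
    exact hP1 _ _
  have hcont : Continuous c := continuous_finsetProd _ fun V _ =>
    (continuous_const.add (continuous_id.smul continuous_const)).matrix_det
  -- For `t ≠ 0` the curve runs in the orbit of `(m, 1)`, so closedness puts `γ 0` there too. Its
  -- second coordinate is `0` because a projection onto a proper subspace is singular, whereas `χ⁻¹`
  -- never vanishes.
  let γ : ℂ → MTilde 𝓓 × ℂ := fun t => (⟨degenRep P m.1 t, degenRep_mem hP hT m.2 t⟩, c t * 1)
  have hγ : Continuous γ := ((continuous_degenRep P m.1).subtype_mk _).prodMk
    (hcont.mul continuous_const)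
  have hclosed := (hm 1 one_ne_zero).1.preimage hγ
  have huniv : (0 : ℂ) ∈ γ ⁻¹' Set.range fun g : Gauge 𝓓 => liftAct g (m, 1) := by
    have hdense : Dense ({0}ᶜ : Set ℂ) := dense_compl_singleton 0
    refine hclosed.closure_subset_iff.2 (fun t ht => ?_) (hdense 0)
    refine ⟨projectionGauge P hP.idem t ht, Prod.ext (Subtype.ext (degenRep_eq hP hT ht)) ?_⟩
    change ((character _)⁻¹ : ℂˣ).val * 1 = c t * 1
    rw [← map_inv, character_val]
    rfl
  obtain ⟨g, hg⟩ := huniv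
  have h2 : ((character g)⁻¹ : ℂˣ).val * 1 = c 0 * 1 := congrArg Prod.snd hg
  rw [hc0, zero_mul, mul_one] at h2
  exact (character g)⁻¹.ne_zero h2

end

section

/-! ## Tie diagrams and their tables -/

/-- The number of ties at `U`, in a set of ties, that cover the D3 brane `j`. -/
def tieHeight (s : Finset (𝓓.NS5 × 𝓓.D5)) (U : 𝓓.D5) (j : ℕ) : ℕ :=
  (Finset.univ.filter fun V : 𝓓.NS5 => (V, U) ∈ s ∧ Covers V U j).card

/-- The number of ties that cover the D3 brane `j`. -/
def coverCount (s : Finset (𝓓.NS5 × 𝓓.D5)) (j : ℕ) : ℕ :=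
  (s.filter fun p => Covers p.1 p.2 j).card

/-- The table of a set of ties. -/
def tableOf (s : Finset (𝓓.NS5 × 𝓓.D5)) : Matrix 𝓓.NS5 𝓓.D5 ℤ := fun V U =>
  if V.1 < U.1 then (if (V, U) ∈ s then 1 else 0) else (if (V, U) ∈ s then 0 else 1)

lemma pos_ne (V : 𝓓.NS5) (U : 𝓓.D5) : V.1.1 ≠ U.1.1 := fun e => by
  have := V.2; rw [Fin.ext e, U.2] at this; cases this

lemma pos_injective_NS5 {V V' : 𝓓.NS5} (h : V.1.1 = V'.1.1) : V = V' := Subtype.ext (Fin.ext h)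

lemma pos_injective_D5 {U U' : 𝓓.D5} (h : U.1.1 = U'.1.1) : U = U' := Subtype.ext (Fin.ext h)

variable (s : Finset (𝓓.NS5 × 𝓓.D5))

lemma sum_tieHeight (j : ℕ) : ∑ U, tieHeight s U j = coverCount s j := by
  simp only [tieHeight, coverCount]
  rw [← Finset.card_sigma]
  refine Finset.card_bij' (fun x _ => (x.2, x.1)) (fun p _ => ⟨p.2, p.1⟩) ?_ ?_ ?_ ?_ <;>
    simp

/-- A tie at `U` starts or ends at the D3 branes next to `U` and next to an NS5 brane, never at
another D5 brane. -/
lemma tieHeight_D5 {U U' : 𝓓.D5} (h : U' ≠ U) :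
    tieHeight s U (right U'.1) = tieHeight s U (left U'.1) := by
  have hne : U'.1.1 ≠ U.1.1 := fun e => h (pos_injective_D5 e)
  refine congrArg Finset.card (Finset.filter_congr fun V _ => and_congr_right fun _ => ?_)
  have := pos_ne V U'
  simp only [Covers, left, right]; omega

/-- To the right of `U`, passing `V` from left to right can only leave the tie `(V, U)`. -/
lemma tieHeight_right_NS5 {U : 𝓓.D5} {V : 𝓓.NS5} (h : U.1.1 < V.1.1) :
    tieHeight s U (left V.1) = tieHeight s U (right V.1) + if (V, U) ∈ s then 1 else 0 := by
  have hV : (if (V, U) ∈ s then 1 else 0) =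
      ∑ V' : 𝓓.NS5, if V' = V then (if (V', U) ∈ s then 1 else 0) else 0 := by simp
  rw [hV, tieHeight, tieHeight, Finset.card_filter, Finset.card_filter, ← Finset.sum_add_distrib]
  refine Finset.sum_congr rfl fun V' _ => ?_
  have := pos_ne V' U
  by_cases hs : (V', U) ∈ s <;> by_cases e : V' = V
  · subst e
    simp only [hs, Covers, left, right, true_and, if_true]
    rw [if_pos (by omega), if_neg (by omega)]
  · have : V'.1.1 ≠ V.1.1 := fun e' => e (pos_injective_NS5 e')
    simp only [hs, Covers, left, right, true_and, e, if_false, add_zero]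
    exact if_congr (by omega) rfl rfl
  · simp [hs]
  · simp [hs]

lemma tieHeight_left_NS5 {U : 𝓓.D5} {V : 𝓓.NS5} (h : V.1.1 < U.1.1) :
    tieHeight s U (right V.1) = tieHeight s U (left V.1) + if (V, U) ∈ s then 1 else 0 := by
  have hV : (if (V, U) ∈ s then 1 else 0) =
      ∑ V' : 𝓓.NS5, if V' = V then (if (V', U) ∈ s then 1 else 0) else 0 := by simp
  rw [hV, tieHeight, tieHeight, Finset.card_filter, Finset.card_filter, ← Finset.sum_add_distrib]
  refine Finset.sum_congr rfl fun V' _ => ?_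
  have := pos_ne V' U
  by_cases hs : (V', U) ∈ s <;> by_cases e : V' = V
  · subst e
    simp only [hs, Covers, left, right, true_and, if_true]
    rw [if_pos (by omega), if_neg (by omega)]
  · have : V'.1.1 ≠ V.1.1 := fun e' => e (pos_injective_NS5 e')
    simp only [hs, Covers, left, right, true_and, e, if_false, add_zero]
    exact if_congr (by omega) rfl rfl
  · simp [hs]
  · simp [hs]

lemma tieHeight_zero (U : 𝓓.D5) : tieHeight s U 0 = 0 :=
  Finset.card_eq_zero.2 (Finset.filter_eq_empty_iff.2 fun V _ h => by
    have := h.2; simp only [Covers] at this; omega)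

lemma tieHeight_of_size_le (U : 𝓓.D5) {j : ℕ} (hj : 𝓓.size ≤ j) : tieHeight s U j = 0 :=
  Finset.card_eq_zero.2 (Finset.filter_eq_empty_iff.2 fun V _ h => by
    have h1 := h.2; have := U.1.2; have := V.1.2
    simp only [Covers] at h1; omega)

/-- An entry is the change of the height at `U` across `V`, plus `1` if `U` is left of `V`: this
correction is the reversed convention of the table there, and it sums to the last term. -/
lemma sum_tableOf_row (V : 𝓓.NS5) : ∑ U, tableOf s V U =
    ((coverCount s (right V.1) : ℤ) - coverCount s (left V.1)) +
      (Finset.univ.filter fun U : 𝓓.D5 => U.1 < V.1).card := by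
  rw [← sum_tieHeight, ← sum_tieHeight, Finset.card_filter]
  push_cast
  rw [← Finset.sum_sub_distrib, ← Finset.sum_add_distrib]
  refine Finset.sum_congr rfl fun U _ => ?_
  rw [tableOf]
  rcases lt_or_gt_of_ne (pos_ne V U) with h | h
  · rw [if_pos (Fin.lt_def.2 h), tieHeight_left_NS5 s h,
      if_neg (show ¬ U.1 < V.1 by rw [Fin.lt_def]; omega)]
    split_ifs <;> simp
  · rw [if_neg (show ¬ V.1 < U.1 by rw [Fin.lt_def]; omega), tieHeight_right_NS5 s h,
      if_pos (Fin.lt_def.2 h)]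
    split_ifs <;> simp

/-- Across `U` only the butterfly of `U` changes its height, and the ties at `U` that cover `U⁻` or
`U⁺` are those with `V` to the left or to the right of `U`. -/
lemma sum_tableOf_col (U : 𝓓.D5) : ∑ V, tableOf s V U =
    ((coverCount s (left U.1) : ℤ) - coverCount s (right U.1)) +
      (Finset.univ.filter fun V : 𝓓.NS5 => U.1 < V.1).card := by
  have h1 : (coverCount s (left U.1) : ℤ) - coverCount s (right U.1) =
      tieHeight s U (left U.1) - tieHeight s U (right U.1) := by
    rw [← sum_tieHeight, ← sum_tieHeight]
    push_cast
    rw [← Finset.sum_sub_distrib, Finset.sum_eq_single U]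
    · intro U' _ h
      rw [tieHeight_D5 s h.symm, sub_self]
    · simp
  rw [h1, tieHeight, tieHeight, Finset.card_filter, Finset.card_filter, Finset.card_filter]
  push_cast
  rw [← Finset.sum_sub_distrib, ← Finset.sum_add_distrib]
  refine Finset.sum_congr rfl fun V _ => ?_
  rw [tableOf]
  have hl : Covers V U (left U.1) ↔ V.1 < U.1 := by
    simp only [Covers, left, Fin.lt_def]; omega
  have hr : Covers V U (right U.1) ↔ U.1 < V.1 := by
    simp only [Covers, right, Fin.lt_def]; omega
  simp only [hl, hr]
  have hne : V.1 ≠ U.1 := fun e => pos_ne V U (congrArg Fin.val e)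
  rcases lt_or_gt_of_ne hne with h | h <;> by_cases hs : (V, U) ∈ s <;>
    simp [h, hs, not_lt.2 h.le]

/-- By the two sum formulas the margins prescribe the jump of the covering number at every 5-brane.
Covering number and multiplicity both start at `0`, so equal jumps mean equality everywhere. -/
lemma tableOf_mem_BCT_iff : tableOf s ∈ 𝓓.BCT ↔ ∀ j, coverCount s j = 𝓓.mult j := by
  constructor
  · rintro ⟨-, hr, hc⟩ j
    induction j with
    | zero => rw [← sum_tieHeight, 𝓓.mult_zero]; simp [tieHeight_zero]
    | succ j ih =>
      rcases lt_or_ge j 𝓓.size with hj | hj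
      · rcases hk : 𝓓.kind ⟨j, hj⟩ with _ | _
        · have h := hc ⟨⟨j, hj⟩, hk⟩
          rw [sum_tableOf_col, chargeD5] at h
          simp only [left, right] at h
          omega
        · have h := hr ⟨⟨j, hj⟩, hk⟩
          rw [sum_tableOf_row, chargeNS5] at h
          simp only [left, right] at h
          omega
      · rw [← sum_tieHeight, 𝓓.mult_of_size_le _ (by omega)]
        simp [tieHeight_of_size_le s _ (hj.trans (Nat.le_succ j))]
  · intro h
    refine ⟨fun V U => ?_, fun V => ?_, fun U => ?_⟩
    · rw [tableOf]; split_ifs <;> simp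
    · rw [sum_tableOf_row, h, h, chargeNS5]
    · rw [sum_tableOf_col, h, h, chargeD5]

lemma mem_iff_of_tableOf_eq {s s' : Finset (𝓓.NS5 × 𝓓.D5)} (h : tableOf s = tableOf s')
    (p : 𝓓.NS5 × 𝓓.D5) : p ∈ s ↔ p ∈ s' := by
  have h1 := congrFun (congrFun h p.1) p.2
  simp only [tableOf] at h1
  by_cases h2 : p ∈ s <;> by_cases h3 : p ∈ s' <;> by_cases h4 : p.1.1 < p.2.1 <;>
    simp_all

lemma bijOn_table : Set.BijOn (TieDiagram.table (𝓓 := 𝓓)) Set.univ 𝓓.BCT := by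
  refine ⟨fun τ _ => (tableOf_mem_BCT_iff τ.ties).2 τ.card_covers, fun τ _ τ' _ h => ?_,
    fun M hM => ?_⟩
  · exact TieDiagram.ext (Finset.ext (mem_iff_of_tableOf_eq h))
  · let s : Finset (𝓓.NS5 × 𝓓.D5) :=
      Finset.univ.filter fun p => if p.1.1 < p.2.1 then M p.1 p.2 = 1 else M p.1 p.2 = 0
    have hs : tableOf s = M := by
      ext V U
      have h01 := hM.1 V U
      simp only [tableOf, s, Finset.mem_filter, Finset.mem_univ, true_and]
      split_ifs <;> simp_all
    exact ⟨⟨s, (tableOf_mem_BCT_iff s).1 (hs ▸ hM)⟩, trivial, hs⟩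

end

section

/-! ## Butterfly diagrams -/

namespace TieDiagram

/-- There is a dot in the column below the D3 brane `j` of the butterfly of `U` at height `ℓ`. -/
def HasDot (τ : TieDiagram 𝓓) (U : 𝓓.D5) (j : ℕ) (ℓ : ℤ) : Prop :=
  τ.bottom U j ≤ ℓ ∧ ℓ < τ.bottom U j + τ.height U j

instance (τ : TieDiagram 𝓓) (U : 𝓓.D5) (j : ℕ) (ℓ : ℤ) : Decidable (τ.HasDot U j ℓ) :=
  inferInstanceAs (Decidable (_ ∧ _))

variable (τ : TieDiagram 𝓓)

lemma height_D5 {U U' : 𝓓.D5} (h : U' ≠ U) :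
    τ.height U (right U'.1) = τ.height U (left U'.1) := tieHeight_D5 τ.ties h

lemma bottom_D5 {U U' : 𝓓.D5} (h : U' ≠ U) :
    τ.bottom U (right U'.1) = τ.bottom U (left U'.1) := by
  rcases lt_or_gt_of_ne (fun e => h (Subtype.ext e) : U'.1 ≠ U.1) with h | h
  · exact τ.bottom_left_of_D5 U U' h
  · exact τ.bottom_right_of_D5 U U' h

lemma hasDot_D5 {U U' : 𝓓.D5} (h : U' ≠ U) (ℓ : ℤ) :
    τ.HasDot U (right U'.1) ℓ ↔ τ.HasDot U (left U'.1) ℓ := by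
  rw [HasDot, HasDot, τ.height_D5 h, τ.bottom_D5 h]

lemma hasDot_left_self {U : 𝓓.D5} {ℓ : ℤ} :
    τ.HasDot U (left U.1) ℓ ↔ 0 ≤ ℓ ∧ ℓ < τ.height U (left U.1) := by
  rw [HasDot, bottom_left_self, zero_add]

lemma hasDot_right_self {U : 𝓓.D5} {ℓ : ℤ} :
    τ.HasDot U (right U.1) ℓ ↔ 0 ≤ ℓ ∧ ℓ < τ.height U (right U.1) := by
  rw [HasDot, bottom_right_self, zero_add]

/-- Across an NS5 brane to the right of `U`, going right, the bottom dot of a column is lost if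
there is a tie. -/
lemma exists_right_NS5 {U : 𝓓.D5} {V : 𝓓.NS5} (h : U.1.1 < V.1.1) :
    ∃ x : ℕ, x ≤ 1 ∧ τ.height U (left V.1) = τ.height U (right V.1) + x ∧
      τ.bottom U (right V.1) = τ.bottom U (left V.1) + x := by
  have h1 := tieHeight_right_NS5 τ.ties h
  have h2 := τ.top_right_of_NS5 U V h
  refine ⟨if (V, U) ∈ τ.ties then 1 else 0, by split_ifs <;> simp, h1, ?_⟩
  have h3 : (τ.height U (left V.1) : ℤ) = τ.height U (right V.1) +
      (if (V, U) ∈ τ.ties then 1 else 0 : ℕ) := by exact_mod_cast h1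
  rw [top, top] at h2
  linarith

/-- Across an NS5 brane to the left of `U`, going left, a column is lowered by one unit, and
loses its bottom dot if there is a tie. -/
lemma exists_left_NS5 {U : 𝓓.D5} {V : 𝓓.NS5} (h : V.1.1 < U.1.1) :
    ∃ x : ℕ, x ≤ 1 ∧ τ.height U (right V.1) = τ.height U (left V.1) + x ∧
      τ.bottom U (left V.1) = τ.bottom U (right V.1) + x - 1 := by
  have h1 := tieHeight_left_NS5 τ.ties h
  have h2 := τ.top_left_of_NS5 U V h
  refine ⟨if (V, U) ∈ τ.ties then 1 else 0, by split_ifs <;> simp, h1, ?_⟩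
  have h3 : (τ.height U (right V.1) : ℤ) = τ.height U (left V.1) +
      (if (V, U) ∈ τ.ties then 1 else 0 : ℕ) := by exact_mod_cast h1
  rw [top, top] at h2
  linarith

variable {τ}

lemma hasDot_level {j : ℕ} (p : τ.Dot j) : τ.HasDot p.1 j (level p) := by
  have := p.2.2
  rw [HasDot, level]; omega

lemma dot_ext {j : ℕ} {p q : τ.Dot j} (h1 : p.1 = q.1) (h2 : level p = level q) : p = q := by
  obtain ⟨U, k⟩ := p
  obtain ⟨U', k'⟩ := q
  obtain rfl : U = U' := h1
  simp only [level] at h2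
  rw [show k = k' from Fin.ext (by omega)]

lemma exists_dot {U : 𝓓.D5} {j : ℕ} {ℓ : ℤ} (h : τ.HasDot U j ℓ) :
    ∃ p : τ.Dot j, p.1 = U ∧ level p = ℓ := by
  obtain ⟨h1, h2⟩ := h
  refine ⟨⟨U, ⟨(ℓ - τ.bottom U j).toNat, by omega⟩⟩, rfl, ?_⟩
  simp only [level]; omega

end TieDiagram

open TieDiagram

/-! ### Frames adapted to a tie diagram -/

/-- A family of vectors, indexed by the dots of a tie diagram (and extended by zero), that is
linearly independent and on which the maps of a representation act as in the butterfly diagram. -/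
structure IsFrame (m : Rep 𝓓) (τ : TieDiagram 𝓓) (v : 𝓓.D5 → ∀ j : ℕ, ℤ → 𝓓.W j → ℂ) :
    Prop where
  zero : ∀ U j ℓ, ¬ τ.HasDot U j ℓ → v U j ℓ = 0
  A : ∀ (U' U : 𝓓.D5) ℓ, τ.HasDot U (right U'.1) ℓ →
    m.A U' *ᵥ v U (right U'.1) ℓ = v U (left U'.1) ℓ
  b : ∀ (U' U : 𝓓.D5) ℓ, τ.HasDot U (right U'.1) ℓ → m.b U' *ᵥ v U (right U'.1) ℓ =
    if U = U' ∧ ℓ = τ.height U (left U.1) then -1 else 0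
  a : ∀ U : 𝓓.D5, m.a U *ᵥ 1 = v U (left U.1) (τ.height U (left U.1) - 1)
  B : ∀ (U' U : 𝓓.D5) ℓ, τ.HasDot U (left U'.1) ℓ →
    m.B U' *ᵥ v U (left U'.1) ℓ = -v U (left U'.1) (ℓ - 1)
  B' : ∀ (U' U : 𝓓.D5) ℓ, τ.HasDot U (right U'.1) ℓ →
    m.B' U' *ᵥ v U (right U'.1) ℓ = -v U (right U'.1) (ℓ - 1)
  C : ∀ (V : 𝓓.NS5) U ℓ, τ.HasDot U (right V.1) ℓ →
    m.C V *ᵥ v U (right V.1) ℓ = v U (left V.1) (ℓ - 1)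
  D : ∀ (V : 𝓓.NS5) U ℓ, τ.HasDot U (left V.1) ℓ →
    m.D V *ᵥ v U (left V.1) ℓ = v U (right V.1) ℓ
  linearIndependent : ∀ j, LinearIndependent ℂ fun p : τ.Dot j => v p.1 j (level p)

/-- The basis vector of a dot. -/
def dotVec (τ : TieDiagram 𝓓) (e : τ.Labelling) (U : 𝓓.D5) (j : ℕ) (ℓ : ℤ) : 𝓓.W j → ℂ :=
  fun p => if (e j p).1 = U ∧ level (e j p) = ℓ then 1 else 0

variable {τ : TieDiagram 𝓓} (e : τ.Labelling)

lemma dotVec_self {j : ℕ} (q : 𝓓.W j) :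
    dotVec τ e (e j q).1 j (level (e j q)) = Pi.single q 1 := by
  funext p
  rw [dotVec, Pi.single_apply]
  refine if_congr ⟨fun h => (e j).injective (dot_ext h.1 h.2), fun h => by rw [h]; simp⟩ rfl rfl

lemma exists_dotVec_eq {U : 𝓓.D5} {j : ℕ} {ℓ : ℤ} (h : τ.HasDot U j ℓ) :
    ∃ q, (e j q).1 = U ∧ level (e j q) = ℓ ∧ dotVec τ e U j ℓ = Pi.single q 1 := by
  obtain ⟨p, rfl, rfl⟩ := exists_dot h
  obtain ⟨q, rfl⟩ := (e j).surjective p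
  exact ⟨q, rfl, rfl, dotVec_self e q⟩

lemma dotVec_of_not_hasDot {U : 𝓓.D5} {j : ℕ} {ℓ : ℤ} (h : ¬ τ.HasDot U j ℓ) :
    dotVec τ e U j ℓ = 0 := by
  funext p
  refine if_neg ?_
  rintro ⟨rfl, rfl⟩
  exact h (hasDot_level _)

lemma linearIndependent_dotVec (j : ℕ) :
    LinearIndependent ℂ fun p : τ.Dot j => dotVec τ e p.1 j (level p) := by
  rw [← linearIndependent_equiv (e j)]
  convert (Pi.basisFun ℂ (𝓓.W j)).linearIndependent using 1
  funext q
  simp only [Function.comp_apply, Pi.basisFun_apply]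
  exact dotVec_self e q

lemma isFrame_butterfly : IsFrame (τ.butterfly e) τ (dotVec τ e) where
  zero U j ℓ h := dotVec_of_not_hasDot e h
  A U' U ℓ h := by
    obtain ⟨q, rfl, rfl, h⟩ := exists_dotVec_eq e h
    rw [h, Matrix.mulVec_single_one]; rfl
  b U' U ℓ h := by
    obtain ⟨q, rfl, rfl, h⟩ := exists_dotVec_eq e h
    rw [h, Matrix.mulVec_single_one]
    have hiff : (e _ q).1 = U' ∧ level (e _ q) = τ.top U' (left U'.1) + 1 ↔
        (e _ q).1 = U' ∧ level (e _ q) = τ.height (e _ q).1 (left (e _ q).1.1) :=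
      and_congr_right fun hU => by rw [hU, top, bottom_left_self]; simp
    funext i
    change (if _ ∧ _ then (-1 : ℂ) else 0) = _
    rw [if_congr hiff rfl rfl]
    split_ifs <;> rfl
  a U := by
    funext p
    simp [butterfly, Matrix.mulVec, dotProduct, top, bottom_left_self, dotVec]
  B U' U ℓ h := by
    obtain ⟨q, rfl, rfl, h⟩ := exists_dotVec_eq e h
    rw [h, Matrix.mulVec_single_one]
    funext p
    change (if _ ∧ _ then (-1 : ℂ) else 0) = -(if _ ∧ _ then (1 : ℂ) else 0)
    split_ifs <;> simp
  B' U' U ℓ h := by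
    obtain ⟨q, rfl, rfl, h⟩ := exists_dotVec_eq e h
    rw [h, Matrix.mulVec_single_one]
    funext p
    change (if _ ∧ _ then (-1 : ℂ) else 0) = -(if _ ∧ _ then (1 : ℂ) else 0)
    split_ifs <;> simp
  C V U ℓ h := by
    obtain ⟨q, rfl, rfl, h⟩ := exists_dotVec_eq e h
    rw [h, Matrix.mulVec_single_one]; rfl
  D V U ℓ h := by
    obtain ⟨q, rfl, rfl, h⟩ := exists_dotVec_eq e h
    rw [h, Matrix.mulVec_single_one]; rfl
  linearIndependent := linearIndependent_dotVec e

lemma ext_dotVec {κ : Type*} {j : ℕ} {M N : Matrix κ (𝓓.W j) ℂ}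
    (h : ∀ U ℓ, τ.HasDot U j ℓ → M *ᵥ dotVec τ e U j ℓ = N *ᵥ dotVec τ e U j ℓ) : M = N := by
  refine Matrix.ext_of_mulVec_single fun q => ?_
  rw [← dotVec_self e q]
  exact h _ _ (hasDot_level _)

lemma eq_top_of_dotVec_mem {j : ℕ} {T : Submodule ℂ (𝓓.W j → ℂ)}
    (h : ∀ U ℓ, τ.HasDot U j ℓ → dotVec τ e U j ℓ ∈ T) : T = ⊤ := by
  rw [eq_top_iff, ← (Pi.basisFun ℂ (𝓓.W j)).span_eq, Submodule.span_le]
  rintro _ ⟨q, rfl⟩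
  rw [Pi.basisFun_apply, ← dotVec_self e q]
  exact h _ _ (hasDot_level _)

/-- The matrices whose columns are the vectors of a frame. -/
def frameMatrix (v : 𝓓.D5 → ∀ j : ℕ, ℤ → 𝓓.W j → ℂ) (j : ℕ) : Matrix (𝓓.W j) (𝓓.W j) ℂ :=
  Matrix.of fun i p => v (e j p).1 j (level (e j p)) i

section

variable {m : Rep 𝓓} {v : 𝓓.D5 → ∀ j : ℕ, ℤ → 𝓓.W j → ℂ}

lemma isUnit_frameMatrix (h : IsFrame m τ v) (j : ℕ) : IsUnit (frameMatrix e v j) := by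
  have hc : (frameMatrix e v j).col =
      (fun p : τ.Dot j => v p.1 j (level p)) ∘ (e j) := rfl
  rw [← Matrix.linearIndependent_cols_iff_isUnit, hc]
  exact (h.linearIndependent j).comp _ (e j).injective

lemma mulVec_dotVec (h : IsFrame m τ v) (U : 𝓓.D5) (j : ℕ) (ℓ : ℤ) :
    frameMatrix e v j *ᵥ dotVec τ e U j ℓ = v U j ℓ := by
  by_cases hd : τ.HasDot U j ℓ
  · obtain ⟨q, rfl, rfl, hq⟩ := exists_dotVec_eq e hd
    rw [hq, Matrix.mulVec_single_one]; rfl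
  · rw [dotVec_of_not_hasDot e hd, h.zero _ _ _ hd, Matrix.mulVec_zero]

/-- The dots are a frame of the butterfly diagram for the same tie diagram, so the matrix that sends
dots to frame vectors intertwines all maps; it suffices to compare on dots. -/
lemma isHom_frameMatrix (h : IsFrame m τ v) : IsHom 1 (τ.butterfly e) m (frameMatrix e v) := by
  have hβ := isFrame_butterfly e
  constructor <;> intro U
  · refine ext_dotVec e fun U' ℓ hd => ?_
    rw [← Matrix.mulVec_mulVec, ← Matrix.mulVec_mulVec, hβ.A _ _ _ hd, mulVec_dotVec e h,
      mulVec_dotVec e h, h.A _ _ _ hd]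
  · refine ext_dotVec e fun U' ℓ hd => ?_
    rw [← Matrix.mulVec_mulVec, one_smul, hβ.b _ _ _ hd, mulVec_dotVec e h, h.b _ _ _ hd]
  · refine Matrix.ext_of_mulVec_single fun i => ?_
    have h1 : (Pi.single i 1 : Fin 1 → ℂ) = 1 := by
      funext k; simp [Subsingleton.elim k i]
    rw [h1, ← Matrix.mulVec_mulVec, one_smul, hβ.a, mulVec_dotVec e h, h.a]
  · refine ext_dotVec e fun U' ℓ hd => ?_
    rw [← Matrix.mulVec_mulVec, ← Matrix.mulVec_mulVec, hβ.B _ _ _ hd, mulVec_dotVec e h,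
      Matrix.mulVec_neg, mulVec_dotVec e h,
      h.B _ _ _ hd]
  · refine ext_dotVec e fun U' ℓ hd => ?_
    rw [← Matrix.mulVec_mulVec, ← Matrix.mulVec_mulVec, hβ.B' _ _ _ hd, mulVec_dotVec e h,
      Matrix.mulVec_neg, mulVec_dotVec e h,
      h.B' _ _ _ hd]
  · refine ext_dotVec e fun U' ℓ hd => ?_
    rw [← Matrix.mulVec_mulVec, ← Matrix.mulVec_mulVec, hβ.C _ _ _ hd, mulVec_dotVec e h,
      mulVec_dotVec e h, h.C _ _ _ hd]
  · refine ext_dotVec e fun U' ℓ hd => ?_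
    rw [← Matrix.mulVec_mulVec, ← Matrix.mulVec_mulVec, hβ.D _ _ _ hd, mulVec_dotVec e h,
      mulVec_dotVec e h, h.D _ _ _ hd]

/-- A representation with a frame is isomorphic to the butterfly diagram. -/
lemma IsFrame.exists_gauge (h : IsFrame m τ v) : ∃ g : Gauge 𝓓, g • τ.butterfly e = m :=
  ⟨fun j => (isUnit_frameMatrix e h j).unit, smul_eq_of_isHom (isHom_frameMatrix e h)⟩

end

/-! ### Butterfly diagrams are stable points -/

/-- Both `C D` and `D C` lower every column by one. The intermediate dot can be missing only for the
bottom dot of a column, where both sides vanish. -/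
lemma IsFrame.C_D {m : Rep 𝓓} {v : 𝓓.D5 → ∀ j : ℕ, ℤ → 𝓓.W j → ℂ} (h : IsFrame m τ v)
    (V : 𝓓.NS5) (U : 𝓓.D5) {ℓ : ℤ} (hd : τ.HasDot U (left V.1) ℓ) :
    (m.C V * m.D V) *ᵥ v U (left V.1) ℓ = v U (left V.1) (ℓ - 1) := by
  rw [← Matrix.mulVec_mulVec, h.D _ _ _ hd]
  by_cases hd' : τ.HasDot U (right V.1) ℓ
  · rw [h.C _ _ _ hd']
  · rw [h.zero _ _ _ hd', Matrix.mulVec_zero, h.zero]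
    rw [HasDot] at *
    rcases lt_or_gt_of_ne (pos_ne V U) with hVU | hVU
    · obtain ⟨x, h1, h2, h3⟩ := τ.exists_left_NS5 hVU
      omega
    · obtain ⟨x, h1, h2, h3⟩ := τ.exists_right_NS5 hVU
      omega

lemma IsFrame.D_C {m : Rep 𝓓} {v : 𝓓.D5 → ∀ j : ℕ, ℤ → 𝓓.W j → ℂ} (h : IsFrame m τ v)
    (V : 𝓓.NS5) (U : 𝓓.D5) {ℓ : ℤ} (hd : τ.HasDot U (right V.1) ℓ) :
    (m.D V * m.C V) *ᵥ v U (right V.1) ℓ = v U (right V.1) (ℓ - 1) := by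
  rw [← Matrix.mulVec_mulVec, h.C _ _ _ hd]
  by_cases hd' : τ.HasDot U (left V.1) (ℓ - 1)
  · rw [h.D _ _ _ hd']
  · rw [h.zero _ _ _ hd', Matrix.mulVec_zero, h.zero]
    rw [HasDot] at *
    rcases lt_or_gt_of_ne (pos_ne V U) with hVU | hVU
    · obtain ⟨x, h1, h2, h3⟩ := τ.exists_left_NS5 hVU
      omega
    · obtain ⟨x, h1, h2, h3⟩ := τ.exists_right_NS5 hVU
      omega

lemma isMomentZero_butterfly : IsMomentZero (τ.butterfly e) := by
  have h := isFrame_butterfly e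
  constructor
  · intro U'
    refine ext_dotVec e fun U ℓ hd => ?_
    simp only [Matrix.add_mulVec, Matrix.sub_mulVec, Matrix.zero_mulVec, ← Matrix.mulVec_mulVec]
    rw [h.A _ _ _ hd, h.B' _ _ _ hd, h.b _ _ _ hd, Matrix.mulVec_neg, sub_neg_eq_add]
    have hB : (τ.butterfly e).B U' *ᵥ dotVec τ e U (left U'.1) ℓ =
        if τ.HasDot U (left U'.1) ℓ then -dotVec τ e U (left U'.1) (ℓ - 1) else 0 := by
      split_ifs with h1
      · exact h.B _ _ _ h1
      · rw [h.zero _ _ _ h1, Matrix.mulVec_zero]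
    have hA : (τ.butterfly e).A U' *ᵥ dotVec τ e U (right U'.1) (ℓ - 1) =
        if τ.HasDot U (right U'.1) (ℓ - 1) then dotVec τ e U (left U'.1) (ℓ - 1) else 0 := by
      split_ifs with h1
      · exact h.A _ _ _ h1
      · rw [h.zero _ _ _ h1, Matrix.mulVec_zero]
    rw [hB, hA]
    by_cases hU : U' = U
    · subst hU
      have ha := h.a U'
      rw [hasDot_right_self] at hd
      have hz : ¬ τ.HasDot U' (left U'.1) (ℓ - 1) → dotVec τ e U' (left U'.1) (ℓ - 1) = 0 :=
        h.zero U' _ (ℓ - 1)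
      simp only [hasDot_left_self, hasDot_right_self, true_and] at hz ⊢
      -- On the dot just above the top of the column at `U⁻` the map `A` is zero, and `-A B'` is
      -- cancelled by `a b`. On all other dots `b` vanishes and `A` commutes with lowering.
      by_cases h1 : ℓ = τ.height U' (left U'.1)
      · rw [if_neg (by omega), if_pos h1, Matrix.mulVec_neg, ha, ← h1]
        split_ifs with h2
        · simp
        · rw [hz (by omega)]; simp
      · rw [if_neg h1, Matrix.mulVec_zero, add_zero]
        split_ifs with h2 h3 h3
        · simp
        · rw [hz (by omega)]; simp
        · rw [hz (by omega)]; simp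
        · simp
    · have hU' : ¬ U = U' := fun e => hU e.symm
      rw [if_neg (c := U = U' ∧ _) (by tauto), Matrix.mulVec_zero, add_zero,
        if_pos ((τ.hasDot_D5 hU ℓ).1 hd)]
      split_ifs with h2
      · simp
      · rw [h.zero U _ (ℓ - 1) ((τ.hasDot_D5 hU _).not.1 h2)]; simp
  · intro i hi h1 h2
    refine sub_eq_zero.2 (ext_dotVec e fun U ℓ hd => ?_)
    exact (h.B' ⟨_, h1⟩ U ℓ hd).trans (h.B ⟨_, h2⟩ U ℓ hd).symm
  · intro i hi h1 h2
    refine sub_eq_zero.2 (ext_dotVec e fun U ℓ hd => ?_)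
    exact (h.C_D ⟨_, h2⟩ U hd).trans (h.D_C ⟨_, h1⟩ U hd).symm
  · intro i hi h1 h2
    refine sub_eq_zero.2 (ext_dotVec e fun U ℓ hd => ?_)
    rw [Matrix.neg_mulVec]
    exact (congrArg Neg.neg (h.D_C ⟨_, h1⟩ U hd)).trans (h.B ⟨_, h2⟩ U ℓ hd).symm
  · intro i hi h1 h2
    refine (ext_dotVec e fun U ℓ hd => ?_)
    rw [Matrix.add_mulVec, Matrix.zero_mulVec]
    refine (congrArg₂ _ (h.C_D ⟨_, h2⟩ U hd) (h.B' ⟨_, h1⟩ U ℓ hd)).trans (add_neg_cancel _)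

/-- `A` detects the coordinates of all dots that have a neighbour at `U⁻`. The other dots lie in the
butterfly of `U`, above the column at `U⁻`: the lowest is detected by `b`, the higher ones after
lowering by `B'`. -/
lemma S1_butterfly : S1 (τ.butterfly e) := by
  intro U S hB hA hb
  have hA' : ∀ s ∈ S, ∀ q : 𝓓.W (right U.1),
      τ.HasDot (e _ q).1 (left U.1) (level (e _ q)) → s q = 0 := fun s hs q hd => by
    obtain ⟨p, hp, hp'⟩ := exists_dot hd
    obtain ⟨p, rfl⟩ := (e _).surjective p
    have h := congrFun (hA s hs) p
    rw [Matrix.mulVec, dotProduct, Finset.sum_eq_single q] at h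
    · simpa [butterfly, hp, hp'] using h
    · intro q' _ hq'
      refine mul_eq_zero_of_left (if_neg fun h' => hq' ?_) _
      exact (e _).injective (dot_ext (h'.1.symm.trans hp) (h'.2.symm.trans hp'))
    · simp
  have hb' : ∀ (n : ℕ), ∀ s ∈ S, ∀ q : 𝓓.W (right U.1), (e _ q).1 = U →
      level (e _ q) = τ.height U (left U.1) + n → s q = 0 := by
    intro n
    induction n with
    | zero =>
      intro s hs q hq hq'
      have h := congrFun (hb s hs) 0
      rw [Matrix.mulVec, dotProduct, Finset.sum_eq_single q] at h
      · simpa [butterfly, hq, hq', top, bottom_left_self] using h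
      · intro q' _ hne
        refine mul_eq_zero_of_left (if_neg fun h' => hne ?_) _
        rw [top, bottom_left_self] at h'
        refine (e _).injective (dot_ext (h'.1.trans hq.symm) ?_)
        rw [h'.2, hq']; simp
      · simp
    | succ n ih =>
      intro s hs q hq hq'
      have hd := hasDot_level (e _ q)
      rw [hq, hasDot_right_self] at hd
      obtain ⟨p, hp, hp'⟩ := exists_dot (show τ.HasDot U (right U.1) (level (e _ q) - 1) by
        rw [hasDot_right_self]; omega)
      obtain ⟨p, rfl⟩ := (e _).surjective p
      have h := ih _ (hB s hs) p hp (by rw [hp', hq']; push_cast; ring)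
      rw [Matrix.mulVec, dotProduct, Finset.sum_eq_single q] at h
      · simpa [butterfly, hp, hp', hq] using h
      · intro q' _ hne
        refine mul_eq_zero_of_left (if_neg fun h' => hne ?_) _
        refine (e _).injective (dot_ext (h'.1.symm.trans (hp.trans hq.symm)) ?_)
        have := h'.2
        rw [hp'] at this; linarith
      · simp
  rw [eq_bot_iff]
  intro s hs
  rw [Submodule.mem_bot]
  funext q
  have hd := hasDot_level (e _ q)
  by_cases hq : (e _ q).1 = U
  · rw [hq, hasDot_right_self] at hd
    rcases lt_or_ge (level (e _ q)) (τ.height U (left U.1)) with hlt | hge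
    · exact hA' s hs q (by rw [hq, hasDot_left_self]; omega)
    · exact hb' (level (e _ q) - τ.height U (left U.1)).toNat s hs q hq (by omega)
  · exact hA' s hs q ((τ.hasDot_D5 (fun h => hq h.symm) _).1 hd)

/-- The dots of other butterflies are in the image of `A`; those of the butterfly of `U` arise from
its top dot `a_U(1)` by applying `B`. -/
lemma S2_butterfly : S2 (τ.butterfly e) := by
  intro U T hB hA ha
  have h := isFrame_butterfly e
  refine eq_top_of_dotVec_mem e fun U' ℓ hd => ?_
  by_cases hU : U = U'
  · subst hU
    have key : ∀ n : ℕ, dotVec τ e U (left U.1) (τ.height U (left U.1) - 1 - n) ∈ T := by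
      intro n
      induction n with
      | zero => simpa using h.a U ▸ ha 1
      | succ n ih =>
        by_cases hd' : τ.HasDot U (left U.1) (τ.height U (left U.1) - 1 - n)
        · have h1 := T.neg_mem (hB _ ih)
          rw [h.B _ _ _ hd', neg_neg] at h1
          rwa [Nat.cast_succ, ← sub_sub]
        · rw [h.zero]
          · exact T.zero_mem
          · rw [hasDot_left_self] at *
            push_cast; omega
    rw [hasDot_left_self] at hd
    convert key (τ.height U (left U.1) - 1 - ℓ).toNat using 1
    congr 1; omega
  · rw [← h.A U U' ℓ ((τ.hasDot_D5 hU ℓ).2 hd)]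
    exact hA _

/-- From left to right, `D` hits every dot at `V⁺` except the top dots of columns left of their D5
brane. Those come from the other direction: `A` and `C` carry `a_U(1)` along the tops of the columns
to the left of `U`. -/
lemma costable_butterfly : Costable (τ.butterfly e) := by
  intro T hT
  have h := isFrame_butterfly e
  have htop : ∀ (U : 𝓓.D5) (j : ℕ), j ≤ U.1.1 →
      dotVec τ e U j (τ.bottom U j + τ.height U j - 1) ∈ T j := by
    intro U j hj
    refine Nat.decreasingInduction (n := U.1.1) (motive := fun j _ =>
      dotVec τ e U j (τ.bottom U j + τ.height U j - 1) ∈ T j) ?_ ?_ hj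
    · intro j hj ih
      rcases hk : 𝓓.kind ⟨j, hj.trans U.1.2⟩ with _ | _
      · let U' : 𝓓.D5 := ⟨⟨j, hj.trans U.1.2⟩, hk⟩
        have hne : U' ≠ U := fun e => by rw [← e] at hj; exact lt_irrefl _ hj
        change dotVec τ e U (right U'.1) (τ.bottom U (right U'.1) + τ.height U (right U'.1) - 1) ∈
          T (right U'.1) at ih
        by_cases hd : τ.HasDot U (right U'.1)
            (τ.bottom U (right U'.1) + τ.height U (right U'.1) - 1)
        · have h1 := hT.A U' _ ih
          rw [h.A _ _ _ hd, τ.bottom_D5 hne, τ.height_D5 hne] at h1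
          exact h1
        · rw [τ.hasDot_D5 hne, τ.bottom_D5 hne, τ.height_D5 hne] at hd
          rw [h.zero _ _ _ hd]
          exact Submodule.zero_mem _
      · let V : 𝓓.NS5 := ⟨⟨j, hj.trans U.1.2⟩, hk⟩
        change dotVec τ e U (right V.1) (τ.bottom U (right V.1) + τ.height U (right V.1) - 1) ∈
          T (right V.1) at ih
        obtain ⟨x, h1, h2, h3⟩ := τ.exists_left_NS5 (U := U) (V := V) hj
        change dotVec τ e U (left V.1) (τ.bottom U (left V.1) + τ.height U (left V.1) - 1) ∈ _
        by_cases hd : τ.HasDot U (right V.1)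
            (τ.bottom U (right V.1) + τ.height U (right V.1) - 1)
        · have h4 := hT.C V _ ih
          rw [h.C _ _ _ hd] at h4
          convert h4 using 2
          omega
        · rw [h.zero]
          · exact Submodule.zero_mem _
          · rw [HasDot] at *; omega
    · have h1 := hT.a U 1
      rw [h.a] at h1
      have h2 := τ.bottom_left_self U
      simp only [left] at h1 h2 ⊢
      rwa [h2, zero_add]
  refine induction_right (𝓓 := 𝓓) (P := fun j => T j = ⊤) (fun j hj => ?_) (fun U hU => ?_)
    (fun V hV => ?_)
  · have := subsingleton_of_mult (mult_eq_zero hj)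
    exact Subsingleton.elim _ _
  · rw [eq_top_iff]
    exact fun w _ => hT.A_inv U w (hU ▸ Submodule.mem_top)
  · refine eq_top_of_dotVec_mem e fun U ℓ hd => ?_
    have key : τ.HasDot U (left V.1) ℓ → dotVec τ e U (right V.1) ℓ ∈ T (right V.1) :=
      fun hd' => h.D V U ℓ hd' ▸ hT.D V _ (hV ▸ Submodule.mem_top)
    rcases lt_or_gt_of_ne (pos_ne V U) with hVU | hVU
    · obtain ⟨x, h1, h2, h3⟩ := τ.exists_left_NS5 hVU
      -- Left of `U` the column at `V⁻` ends one level lower, so exactly the top dot at `V⁺` has no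
      -- preimage under `D`.
      by_cases hℓ : ℓ = τ.bottom U (right V.1) + τ.height U (right V.1) - 1
      · rw [hℓ]
        exact htop U (right V.1) hVU
      · refine key ?_
        rw [HasDot] at *; omega
    · obtain ⟨x, h1, h2, h3⟩ := τ.exists_right_NS5 hVU
      refine key ?_
      rw [HasDot] at *; omega

/-- The butterfly diagram of a tie diagram as a stable point. -/
def butterflyStable : Stable 𝓓 :=
  ⟨⟨τ.butterfly e, isMomentZero_butterfly e, S1_butterfly e, S2_butterfly e⟩,
    Costable.isStable (costable_butterfly e)⟩

end

section

open TieDiagram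

variable {τ : TieDiagram 𝓓} (e : τ.Labelling)

/-! ### Butterfly diagrams represent fixed points -/

/-- The weight of a dot. -/
def dotWeight (τ : TieDiagram 𝓓) (t : Torus 𝓓) (U : 𝓓.D5) (ℓ : ℤ) : ℂˣ :=
  (t.1 U)⁻¹ * t.2 ^ ((τ.height U (left U.1) : ℤ) - 1 - ℓ)

/-- The diagonal gauge transformation that multiplies every dot by its weight. -/
def dotGauge (t : Torus 𝓓) : Gauge 𝓓 := fun j =>
  ⟨Matrix.diagonal fun p => (dotWeight τ t (e j p).1 (level (e j p))).val,
    Matrix.diagonal fun p => ((dotWeight τ t (e j p).1 (level (e j p)))⁻¹ : ℂˣ).val,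
    by simp [Matrix.diagonal_mul_diagonal], by simp [Matrix.diagonal_mul_diagonal]⟩

lemma dotWeight_sub_one (t : Torus 𝓓) (U : 𝓓.D5) (ℓ : ℤ) :
    (dotWeight τ t U (ℓ - 1)).val = t.2.val * (dotWeight τ t U ℓ).val := by
  rw [← Units.val_mul, dotWeight, dotWeight, mul_left_comm, ← zpow_one_add]
  congr 3; ring

lemma dotGauge_mulVec (t : Torus 𝓓) (U : 𝓓.D5) (j : ℕ) (ℓ : ℤ) :
    (dotGauge e t j).val *ᵥ dotVec τ e U j ℓ = (dotWeight τ t U ℓ).val • dotVec τ e U j ℓ := by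
  funext p
  simp only [dotGauge, Matrix.mulVec_diagonal, dotVec, Pi.smul_apply, smul_eq_mul]
  split_ifs with h
  · rw [h.1, h.2]
  · simp

/-- The weights are forced: `a_U(1)`, at level `height - 1`, has weight `(t U)⁻¹`, and lowering by
one multiplies by `ħ`. The dot detected by `b U`, one level above `a_U(1)`, then has weight `(ħ t
U)⁻¹`, which cancels the factor on `b U`. -/
lemma torus_smul_butterfly (t : Torus 𝓓) : dotGauge e t • τ.butterfly e = t • τ.butterfly e := by
  have h := isFrame_butterfly e
  refine smul_eq_of_isHom ?_
  rw [torus_smul_def]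
  constructor <;> intro U
  · refine ext_dotVec e fun U' ℓ hd => ?_
    rw [← Matrix.mulVec_mulVec, ← Matrix.mulVec_mulVec, dotGauge_mulVec, torusAct_A,
      Matrix.mulVec_smul, h.A _ _ _ hd, dotGauge_mulVec]
  · refine ext_dotVec e fun U' ℓ hd => ?_
    rw [← Matrix.mulVec_mulVec, dotGauge_mulVec, torusAct_b, one_smul, Matrix.smul_mulVec,
      Matrix.mulVec_smul, h.b _ _ _ hd]
    split_ifs with h1
    · obtain ⟨rfl, rfl⟩ := h1
      rw [dotWeight, smul_smul, sub_right_comm, sub_self, zero_sub, zpow_neg_one]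
      convert one_smul ℂ _ using 2
      simp
      field_simp
    · simp
  · refine Matrix.ext_of_mulVec_single fun i => ?_
    have h1 : (Pi.single i 1 : Fin 1 → ℂ) = 1 := by
      funext k; simp [Subsingleton.elim k i]
    rw [h1, ← Matrix.mulVec_mulVec, one_smul, torusAct_a, Matrix.smul_mulVec, h.a, dotGauge_mulVec,
      dotWeight, sub_self, zpow_zero, mul_one]
  · refine ext_dotVec e fun U' ℓ hd => ?_
    rw [← Matrix.mulVec_mulVec, ← Matrix.mulVec_mulVec, dotGauge_mulVec, torusAct_B,
      Matrix.mulVec_smul, Matrix.smul_mulVec, h.B _ _ _ hd, Matrix.mulVec_neg, dotGauge_mulVec,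
      dotWeight_sub_one, smul_neg, smul_neg, smul_smul, mul_comm]
  · refine ext_dotVec e fun U' ℓ hd => ?_
    rw [← Matrix.mulVec_mulVec, ← Matrix.mulVec_mulVec, dotGauge_mulVec, torusAct_B',
      Matrix.mulVec_smul, Matrix.smul_mulVec, h.B' _ _ _ hd, Matrix.mulVec_neg, dotGauge_mulVec,
      dotWeight_sub_one, smul_neg, smul_neg, smul_smul, mul_comm]
  · refine ext_dotVec e fun U' ℓ hd => ?_
    rw [← Matrix.mulVec_mulVec, ← Matrix.mulVec_mulVec, dotGauge_mulVec, torusAct_C,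
      Matrix.mulVec_smul, Matrix.smul_mulVec, h.C _ _ _ hd, dotGauge_mulVec,
      dotWeight_sub_one, smul_smul, mul_comm]
  · refine ext_dotVec e fun U' ℓ hd => ?_
    rw [← Matrix.mulVec_mulVec, ← Matrix.mulVec_mulVec, dotGauge_mulVec, torusAct_D,
      Matrix.mulVec_smul, h.D _ _ _ hd, dotGauge_mulVec]

lemma BowVariety.mk_eq_iff {m m' : Stable 𝓓} :
    BowVariety.mk m = BowVariety.mk m' ↔ ∃ g : Gauge 𝓓, g • m'.1.1 = m.1.1 := by
  refine Quotient.eq.trans ?_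
  refine exists_congr fun g => ⟨fun h => congrArg (fun x => x.1.1) h, fun h =>
    Subtype.ext (Subtype.ext h)⟩

lemma BowVariety.smul_mk (t : Torus 𝓓) (m : Stable 𝓓) :
    t • BowVariety.mk m = BowVariety.mk (t • m) := rfl

lemma butterfly_mem_fixedPoints :
    BowVariety.mk (butterflyStable e) ∈ MulAction.fixedPoints 𝓓.Torus 𝓓.BowVariety := by
  intro t
  rw [BowVariety.smul_mk, BowVariety.mk_eq_iff]
  exact ⟨dotGauge e t, torus_smul_butterfly e t⟩

/-! ### The tie diagram is determined by the fixed point -/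

lemma sum_height (τ : TieDiagram 𝓓) (j : ℕ) : ∑ U, τ.height U j = 𝓓.mult j := by
  rw [← τ.card_covers j]
  exact sum_tieHeight τ.ties j

lemma trace_dotGauge (x : 𝓓.D5 → ℂˣ) (j : ℕ) :
    (dotGauge e (x⁻¹, 1) j).val.trace = ∑ U, (τ.height U j : ℂ) * (x U).val := by
  simp only [dotGauge, dotWeight, one_zpow, Pi.inv_apply, inv_inv, mul_one, Matrix.trace_diagonal]
  rw [Equiv.sum_comp (e j) fun p => (x p.1).val, Fintype.sum_sigma]
  simp

/-- `g` followed by the compensating transformation of the second diagram, and that of the first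
followed by `g`, have the same effect. Stabilizers are trivial, so the two compensating
transformations are conjugate and have equal traces. -/
lemma height_eq_of_smul_eq {τ' : TieDiagram 𝓓} {e' : τ'.Labelling} {g : Gauge 𝓓}
    (h : g • τ.butterfly e = τ'.butterfly e') (U : 𝓓.D5) (j : ℕ) :
    τ.height U j = τ'.height U j := by
  have htr : ∀ x : 𝓓.D5 → ℂˣ, ∑ U, (τ.height U j : ℂ) * (x U).val =
      ∑ U, (τ'.height U j : ℂ) * (x U).val := fun x => by
    have h1 : (dotGauge e' (x⁻¹, 1) * g) • τ.butterfly e =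
        (g * dotGauge e (x⁻¹, 1)) • τ.butterfly e := by
      rw [mul_smul, mul_smul, h, torus_smul_butterfly, torus_smul_butterfly, ← h, ← smul_comm g]
    have h2 := (costable_butterfly e).eq_of_smul_eq (isMomentZero_butterfly e)
      (S1_butterfly e) h1
    have h3 := congrFun (eq_mul_inv_of_mul_eq h2) j
    have h4 : (dotGauge e' (x⁻¹, 1) j).val =
        (g j).val * (dotGauge e (x⁻¹, 1) j).val * (g j)⁻¹.val := congrArg Units.val h3
    rw [← trace_dotGauge e, ← trace_dotGauge e', h4, Matrix.trace_mul_comm, ← Matrix.mul_assoc,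
      Units.inv_mul, Matrix.one_mul]
  -- The value `2` at `U` and `1` elsewhere turns the trace into the multiplicity plus the height at
  -- `U`.
  have h1 := htr fun U' => if U' = U then Units.mk0 2 two_ne_zero else 1
  have h2 : ∀ f : 𝓓.D5 → ℕ, ∑ U', (f U' : ℂ) *
      ((if U' = U then Units.mk0 2 two_ne_zero else 1 : ℂˣ)).val = (∑ U', f U' + f U : ℕ) := by
    intro f
    have h3 : ∀ U', (f U' : ℂ) * ((if U' = U then Units.mk0 2 two_ne_zero else 1 : ℂˣ)).val =
        f U' + if U' = U then (f U' : ℂ) else 0 := fun U' => by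
      split_ifs
      · simp; ring
      · simp
    simp only [h3, Finset.sum_add_distrib]
    simp
  rw [h2 fun U => τ.height U j, h2 fun U => τ'.height U j, Nat.cast_inj, sum_height,
    sum_height] at h1
  omega

/-- `V` and `U` are tied iff the height at `U` jumps across `V`. -/
lemma tieDiagram_eq_of_smul_eq {τ' : TieDiagram 𝓓} {e' : τ'.Labelling} {g : Gauge 𝓓}
    (h : g • τ.butterfly e = τ'.butterfly e') : τ = τ' := by
  have hh := height_eq_of_smul_eq e h
  refine TieDiagram.ext (Finset.ext fun ⟨V, U⟩ => ?_)
  have hl : tieHeight τ.ties U (left V.1) = tieHeight τ'.ties U (left V.1) := hh U (left V.1)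
  have hr : tieHeight τ.ties U (right V.1) = tieHeight τ'.ties U (right V.1) := hh U (right V.1)
  rcases lt_or_gt_of_ne (pos_ne V U) with hlt | hlt
  · rw [tieHeight_left_NS5 _ hlt, tieHeight_left_NS5 _ hlt] at hr
    split_ifs at hr <;> first | omega | tauto
  · rw [tieHeight_right_NS5 _ hlt, tieHeight_right_NS5 _ hlt] at hl
    split_ifs at hl <;> first | omega | tauto

/-- The fixed points correspond to the binary contingency tables, once every fixed point is known
to be represented by a butterfly diagram. -/
lemma exists_equiv_BCT
    (H : ∀ f ∈ MulAction.fixedPoints 𝓓.Torus 𝓓.BowVariety,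
      ∃ (τ : 𝓓.TieDiagram) (e : τ.Labelling), Represents (τ.butterfly e) f) :
    ∃ Φ : MulAction.fixedPoints 𝓓.Torus 𝓓.BowVariety ≃ 𝓓.BCT,
      ∀ (τ : 𝓓.TieDiagram) (e : τ.Labelling) (f : MulAction.fixedPoints 𝓓.Torus 𝓓.BowVariety),
        Represents (τ.butterfly e) f.1 → (Φ f).1 = τ.table := by
  choose τ e hτ using fun f : MulAction.fixedPoints 𝓓.Torus 𝓓.BowVariety => H f.1 f.2
  have huniq : ∀ (τ' : 𝓓.TieDiagram) (e' : τ'.Labelling)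
      (f : MulAction.fixedPoints 𝓓.Torus 𝓓.BowVariety),
      Represents (τ'.butterfly e') f.1 → τ f = τ' := by
    rintro τ' e' f ⟨s', hs', hf'⟩
    obtain ⟨s, hs, hf⟩ := hτ f
    obtain ⟨g, hg⟩ := BowVariety.mk_eq_iff.1 (hf'.trans hf.symm)
    rw [hs, hs'] at hg
    exact tieDiagram_eq_of_smul_eq _ hg
  have hbij : Function.Bijective τ := by
    constructor
    · intro f f' hff'
      obtain ⟨s, hs, hf⟩ := hτ f
      obtain ⟨s', hs', hf'⟩ := hτ f'
      refine Subtype.ext (hf.symm.trans ((BowVariety.mk_eq_iff.2 ?_).trans hf'))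
      rw [hs, hs']
      have key : ∀ (τ₁ τ₂ : 𝓓.TieDiagram) (e₁ : τ₁.Labelling) (e₂ : τ₂.Labelling), τ₁ = τ₂ →
          ∃ g : Gauge 𝓓, g • τ₂.butterfly e₂ = τ₁.butterfly e₁ := by
        rintro τ₁ _ e₁ e₂ rfl
        exact (isFrame_butterfly e₁).exists_gauge e₂
      exact key _ _ _ _ hff'
    · intro τ'
      obtain ⟨e'⟩ : Nonempty τ'.Labelling := inferInstance
      exact ⟨⟨_, butterfly_mem_fixedPoints e'⟩, huniq τ' e' _ ⟨butterflyStable e', rfl, rfl⟩⟩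
  let Ψ : 𝓓.TieDiagram ≃ 𝓓.BCT :=
    (Equiv.Set.univ _).symm.trans (bijOn_table (𝓓 := 𝓓)).equiv
  refine ⟨(Equiv.ofBijective τ hbij).trans Ψ, fun τ' e' f hf => ?_⟩
  exact congrArg TieDiagram.table (huniq τ' e' f hf)

end

section

/-! ## Fixed points -/

/-- The nilpotent endomorphism `-B = -B' = C D = D C` of the space of a D3 brane. -/
def nilMap (m : Rep 𝓓) (j : ℕ) : Matrix (𝓓.W j) (𝓓.W j) ℂ :=
  if hj : j < 𝓓.size then
    match hk : 𝓓.kind ⟨j, hj⟩ with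
    | FiveBrane.D5 => -m.B ⟨⟨j, hj⟩, hk⟩
    | FiveBrane.NS5 => m.C ⟨⟨j, hj⟩, hk⟩ * m.D ⟨⟨j, hj⟩, hk⟩
  else 0

lemma nilMap_left_D5 (m : Rep 𝓓) (U : 𝓓.D5) : nilMap m (left U.1) = -m.B U := by
  obtain ⟨⟨j, hj⟩, hk⟩ := U
  simp only [nilMap, left, hj, dif_pos]
  split
  · rfl
  · rename_i h; cases h.symm.trans hk

lemma nilMap_left_NS5 (m : Rep 𝓓) (V : 𝓓.NS5) : nilMap m (left V.1) = m.C V * m.D V := by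
  obtain ⟨⟨j, hj⟩, hk⟩ := V
  simp only [nilMap, left, hj, dif_pos]
  split
  · rename_i h; cases h.symm.trans hk
  · rfl

/-- `nilMap` is read off the 5-brane to the right of a D3 brane; the moment map equation there says
that the 5-brane to the left gives the same endomorphism. -/
lemma nilMap_right_D5 {m : Rep 𝓓} (hm : IsMomentZero m) (U : 𝓓.D5) :
    nilMap m (right U.1) = -m.B' U := by
  rcases lt_or_ge (U.1.1 + 1) 𝓓.size with hj | hj
  · rcases hk : 𝓓.kind ⟨U.1.1 + 1, hj⟩ with _ | _
    · refine (nilMap_left_D5 m ⟨_, hk⟩).trans (neg_inj.2 ?_)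
      exact (sub_eq_zero.1 (hm.between_D5_D5 U.1.1 hj U.2 hk)).symm
    · refine (nilMap_left_NS5 m ⟨_, hk⟩).trans ?_
      exact eq_neg_of_add_eq_zero_left (hm.between_D5_NS5 U.1.1 hj U.2 hk)
  · have : IsEmpty (𝓓.W (right U.1)) := by
      rw [W, right, 𝓓.mult_of_size_le _ hj]; infer_instance
    exact Subsingleton.elim _ _

lemma nilMap_right_NS5 {m : Rep 𝓓} (hm : IsMomentZero m) (V : 𝓓.NS5) :
    nilMap m (right V.1) = m.D V * m.C V := by
  rcases lt_or_ge (V.1.1 + 1) 𝓓.size with hj | hj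
  · rcases hk : 𝓓.kind ⟨V.1.1 + 1, hj⟩ with _ | _
    · refine (nilMap_left_D5 m ⟨_, hk⟩).trans ?_
      exact (sub_eq_zero.1 (hm.between_NS5_D5 V.1.1 hj V.2 hk)) ▸ neg_neg _
    · refine (nilMap_left_NS5 m ⟨_, hk⟩).trans ?_
      exact sub_eq_zero.1 (hm.between_NS5_NS5 V.1.1 hj V.2 hk)
  · have : IsEmpty (𝓓.W (right V.1)) := by
      rw [W, right, 𝓓.mult_of_size_le _ hj]; infer_instance
    exact Subsingleton.elim _ _

/-- The vector `a_U(1)`. -/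
def aVec (m : Rep 𝓓) (U : 𝓓.D5) : 𝓓.W (left U.1) → ℂ := m.a U *ᵥ 1

/-- The linear form `b_U`. -/
def bForm (m : Rep 𝓓) (U : 𝓓.D5) (w : 𝓓.W (right U.1) → ℂ) : ℂ := (m.b U *ᵥ w) 0

lemma bForm_zero (m : Rep 𝓓) (U : 𝓓.D5) : bForm m U 0 = 0 := by simp [bForm]

lemma bForm_sub (m : Rep 𝓓) (U : 𝓓.D5) (w w' : 𝓓.W (right U.1) → ℂ) :
    bForm m U (w - w') = bForm m U w - bForm m U w' := by simp [bForm, Matrix.mulVec_sub]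

lemma bForm_smul (m : Rep 𝓓) (U : 𝓓.D5) (c : ℂ) (w : 𝓓.W (right U.1) → ℂ) :
    bForm m U (c • w) = c * bForm m U w := by simp [bForm, Matrix.mulVec_smul]

lemma mulVec_eq_bForm (m : Rep 𝓓) (U : 𝓓.D5) (w : 𝓓.W (right U.1) → ℂ) :
    m.b U *ᵥ w = fun _ => bForm m U w := by
  funext i; rw [bForm, Subsingleton.elim i 0]

lemma a_mulVec (m : Rep 𝓓) (U : 𝓓.D5) (w : Fin 1 → ℂ) : m.a U *ᵥ w = w 0 • aVec m U := by
  rw [aVec, ← Matrix.mulVec_smul]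
  congr 1
  funext i
  simp [Subsingleton.elim i 0]

section

variable {m : Rep 𝓓}

lemma A_nilMap (hm : IsMomentZero m) (U : 𝓓.D5) (w : 𝓓.W (right U.1) → ℂ) :
    m.A U *ᵥ (nilMap m (right U.1) *ᵥ w) =
      nilMap m (left U.1) *ᵥ (m.A U *ᵥ w) - bForm m U w • aVec m U := by
  rw [nilMap_right_D5 hm, nilMap_left_D5, Matrix.neg_mulVec, Matrix.mulVec_neg,
    hm.A_mulVec_B', Matrix.neg_mulVec, a_mulVec m U (m.b U *ᵥ w), bForm]
  abel

lemma C_D_mulVec (V : 𝓓.NS5) (w : 𝓓.W (left V.1) → ℂ) :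
    m.C V *ᵥ (m.D V *ᵥ w) = nilMap m (left V.1) *ᵥ w := by
  rw [nilMap_left_NS5, Matrix.mulVec_mulVec]

lemma D_C_mulVec (hm : IsMomentZero m) (V : 𝓓.NS5) (w : 𝓓.W (right V.1) → ℂ) :
    m.D V *ᵥ (m.C V *ᵥ w) = nilMap m (right V.1) *ᵥ w := by
  rw [nilMap_right_NS5 hm, Matrix.mulVec_mulVec]

lemma C_nilMap (hm : IsMomentZero m) (V : 𝓓.NS5) (w : 𝓓.W (right V.1) → ℂ) :
    m.C V *ᵥ (nilMap m (right V.1) *ᵥ w) = nilMap m (left V.1) *ᵥ (m.C V *ᵥ w) := by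
  rw [← D_C_mulVec hm, C_D_mulVec]

lemma D_nilMap (hm : IsMomentZero m) (V : 𝓓.NS5) (w : 𝓓.W (left V.1) → ℂ) :
    m.D V *ᵥ (nilMap m (left V.1) *ᵥ w) = nilMap m (right V.1) *ᵥ (m.D V *ᵥ w) := by
  rw [← C_D_mulVec, D_C_mulVec hm]

lemma pow_succ_mulVec {n : ℕ} (M : Matrix (Fin n) (Fin n) ℂ) (k : ℕ) (w : Fin n → ℂ) :
    M ^ (k + 1) *ᵥ w = M ^ k *ᵥ (M *ᵥ w) := by
  rw [pow_succ, Matrix.mulVec_mulVec]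

lemma pow_succ_mulVec' {n : ℕ} (M : Matrix (Fin n) (Fin n) ℂ) (k : ℕ) (w : Fin n → ℂ) :
    M ^ (k + 1) *ᵥ w = M *ᵥ (M ^ k *ᵥ w) := by
  rw [pow_succ', Matrix.mulVec_mulVec]

/-- A vector killed by `A` and by all `b N ^ k` vanishes. -/
lemma eq_zero_of_S1 (hm : IsMomentZero m) (hS : S1 m) (U : 𝓓.D5) {w : 𝓓.W (right U.1) → ℂ}
    (hA : m.A U *ᵥ w = 0) (hb : ∀ k : ℕ, bForm m U (nilMap m (right U.1) ^ k *ᵥ w) = 0) :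
    w = 0 := by
  have hA' : ∀ k : ℕ, m.A U *ᵥ (nilMap m (right U.1) ^ k *ᵥ w) = 0 := fun k => by
    induction k with
    | zero => simpa using hA
    | succ k ih => rw [pow_succ_mulVec', A_nilMap hm, ih, hb, zero_smul, Matrix.mulVec_zero,
        sub_zero]
  let S := Submodule.span ℂ (Set.range fun k : ℕ => nilMap m (right U.1) ^ k *ᵥ w)
  have hind : ∀ (T : Submodule ℂ (𝓓.W (right U.1) → ℂ)),
      (∀ k : ℕ, nilMap m (right U.1) ^ k *ᵥ w ∈ T) → ∀ s ∈ S, s ∈ T := fun T hT s hs =>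
    Submodule.span_le.2 (by rintro _ ⟨k, rfl⟩; exact hT k) hs
  have hbot : S = ⊥ := by
    refine hS U S ?_ ?_ ?_
    · refine hind (S.comap (m.B' U).mulVecLin) fun k => ?_
      rw [Submodule.mem_comap, Matrix.mulVecLin_apply, ← neg_neg (m.B' U), ← nilMap_right_D5 hm,
        Matrix.neg_mulVec, ← pow_succ_mulVec']
      exact S.neg_mem (Submodule.subset_span ⟨k + 1, rfl⟩)
    · exact hind (LinearMap.ker (m.A U).mulVecLin) fun k => hA' k
    · refine hind (LinearMap.ker (m.b U).mulVecLin) fun k => ?_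
      rw [LinearMap.mem_ker, Matrix.mulVecLin_apply, mulVec_eq_bForm, hb]; rfl
  have hw : w ∈ S := Submodule.subset_span ⟨0, by simp⟩
  rwa [hbot, Submodule.mem_bot] at hw

end

/-! ### Weights and generalized eigenspaces -/

/-- An automorphism that shows that a point is fixed by a torus element: a family of matrices that
intertwines `A, D`, multiplies `N, C` by `c`, and for which `a U`, `b U` have weights
`μ U 0`, `μ U 1`; the weights `μ U ℓ` are pairwise distinct. -/
structure IsGrading (m : Rep 𝓓) (c : ℂ) (μ : 𝓓.D5 → ℤ → ℂ)
    (g : ∀ j, Matrix (𝓓.W j) (𝓓.W j) ℂ) : Prop where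
  inj : ∀ U U' ℓ ℓ', μ U ℓ = μ U' ℓ' → U = U' ∧ ℓ = ℓ'
  sub_one : ∀ U ℓ, μ U (ℓ - 1) = c * μ U ℓ
  ne_zero : c ≠ 0
  A : ∀ (U : 𝓓.D5) w, g (left U.1) *ᵥ (m.A U *ᵥ w) = m.A U *ᵥ (g (right U.1) *ᵥ w)
  C : ∀ (V : 𝓓.NS5) w, g (left V.1) *ᵥ (m.C V *ᵥ w) = c • m.C V *ᵥ (g (right V.1) *ᵥ w)
  D : ∀ (V : 𝓓.NS5) w, g (right V.1) *ᵥ (m.D V *ᵥ w) = m.D V *ᵥ (g (left V.1) *ᵥ w)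
  N : ∀ j w, g j *ᵥ (nilMap m j *ᵥ w) = c • nilMap m j *ᵥ (g j *ᵥ w)
  a : ∀ U, g (left U.1) *ᵥ aVec m U = μ U 0 • aVec m U
  b : ∀ U w, bForm m U (g (right U.1) *ᵥ w) = μ U 1 * bForm m U w

/-- The generalized eigenspace of a matrix. -/
abbrev genEig {n : ℕ} (g : Matrix (Fin n) (Fin n) ℂ) (ν : ℂ) : Submodule ℂ (Fin n → ℂ) :=
  Module.End.maxGenEigenspace (Matrix.toLin' g) ν

lemma mem_genEig_of_eq {n : ℕ} {g : Matrix (Fin n) (Fin n) ℂ} {ν : ℂ} {w : Fin n → ℂ}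
    (h : g *ᵥ w = ν • w) : w ∈ genEig g ν := by
  rw [genEig, Module.End.mem_maxGenEigenspace]
  exact ⟨1, by simp [h]⟩

lemma map_genEig {n n' : ℕ} {g : Matrix (Fin n) (Fin n) ℂ} {g' : Matrix (Fin n') (Fin n') ℂ}
    {M : Matrix (Fin n') (Fin n) ℂ} {c : ℂ} (h : ∀ w, g' *ᵥ (M *ᵥ w) = c • M *ᵥ (g *ᵥ w))
    {ν : ℂ} {w : Fin n → ℂ} (hw : w ∈ genEig g ν) : M *ᵥ w ∈ genEig g' (c * ν) := by
  rw [genEig, Module.End.mem_maxGenEigenspace] at *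
  obtain ⟨k, hk⟩ := hw
  refine ⟨k, ?_⟩
  have key : ∀ (k : ℕ) (w : Fin n → ℂ), ((Matrix.toLin' g' - (c * ν) • 1) ^ k) (M *ᵥ w) =
      c ^ k • M *ᵥ (((Matrix.toLin' g - ν • 1) ^ k) w) := by
    intro k
    induction k with
    | zero => intro w; simp
    | succ k ih =>
      intro w
      have h1 : (Matrix.toLin' g' - (c * ν) • 1) (M *ᵥ w) =
          M *ᵥ (c • (Matrix.toLin' g - ν • 1) w) := by
        simp [h, Matrix.mulVec_sub, Matrix.mulVec_smul, smul_sub, smul_smul]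
      rw [pow_succ, Module.End.mul_apply, h1, ih, map_smul, Matrix.mulVec_smul, smul_smul,
        ← pow_succ, ← Module.End.mul_apply, ← pow_succ]
  rw [key, hk, Matrix.mulVec_zero, smul_zero]

namespace IsGrading

variable {m : Rep 𝓓} {c : ℂ} {μ : 𝓓.D5 → ℤ → ℂ} {g : ∀ j, Matrix (𝓓.W j) (𝓓.W j) ℂ}

lemma pow_mul (hg : IsGrading m c μ g) (U : 𝓓.D5) (ℓ : ℤ) (k : ℕ) :
    c ^ k * μ U ℓ = μ U (ℓ - k) := by
  induction k with
  | zero => simp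
  | succ k ih => rw [pow_succ', mul_assoc, ih, ← hg.sub_one]; congr 1; push_cast; ring

lemma A_mem (hg : IsGrading m c μ g) (U : 𝓓.D5) {ν : ℂ} {w : 𝓓.W (right U.1) → ℂ}
    (hw : w ∈ genEig (g _) ν) : m.A U *ᵥ w ∈ genEig (g (left U.1)) ν := by
  have := map_genEig (g' := g (left U.1)) (M := m.A U) (c := 1)
    (fun w => by rw [one_smul]; exact hg.A U w) hw
  rwa [one_mul] at this

lemma N_pow_mem (hg : IsGrading m c μ g) {j : ℕ} (k : ℕ) {ν : ℂ} {w : 𝓓.W j → ℂ}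
    (hw : w ∈ genEig (g j) ν) : nilMap m j ^ k *ᵥ w ∈ genEig (g j) (c ^ k * ν) := by
  induction k with
  | zero => simpa using hw
  | succ k ih =>
    rw [pow_succ_mulVec', pow_succ', mul_assoc]
    exact map_genEig (hg.N j) ih

/-- `b (g - ν) = (μ U 1 - ν) b`: a power of `g - ν` kills `w`, while the scalar on the right is not
zero. -/
lemma bForm_eq_zero (hg : IsGrading m c μ g) {U : 𝓓.D5} {ν : ℂ} {w : 𝓓.W (right U.1) → ℂ}
    (hw : w ∈ genEig (g _) ν) (hν : ν ≠ μ U 1) : bForm m U w = 0 := by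
  rw [genEig, Module.End.mem_maxGenEigenspace] at hw
  obtain ⟨k, hk⟩ := hw
  have key : ∀ (k : ℕ) w, bForm m U (((Matrix.toLin' (g (right U.1)) - ν • 1) ^ k) w) =
      (μ U 1 - ν) ^ k * bForm m U w := by
    intro k
    induction k with
    | zero => intro w; simp
    | succ k ih =>
      intro w
      rw [pow_succ, Module.End.mul_apply, ih, LinearMap.sub_apply, bForm_sub, Matrix.toLin'_apply,
        hg.b, LinearMap.smul_apply, bForm_smul, Module.End.one_apply]
      ring
  have h := key k w
  rw [hk, bForm_zero] at h
  exact (mul_eq_zero.1 h.symm).resolve_left (pow_ne_zero _ (sub_ne_zero.2 hν.symm))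

/-- The weight of `N ^ k w` is `c ^ k ν`, so no `b N ^ k` can see `w`, and (S1) reduces to
injectivity of `A` on this weight space. -/
lemma eq_zero_of_A (hg : IsGrading m c μ g) (hm : IsMomentZero m) (hS : S1 m) {U : 𝓓.D5} {ν : ℂ}
    {w : 𝓓.W (right U.1) → ℂ} (hw : w ∈ genEig (g _) ν) (hν : ∀ k : ℕ, c ^ k * ν ≠ μ U 1)
    (hA : m.A U *ᵥ w = 0) : w = 0 :=
  eq_zero_of_S1 hm hS U hA fun k => hg.bForm_eq_zero (hg.N_pow_mem k hw) (hν k)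

lemma eq_zero_of_A_of_ne (hg : IsGrading m c μ g) (hm : IsMomentZero m) (hS : S1 m)
    {U U' : 𝓓.D5} {ℓ : ℤ} {w : 𝓓.W (right U'.1) → ℂ} (hw : w ∈ genEig (g _) (μ U ℓ))
    (h : U = U' → ℓ ≤ 0) (hA : m.A U' *ᵥ w = 0) : w = 0 := by
  refine hg.eq_zero_of_A hm hS hw (fun k hk => ?_) hA
  rw [hg.pow_mul] at hk
  obtain ⟨h1, h2⟩ := hg.inj _ _ _ _ hk
  have := h h1
  omega

/-- Among the forms `b N ^ k` in (S1) only the one with `ℓ - k = 1` can be nonzero on this weight.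
-/
lemma eq_zero_of_bForm (hg : IsGrading m c μ g) (hm : IsMomentZero m) (hS : S1 m)
    {U : 𝓓.D5} {ℓ : ℤ} {w : 𝓓.W (right U.1) → ℂ} (hw : w ∈ genEig (g _) (μ U ℓ))
    (hA : m.A U *ᵥ w = 0)
    (hb : bForm m U (nilMap m (right U.1) ^ (ℓ - 1).toNat *ᵥ w) = 0) : w = 0 := by
  refine eq_zero_of_S1 hm hS U hA fun k => ?_
  by_cases hk : ℓ - k = 1
  · rwa [show (ℓ - 1).toNat = k by omega] at hb
  · refine hg.bForm_eq_zero (hg.N_pow_mem k hw) fun h => hk ?_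
    rw [hg.pow_mul] at h
    exact (hg.inj _ _ _ _ h).2

lemma eigen_N (hg : IsGrading m c μ g) {U : 𝓓.D5} {ℓ : ℤ} {j : ℕ} {w : 𝓓.W j → ℂ}
    (hw : g j *ᵥ w = μ U ℓ • w) :
    g j *ᵥ (nilMap m j *ᵥ w) = μ U (ℓ - 1) • nilMap m j *ᵥ w := by
  rw [hg.N, hw, Matrix.mulVec_smul, smul_smul, hg.sub_one]

lemma eigen_a (hg : IsGrading m c μ g) (U : 𝓓.D5) (k : ℕ) :
    g (left U.1) *ᵥ (nilMap m (left U.1) ^ k *ᵥ aVec m U) =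
      μ U (-k) • nilMap m (left U.1) ^ k *ᵥ aVec m U := by
  induction k with
  | zero => simpa using hg.a U
  | succ k ih =>
    rw [pow_succ_mulVec', hg.eigen_N ih]
    congr 2
    push_cast; ring

/-- Across a D5 brane `U'`, an eigenvector of a weight that does not belong to `U'` lifts. -/
lemma exists_lift (hg : IsGrading m c μ g) (hm : IsMomentZero m) (hS : S1 m) (hS2 : S2 m)
    {U U' : 𝓓.D5} (hU : U ≠ U') {ℓ : ℤ} {x : 𝓓.W (left U'.1) → ℂ}
    (hx : g _ *ᵥ x = μ U ℓ • x) :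
    ∃ w, g (right U'.1) *ᵥ w = μ U ℓ • w ∧ m.A U' *ᵥ w = x := by
  -- By (S2) the space at `U'⁻` is `im A + R`. All weights of `R` belong to `U'`, so the part of
  -- weight `μ U ℓ` must come from the image of `A`.
  let R := Submodule.span ℂ (Set.range fun k : ℕ => nilMap m (left U'.1) ^ k *ᵥ aVec m U')
  have haR : aVec m U' ∈ R := Submodule.subset_span ⟨0, by simp⟩
  have hBneg : ∀ x, m.B U' *ᵥ x = -(nilMap m (left U'.1) *ᵥ x) := fun x => by
    rw [nilMap_left_D5, Matrix.neg_mulVec, neg_neg]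
  have htop := hS2 U' (LinearMap.range (m.A U').mulVecLin ⊔ R) ?_ ?_ ?_
  · have hF : R ≤ ⨆ ν ≠ μ U ℓ, genEig (g (left U'.1)) ν := by
      refine Submodule.span_le.2 ?_
      rintro _ ⟨k, rfl⟩
      refine Submodule.mem_iSup_of_mem (μ U' (-k)) (Submodule.mem_iSup_of_mem (fun h => ?_)
        (mem_genEig_of_eq (hg.eigen_a U' k)))
      exact hU (hg.inj _ _ _ _ h).1.symm
    obtain ⟨_, ⟨w, rfl⟩, y, hy, hxy⟩ := Submodule.mem_sup.1 (htop ▸ Submodule.mem_top (x := x))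
    have hdec : w ∈ genEig (g (right U'.1)) (μ U ℓ) ⊔ ⨆ ν ≠ μ U ℓ, genEig (g (right U'.1)) ν := by
      have h1 : ⨆ ν, genEig (g (right U'.1)) ν ≤
          genEig (g (right U'.1)) (μ U ℓ) ⊔ ⨆ ν ≠ μ U ℓ, genEig (g (right U'.1)) ν := by
        refine iSup_le fun ν => ?_
        rcases eq_or_ne ν (μ U ℓ) with rfl | h
        · exact le_sup_left
        · exact le_sup_of_le_right (le_iSup₂_of_le ν h le_rfl)
      rw [Module.End.iSup_maxGenEigenspace_eq_top] at h1
      exact h1 Submodule.mem_top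
    obtain ⟨w1, hw1, w2, hw2, rfl⟩ := Submodule.mem_sup.1 hdec
    have hAw2 : m.A U' *ᵥ w2 ∈ ⨆ ν ≠ μ U ℓ, genEig (g (left U'.1)) ν := by
      have h1 : ⨆ ν ≠ μ U ℓ, genEig (g (right U'.1)) ν ≤
          (⨆ ν ≠ μ U ℓ, genEig (g (left U'.1)) ν).comap (m.A U').mulVecLin :=
        iSup₂_le fun ν h w hw => Submodule.mem_iSup_of_mem ν
          (Submodule.mem_iSup_of_mem h (hg.A_mem U' hw))
      exact h1 hw2
    have hAw1 : m.A U' *ᵥ w1 = x := by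
      rw [← sub_eq_zero, ← neg_eq_zero, neg_sub]
      refine Submodule.disjoint_def.1
        (Module.End.independent_maxGenEigenspace (Matrix.toLin' (g (left U'.1))) (μ U ℓ)) _
        (Submodule.sub_mem _ (mem_genEig_of_eq hx) (hg.A_mem U' hw1)) ?_
      have : x - m.A U' *ᵥ w1 = m.A U' *ᵥ w2 + y := by
        rw [← hxy, Matrix.mulVecLin_apply, Matrix.mulVec_add]; abel
      rw [this]
      exact Submodule.add_mem _ hAw2 (hF hy)
    -- So far `w1` is only a generalized eigenvector. The defect `g w1 - μ U ℓ • w1` has the same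
    -- weight and is killed by `A`, since `x` is a genuine eigenvector; hence it vanishes.
    refine ⟨w1, ?_, hAw1⟩
    rw [← sub_eq_zero]
    refine hg.eq_zero_of_A_of_ne hm hS (Submodule.sub_mem _ ?_ (Submodule.smul_mem _ _ hw1))
      (fun h => absurd h hU) ?_
    · exact Module.End.mapsTo_maxGenEigenspace_of_comm (Commute.refl (Matrix.toLin' (g _))) _ hw1
    · rw [Matrix.mulVec_sub, ← hg.A, hAw1, hx, Matrix.mulVec_smul, hAw1, sub_self]
  · intro t ht
    obtain ⟨_, ⟨w, rfl⟩, y, hy, rfl⟩ := Submodule.mem_sup.1 ht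
    rw [hBneg, Matrix.mulVec_add]
    refine Submodule.neg_mem _ (Submodule.add_mem _ ?_ (Submodule.mem_sup_right ?_))
    · have h1 := A_nilMap hm U' w
      rw [Matrix.mulVecLin_apply, ← sub_add_cancel (nilMap m _ *ᵥ (m.A U' *ᵥ w))
        (bForm m U' w • aVec m U'), ← h1]
      exact Submodule.add_mem _ (Submodule.mem_sup_left ⟨_, rfl⟩)
        (Submodule.mem_sup_right (R.smul_mem _ haR))
    · have h1 : R ≤ R.comap (nilMap m (left U'.1)).mulVecLin := by
        refine Submodule.span_le.2 ?_
        rintro _ ⟨k, rfl⟩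
        refine Submodule.subset_span ⟨k + 1, ?_⟩
        exact pow_succ_mulVec' _ _ _
      exact h1 hy
  · exact fun w => Submodule.mem_sup_left ⟨w, rfl⟩
  · intro w
    rw [a_mulVec]
    exact Submodule.mem_sup_right (R.smul_mem _ haR)

end IsGrading

end

section

/-! ### The vectors of one butterfly -/

/-- A property of D3 branes that holds for `U⁻`, and passes from there outwards across all 5-branes,
holds for all D3 branes. -/
lemma induction_from {P : ℕ → Prop} (U : 𝓓.D5) (base : P (left U.1))
    (hDl : ∀ U' : 𝓓.D5, U'.1.1 < U.1.1 → P (right U'.1) → P (left U'.1))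
    (hNl : ∀ V : 𝓓.NS5, V.1.1 < U.1.1 → P (right V.1) → P (left V.1))
    (hDr : ∀ U' : 𝓓.D5, U.1.1 ≤ U'.1.1 → P (left U'.1) → P (right U'.1))
    (hNr : ∀ V : 𝓓.NS5, U.1.1 < V.1.1 → P (left V.1) → P (right V.1))
    (h0 : ∀ j, 𝓓.size ≤ j → P j) (j : ℕ) : P j := by
  have hl : ∀ j, j ≤ U.1.1 → P j := fun j hj => by
    refine Nat.decreasingInduction (n := U.1.1) (motive := fun j _ => P j) ?_ base hj
    intro j hj ih
    rcases hk : 𝓓.kind ⟨j, hj.trans U.1.2⟩ with _ | _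
    · exact hDl ⟨_, hk⟩ hj ih
    · exact hNl ⟨_, hk⟩ hj ih
  induction j with
  | zero => exact hl 0 (Nat.zero_le _)
  | succ j ih =>
    rcases le_or_gt (j + 1) U.1.1 with h1 | h1
    · exact hl _ h1
    · rcases lt_or_ge j 𝓓.size with hj | hj
      · rcases hk : 𝓓.kind ⟨j, hj⟩ with _ | _
        · exact hDr ⟨_, hk⟩ (Nat.lt_succ_iff.1 h1) ih
        · refine hNr ⟨⟨j, hj⟩, hk⟩ ?_ ih
          have := pos_ne ⟨⟨j, hj⟩, hk⟩ U
          simp only at this ⊢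
          omega
      · exact h0 _ (hj.trans (Nat.le_succ j))

variable (m : Rep 𝓓) (μ : 𝓓.D5 → ℤ → ℂ) (g : ∀ j, Matrix (𝓓.W j) (𝓓.W j) ℂ)

/-- The condition on the vector of a dot to the right of a D5 brane `U'` in the butterfly of `U`,
where `x` is the vector to the left of `U'` at the same level. -/
structure IsLift (U U' : 𝓓.D5) (ℓ : ℤ) (x : 𝓓.W (left U'.1) → ℂ) (w : 𝓓.W (right U'.1) → ℂ) :
    Prop where
  eigen : g (right U'.1) *ᵥ w = μ U ℓ • w
  ne_zero : w ≠ 0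
  A : m.A U' *ᵥ w = x
  -- At positive levels the butterfly of `U` is empty at `U⁻`, so `A` cannot normalise the vector;
  -- the value of `b` after lowering to level `1` does.
  b : U = U' → 1 ≤ ℓ → bForm m U' (nilMap m (right U'.1) ^ (ℓ - 1).toNat *ᵥ w) = -1

open Classical in
/-- The vector with the property `IsLift`, or zero if there is none. -/
def liftVec (U U' : 𝓓.D5) (ℓ : ℤ) (x : 𝓓.W (left U'.1) → ℂ) : 𝓓.W (right U'.1) → ℂ :=
  if h : ∃ w, IsLift m μ g U U' ℓ x w then h.choose else 0

/-- The passage from the vectors to the right of a 5-brane to those to its left. -/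
def stepLeft (j : ℕ) (f : ℤ → 𝓓.W (j + 1) → ℂ) (ℓ : ℤ) : 𝓓.W j → ℂ :=
  if hj : j < 𝓓.size then
    match hk : 𝓓.kind ⟨j, hj⟩ with
    | FiveBrane.D5 => m.A ⟨⟨j, hj⟩, hk⟩ *ᵥ f ℓ
    | FiveBrane.NS5 => m.C ⟨⟨j, hj⟩, hk⟩ *ᵥ f (ℓ + 1)
  else 0

/-- The passage from the vectors to the left of a 5-brane to those to its right. -/
def stepRight (U : 𝓓.D5) (j : ℕ) (f : ℤ → 𝓓.W j → ℂ) (ℓ : ℤ) : 𝓓.W (j + 1) → ℂ :=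
  if hj : j < 𝓓.size then
    match hk : 𝓓.kind ⟨j, hj⟩ with
    | FiveBrane.D5 => liftVec m μ g U ⟨⟨j, hj⟩, hk⟩ ℓ (f ℓ)
    | FiveBrane.NS5 => m.D ⟨⟨j, hj⟩, hk⟩ *ᵥ f ℓ
  else 0

/-- The vectors at `U⁻` in the butterfly of `U`. -/
def baseVec (U : 𝓓.D5) (ℓ : ℤ) : 𝓓.W (left U.1) → ℂ :=
  -- Here `a_U(1)` has level `0`, since the height of the column is not yet known; butterfly
  -- diagrams put the bottom at `0`, and `isFrame_wing` corrects the shift.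
  if ℓ ≤ 0 then nilMap m (left U.1) ^ (-ℓ).toNat *ᵥ aVec m U else 0

/-- The vectors to the left of `U` in the butterfly of `U`. -/
def leftWing (U : 𝓓.D5) (j : ℕ) (ℓ : ℤ) : 𝓓.W j → ℂ :=
  if j < U.1.1 then stepLeft m j (leftWing U (j + 1)) ℓ
  else if h : j = U.1.1 then h ▸ baseVec m U ℓ else 0
termination_by U.1.1 - j

/-- The vectors in the butterfly of `U`. -/
def wing (U : 𝓓.D5) : ∀ (j : ℕ), ℤ → 𝓓.W j → ℂ
  | 0 => leftWing m U 0
  | j + 1 => if j + 1 ≤ U.1.1 then leftWing m U (j + 1) else stepRight m μ g U j (wing U j)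

lemma wing_of_le {U : 𝓓.D5} {j : ℕ} (h : j ≤ U.1.1) : wing m μ g U j = leftWing m U j := by
  cases j with
  | zero => rfl
  | succ j => rw [wing, if_pos h]

lemma wing_base (U : 𝓓.D5) (ℓ : ℤ) : wing m μ g U (left U.1) ℓ = baseVec m U ℓ := by
  rw [wing_of_le m μ g le_rfl, leftWing, if_neg (lt_irrefl _), dif_pos rfl]

lemma wing_left {U : 𝓓.D5} {j : ℕ} (h : j < U.1.1) :
    wing m μ g U j = stepLeft m j (wing m μ g U (j + 1)) := by
  rw [wing_of_le m μ g h.le, wing_of_le m μ g (Nat.succ_le_of_lt h)]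
  funext ℓ
  rw [leftWing, if_pos h]

lemma wing_left_D5 {U U' : 𝓓.D5} (h : U'.1.1 < U.1.1) (ℓ : ℤ) :
    wing m μ g U (left U'.1) ℓ = m.A U' *ᵥ wing m μ g U (right U'.1) ℓ := by
  rw [wing_left m μ g h]
  obtain ⟨⟨j, hj⟩, hk⟩ := U'
  simp only [stepLeft, left, hj, dif_pos]
  split
  · rfl
  · rename_i h; cases h.symm.trans hk

lemma wing_left_NS5 {U : 𝓓.D5} {V : 𝓓.NS5} (h : V.1.1 < U.1.1) (ℓ : ℤ) :
    wing m μ g U (left V.1) ℓ = m.C V *ᵥ wing m μ g U (right V.1) (ℓ + 1) := by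
  rw [wing_left m μ g h]
  obtain ⟨⟨j, hj⟩, hk⟩ := V
  simp only [stepLeft, left, hj, dif_pos]
  split
  · rename_i h; cases h.symm.trans hk
  · rfl

lemma wing_right_D5 {U U' : 𝓓.D5} (h : U.1.1 ≤ U'.1.1) (ℓ : ℤ) :
    wing m μ g U (right U'.1) ℓ = liftVec m μ g U U' ℓ (wing m μ g U (left U'.1) ℓ) := by
  rw [wing, if_neg (by omega)]
  obtain ⟨⟨j, hj⟩, hk⟩ := U'
  simp only [stepRight, hj, dif_pos]
  split
  · rfl
  · rename_i h; cases h.symm.trans hk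

lemma wing_right_NS5 {U : 𝓓.D5} {V : 𝓓.NS5} (h : U.1.1 < V.1.1) (ℓ : ℤ) :
    wing m μ g U (right V.1) ℓ = m.D V *ᵥ wing m μ g U (left V.1) ℓ := by
  rw [wing, if_neg (by omega)]
  obtain ⟨⟨j, hj⟩, hk⟩ := V
  simp only [stepRight, hj, dif_pos]
  split
  · rename_i h; cases h.symm.trans hk
  · rfl

variable {m μ g} {c : ℂ}

lemma isLift_liftVec {U U' : 𝓓.D5} {ℓ : ℤ} {x : 𝓓.W (left U'.1) → ℂ}
    (h : liftVec m μ g U U' ℓ x ≠ 0) : IsLift m μ g U U' ℓ x (liftVec m μ g U U' ℓ x) := by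
  by_cases h1 : ∃ w, IsLift m μ g U U' ℓ x w
  · rw [liftVec, dif_pos h1]
    exact h1.choose_spec
  · exact absurd (dif_neg h1) h

/-- The difference lies in `ker A`. There (S1) leaves room only for the weights of `U` at positive
levels at `U⁺`, and these are fixed by the normalisation of `b`. -/
lemma IsLift.unique (hg : IsGrading m c μ g) (hm : IsMomentZero m) (hS : S1 m)
    {U U' : 𝓓.D5} {ℓ : ℤ} {x : 𝓓.W (left U'.1) → ℂ} {w w' : 𝓓.W (right U'.1) → ℂ}
    (h : IsLift m μ g U U' ℓ x w) (h' : IsLift m μ g U U' ℓ x w') : w = w' := by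
  have hA : m.A U' *ᵥ (w - w') = 0 := by rw [Matrix.mulVec_sub, h.A, h'.A, sub_self]
  have hE := Submodule.sub_mem _ (mem_genEig_of_eq h.eigen) (mem_genEig_of_eq h'.eigen)
  rw [← sub_eq_zero]
  by_cases hU : U = U' ∧ 1 ≤ ℓ
  · obtain ⟨rfl, hℓ⟩ := hU
    refine hg.eq_zero_of_bForm hm hS hE hA ?_
    rw [Matrix.mulVec_sub, bForm_sub, h.b rfl hℓ, h'.b rfl hℓ, sub_self]
  · exact hg.eq_zero_of_A_of_ne hm hS hE (fun e => by by_contra h; exact hU ⟨e, by omega⟩) hA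

lemma IsLift.liftVec_eq (hg : IsGrading m c μ g) (hm : IsMomentZero m) (hS : S1 m)
    {U U' : 𝓓.D5} {ℓ : ℤ} {x : 𝓓.W (left U'.1) → ℂ} {w : 𝓓.W (right U'.1) → ℂ}
    (h : IsLift m μ g U U' ℓ x w) : liftVec m μ g U U' ℓ x = w := by
  have h1 : ∃ w, IsLift m μ g U U' ℓ x w := ⟨w, h⟩
  rw [liftVec, dif_pos h1]
  exact h1.choose_spec.unique hg hm hS h

lemma liftVec_eigen (U U' : 𝓓.D5) (ℓ : ℤ) (x : 𝓓.W (left U'.1) → ℂ) :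
    g (right U'.1) *ᵥ liftVec m μ g U U' ℓ x = μ U ℓ • liftVec m μ g U U' ℓ x := by
  by_cases h : liftVec m μ g U U' ℓ x = 0
  · simp [h]
  · exact (isLift_liftVec h).eigen

lemma wing_eigen (hg : IsGrading m c μ g) (U : 𝓓.D5) (j : ℕ) :
    ∀ ℓ, g j *ᵥ wing m μ g U j ℓ = μ U ℓ • wing m μ g U j ℓ := by
  refine induction_from (P := fun j => ∀ ℓ, g j *ᵥ wing m μ g U j ℓ = μ U ℓ • wing m μ g U j ℓ)
    U ?_ ?_ ?_ ?_ ?_ ?_ j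
  · intro ℓ
    rw [wing_base, baseVec]
    split_ifs with h
    · rw [hg.eigen_a]; congr 2; omega
    · simp
  · intro U' h ih ℓ
    rw [wing_left_D5 m μ g h, hg.A, ih, Matrix.mulVec_smul]
  · intro V h ih ℓ
    rw [wing_left_NS5 m μ g h, hg.C, ih, Matrix.mulVec_smul, smul_smul, ← hg.sub_one]
    congr 2; ring
  · intro U' h _ ℓ
    rw [wing_right_D5 m μ g h]
    exact liftVec_eigen _ _ _ _
  · intro V h ih ℓ
    rw [wing_right_NS5 m μ g h, hg.D, ih, Matrix.mulVec_smul]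
  · intro j hj ℓ
    have := subsingleton_of_mult (𝓓.mult_of_size_le j hj)
    exact Subsingleton.elim _ _

lemma wing_mem (hg : IsGrading m c μ g) (U : 𝓓.D5) (j : ℕ) (ℓ : ℤ) :
    wing m μ g U j ℓ ∈ genEig (g j) (μ U ℓ) := mem_genEig_of_eq (wing_eigen hg U j ℓ)

/-- Across a D5 brane other than `U`, the map `A` identifies the vectors of the butterfly of
`U`. -/
lemma A_wing_of_ne (hg : IsGrading m c μ g) (hm : IsMomentZero m) (hS : S1 m) (hS2 : S2 m)
    {U U' : 𝓓.D5} (h : U ≠ U') (ℓ : ℤ) :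
    m.A U' *ᵥ wing m μ g U (right U'.1) ℓ = wing m μ g U (left U'.1) ℓ := by
  rcases lt_or_ge U'.1.1 U.1.1 with hlt | hge
  · rw [wing_left_D5 m μ g hlt]
  · rw [wing_right_D5 m μ g hge]
    obtain ⟨w, hw, hAw⟩ := hg.exists_lift hm hS hS2 h (wing_eigen hg U (left U'.1) ℓ)
    by_cases hw0 : w = 0
    · rw [hw0, Matrix.mulVec_zero] at hAw
      by_cases hl : liftVec m μ g U U' ℓ (wing m μ g U (left U'.1) ℓ) = 0
      · rw [hl, Matrix.mulVec_zero, hAw]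
      · exact (isLift_liftVec hl).A
    · rw [IsLift.liftVec_eq hg hm hS ⟨hw, hw0, hAw, fun e => absurd e h⟩, hAw]

lemma wing_right_self_of_ne_zero {U : 𝓓.D5} {ℓ : ℤ} (h : wing m μ g U (right U.1) ℓ ≠ 0) :
    IsLift m μ g U U ℓ (wing m μ g U (left U.1) ℓ) (wing m μ g U (right U.1) ℓ) := by
  rw [wing_right_D5 m μ g le_rfl] at *
  exact isLift_liftVec h

lemma wing_right_self_eq (hg : IsGrading m c μ g) (hm : IsMomentZero m) (hS : S1 m) {U : 𝓓.D5}
    {ℓ : ℤ} {w : 𝓓.W (right U.1) → ℂ}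
    (h : IsLift m μ g U U ℓ (wing m μ g U (left U.1) ℓ) w) :
    wing m μ g U (right U.1) ℓ = w := by
  rw [wing_right_D5 m μ g le_rfl]
  exact h.liftVec_eq hg hm hS

lemma A_wing {U U' : 𝓓.D5} (hg : IsGrading m c μ g) (hm : IsMomentZero m) (hS : S1 m)
    (hS2 : S2 m) {ℓ : ℤ} (h : wing m μ g U (right U'.1) ℓ ≠ 0) :
    m.A U' *ᵥ wing m μ g U (right U'.1) ℓ = wing m μ g U (left U'.1) ℓ := by
  by_cases hU : U = U'
  · subst hU
    exact (wing_right_self_of_ne_zero h).A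
  · exact A_wing_of_ne hg hm hS hS2 hU ℓ

lemma bForm_wing_of_ne (hg : IsGrading m c μ g) {U U' : 𝓓.D5} {ℓ : ℤ} (h : ¬(U = U' ∧ ℓ = 1)) :
    bForm m U' (wing m μ g U (right U'.1) ℓ) = 0 :=
  hg.bForm_eq_zero (wing_mem hg U _ ℓ) fun e => h (hg.inj _ _ _ _ e)

lemma bForm_wing_one {U : 𝓓.D5} (h : wing m μ g U (right U.1) 1 ≠ 0) :
    bForm m U (wing m μ g U (right U.1) 1) = -1 := by
  simpa using (wing_right_self_of_ne_zero h).b rfl le_rfl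

lemma wing_base_of_pos (U : 𝓓.D5) {ℓ : ℤ} (h : 0 < ℓ) : wing m μ g U (left U.1) ℓ = 0 := by
  rw [wing_base, baseVec, if_neg (by omega)]

lemma wing_base_zero (U : 𝓓.D5) : wing m μ g U (left U.1) 0 = aVec m U := by
  simp [wing_base, baseVec]

lemma N_wing_base (U : 𝓓.D5) {ℓ : ℤ} (h : ℓ ≤ 0) :
    nilMap m (left U.1) *ᵥ wing m μ g U (left U.1) ℓ = wing m μ g U (left U.1) (ℓ - 1) := by
  rw [wing_base, wing_base, baseVec, baseVec, if_pos h, if_pos (by omega), ← pow_succ_mulVec']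
  congr 2; omega

/-- The lowered vector, if not zero, is again a lift, one level below, so uniqueness identifies it.
If it is zero, a nonzero vector one level below would contradict injectivity of `A` for `ℓ ≤ 1`, and
`b N ^ (ℓ - 1) w = -1` is violated for `ℓ > 1`. -/
lemma N_wing_right_self (hg : IsGrading m c μ g) (hm : IsMomentZero m) (hS : S1 m)
    {U : 𝓓.D5} {ℓ : ℤ} (h : wing m μ g U (right U.1) ℓ ≠ 0) :
    nilMap m (right U.1) *ᵥ wing m μ g U (right U.1) ℓ = wing m μ g U (right U.1) (ℓ - 1) := by
  have hL := wing_right_self_of_ne_zero h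
  set w := wing m μ g U (right U.1) ℓ
  have hE : g (right U.1) *ᵥ (nilMap m (right U.1) *ᵥ w) = μ U (ℓ - 1) • nilMap m _ *ᵥ w :=
    hg.eigen_N hL.eigen
  have hA : m.A U *ᵥ (nilMap m (right U.1) *ᵥ w) = wing m μ g U (left U.1) (ℓ - 1) := by
    rw [A_nilMap hm, hL.A]
    -- Lowering from level `1` to `0` at `U⁺` is where `a` and `b` meet: the value `-1` of `b`
    -- produces `a_U(1)` at `U⁻`.
    by_cases h1 : ℓ = 1
    · subst h1
      rw [wing_base_of_pos U one_pos, bForm_wing_one h]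
      simp [wing_base_zero]
    · rw [bForm_wing_of_ne hg (by tauto), zero_smul, sub_zero]
      rcases le_or_gt ℓ 0 with h2 | h2
      · exact N_wing_base U h2
      · rw [wing_base_of_pos U h2, wing_base_of_pos U (by omega), Matrix.mulVec_zero]
  by_cases h0 : nilMap m (right U.1) *ᵥ w = 0
  · rw [h0]
    by_contra hne
    have hL' := wing_right_self_of_ne_zero (Ne.symm hne)
    rw [h0, Matrix.mulVec_zero] at hA
    rcases le_or_gt ℓ 1 with h1 | h1
    · refine hL'.ne_zero (hg.eq_zero_of_A_of_ne hm hS (mem_genEig_of_eq hL'.eigen)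
        (fun _ => by omega) ?_)
      rw [hL'.A, hA]
    · have hb := hL.b rfl h1.le
      rw [show (ℓ - 1).toNat = (ℓ - 2).toNat + 1 by omega, pow_succ_mulVec, h0,
        Matrix.mulVec_zero, bForm_zero] at hb
      norm_num at hb
  · refine (wing_right_self_eq hg hm hS ⟨hE, h0, hA, fun _ hℓ => ?_⟩).symm
    rw [← pow_succ_mulVec, show (ℓ - 1 - 1).toNat + 1 = (ℓ - 1).toNat by omega]
    exact hL.b rfl (by omega)

/-- The restriction to nonzero vectors matters: at `U⁻` the vector of level `1` is zero, but the one
of level `0` is `a_U(1)`. -/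
lemma N_wing (hg : IsGrading m c μ g) (hm : IsMomentZero m) (hS : S1 m) (hS2 : S2 m)
    (U : 𝓓.D5) (j : ℕ) : ∀ ℓ, wing m μ g U j ℓ ≠ 0 →
      nilMap m j *ᵥ wing m μ g U j ℓ = wing m μ g U j (ℓ - 1) := by
  refine induction_from (P := fun j => ∀ ℓ, wing m μ g U j ℓ ≠ 0 →
    nilMap m j *ᵥ wing m μ g U j ℓ = wing m μ g U j (ℓ - 1)) U ?_ ?_ ?_ ?_ ?_ ?_ j
  · intro ℓ h
    refine N_wing_base U ?_
    by_contra h1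
    exact h (wing_base_of_pos U (by omega))
  · intro U' h ih ℓ hne
    rw [wing_left_D5 m μ g h] at hne ⊢
    have hne' : wing m μ g U (right U'.1) ℓ ≠ 0 := fun e => hne (by rw [e, Matrix.mulVec_zero])
    have h1 := A_nilMap hm U' (wing m μ g U (right U'.1) ℓ)
    rw [bForm_wing_of_ne hg (fun e => by rw [e.1] at h; exact lt_irrefl _ h), zero_smul, sub_zero,
      ih _ hne'] at h1
    rw [← h1, wing_left_D5 m μ g h]
  · intro V h ih ℓ hne
    rw [wing_left_NS5 m μ g h] at hne ⊢
    have hne' : wing m μ g U (right V.1) (ℓ + 1) ≠ 0 :=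
      fun e => hne (by rw [e, Matrix.mulVec_zero])
    rw [← C_nilMap hm, ih _ hne', wing_left_NS5 m μ g h]
    congr 2; ring
  · intro U' h ih ℓ hne
    by_cases hU : U = U'
    · subst hU
      exact N_wing_right_self hg hm hS hne
    · have hw := wing_mem hg U (right U'.1)
      have hA := A_wing_of_ne hg hm hS hS2 hU
      have hne' : wing m μ g U (left U'.1) ℓ ≠ 0 := fun e =>
        hne (hg.eq_zero_of_A_of_ne hm hS (hw ℓ) (fun e => absurd e hU) ((hA ℓ).trans e))
      rw [← sub_eq_zero]
      refine hg.eq_zero_of_A_of_ne hm hS (U := U) (ℓ := ℓ - 1) (Submodule.sub_mem _ ?_ (hw _))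
        (fun e => absurd e hU) ?_
      · exact mem_genEig_of_eq (hg.eigen_N (wing_eigen hg U _ ℓ))
      · rw [Matrix.mulVec_sub, A_nilMap hm, bForm_wing_of_ne hg (by tauto), zero_smul, sub_zero,
          hA, hA, ih _ hne', sub_self]
  · intro V h ih ℓ hne
    rw [wing_right_NS5 m μ g h] at hne ⊢
    have hne' : wing m μ g U (left V.1) ℓ ≠ 0 := fun e => hne (by rw [e, Matrix.mulVec_zero])
    rw [← D_nilMap hm, ih _ hne', wing_right_NS5 m μ g h]
  · intro j hj ℓ _
    have := subsingleton_of_mult (𝓓.mult_of_size_le j hj)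
    exact Subsingleton.elim _ _

/-- Left of `U` this is how the vectors are built; right of `U` they are built by `D`, and `C D` is
the lowering map. `D_wing` is the mirror image. -/
lemma C_wing (hg : IsGrading m c μ g) (hm : IsMomentZero m) (hS : S1 m) (hS2 : S2 m)
    {U : 𝓓.D5} {V : 𝓓.NS5} {ℓ : ℤ} (h : wing m μ g U (right V.1) ℓ ≠ 0) :
    m.C V *ᵥ wing m μ g U (right V.1) ℓ = wing m μ g U (left V.1) (ℓ - 1) := by
  rcases lt_or_gt_of_ne (pos_ne V U) with hlt | hlt
  · rw [wing_left_NS5 m μ g hlt, sub_add_cancel]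
  · rw [wing_right_NS5 m μ g hlt] at h ⊢
    rw [C_D_mulVec, N_wing hg hm hS hS2]
    exact fun e => h (by rw [e, Matrix.mulVec_zero])

lemma D_wing (hg : IsGrading m c μ g) (hm : IsMomentZero m) (hS : S1 m) (hS2 : S2 m)
    {U : 𝓓.D5} {V : 𝓓.NS5} {ℓ : ℤ} (h : wing m μ g U (left V.1) ℓ ≠ 0) :
    m.D V *ᵥ wing m μ g U (left V.1) ℓ = wing m μ g U (right V.1) ℓ := by
  rcases lt_or_gt_of_ne (pos_ne V U) with hlt | hlt
  · rw [wing_left_NS5 m μ g hlt] at h ⊢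
    rw [D_C_mulVec hm, N_wing hg hm hS hS2, add_sub_cancel_right]
    exact fun e => h (by rw [e, Matrix.mulVec_zero])
  · rw [wing_right_NS5 m μ g hlt]

/-! ### The vectors of all butterflies span -/

/-- The span of the vectors of all butterflies. -/
def wingSpan (m : Rep 𝓓) (μ : 𝓓.D5 → ℤ → ℂ) (g : ∀ j, Matrix (𝓓.W j) (𝓓.W j) ℂ) (j : ℕ) :
    Submodule ℂ (𝓓.W j → ℂ) :=
  Submodule.span ℂ (Set.range fun p : 𝓓.D5 × ℤ => wing m μ g p.1 j p.2)

lemma wing_mem_wingSpan (U : 𝓓.D5) (j : ℕ) (ℓ : ℤ) : wing m μ g U j ℓ ∈ wingSpan m μ g j :=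
  Submodule.subset_span ⟨(U, ℓ), rfl⟩

lemma map_wingSpan {i j : ℕ} {M : Matrix (𝓓.W i) (𝓓.W j) ℂ} {T : Submodule ℂ (𝓓.W i → ℂ)}
    (h : ∀ U ℓ, wing m μ g U j ℓ ≠ 0 → M *ᵥ wing m μ g U j ℓ ∈ T) :
    ∀ w ∈ wingSpan m μ g j, M *ᵥ w ∈ T := by
  have : wingSpan m μ g j ≤ T.comap M.mulVecLin := by
    refine Submodule.span_le.2 ?_
    rintro _ ⟨⟨U, ℓ⟩, rfl⟩
    change M *ᵥ wing m μ g U j ℓ ∈ T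
    by_cases h0 : wing m μ g U j ℓ = 0
    · rw [h0, Matrix.mulVec_zero]; exact T.zero_mem
    · exact h U ℓ h0
  exact this

/-- Generalized eigenspaces are independent, so the vectors of other weights contribute nothing to
`x`. -/
lemma mem_genEig_wingSpan (hg : IsGrading m c μ g) {j : ℕ} {ν : ℂ} {x : 𝓓.W j → ℂ}
    (hx : x ∈ genEig (g j) ν) (hx' : x ∈ wingSpan m μ g j) {T : Submodule ℂ (𝓓.W j → ℂ)}
    (hT : ∀ U ℓ, μ U ℓ = ν → wing m μ g U j ℓ ∈ T) (hTE : T ≤ genEig (g j) ν) : x ∈ T := by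
  have h1 : wingSpan m μ g j ≤ T ⊔ ⨆ ν' ≠ ν, genEig (g j) ν' := by
    refine Submodule.span_le.2 ?_
    rintro _ ⟨⟨U, ℓ⟩, rfl⟩
    by_cases h : μ U ℓ = ν
    · exact Submodule.mem_sup_left (hT U ℓ h)
    · exact Submodule.mem_sup_right (Submodule.mem_iSup_of_mem _
        (Submodule.mem_iSup_of_mem h (wing_mem hg U j ℓ)))
  obtain ⟨y, hy, z, hz, rfl⟩ := Submodule.mem_sup.1 (h1 hx')
  have hz0 : z = 0 := by
    refine Submodule.disjoint_def.1
      (Module.End.independent_maxGenEigenspace (Matrix.toLin' (g j)) ν) _ ?_ hz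
    simpa using Submodule.sub_mem _ hx (hTE hy)
  rwa [hz0, add_zero]

/-- A vector at `U⁺` of a weight of `U` that maps to a multiple of the vector at `U⁻` is a multiple
of the vector at `U⁺`. -/
lemma mem_wingSpan_of_A_self (hg : IsGrading m c μ g) (hm : IsMomentZero m) (hS : S1 m)
    {U : 𝓓.D5} {ℓ : ℤ} {w : 𝓓.W (right U.1) → ℂ} (hw : w ∈ genEig (g _) (μ U ℓ)) {s : ℂ}
    (hA : m.A U *ᵥ w = s • wing m μ g U (left U.1) ℓ) : w ∈ wingSpan m μ g (right U.1) := by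
  by_cases hw0 : w = 0
  · rw [hw0]; exact Submodule.zero_mem _
  have hE : g (right U.1) *ᵥ w - μ U ℓ • w ∈ genEig (g (right U.1)) (μ U ℓ) :=
    Submodule.sub_mem _ (Module.End.mapsTo_maxGenEigenspace_of_comm
      (Commute.refl (Matrix.toLin' (g _))) _ hw) (Submodule.smul_mem _ _ hw)
  have hA' : m.A U *ᵥ (g (right U.1) *ᵥ w - μ U ℓ • w) = 0 := by
    rw [Matrix.mulVec_sub, ← hg.A, hA, Matrix.mulVec_smul, wing_eigen hg, Matrix.mulVec_smul, hA,
      smul_comm, sub_self]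
  -- A nonzero multiple of `w` is a lift, normalised by its image under `A` for `ℓ ≤ 0` and by `b N
  -- ^ (ℓ - 1)` for `ℓ > 0`. In both cases (S1) first makes `w` a genuine eigenvector.
  have hlift : ∃ d : ℂ, d ≠ 0 ∧
      IsLift m μ g U U ℓ (wing m μ g U (left U.1) ℓ) (d • w) := by
    rcases le_or_gt ℓ 0 with hℓ | hℓ
    · have heig := sub_eq_zero.1 (hg.eq_zero_of_A_of_ne hm hS hE (fun _ => hℓ) hA')
      have hs : s ≠ 0 := fun h0 => hw0 (hg.eq_zero_of_A_of_ne hm hS hw (fun _ => hℓ) (by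
        rw [hA, h0, zero_smul]))
      refine ⟨s⁻¹, inv_ne_zero hs, ?_, ?_, ?_, fun _ h => by omega⟩
      · rw [Matrix.mulVec_smul, heig, smul_comm]
      · exact smul_ne_zero (inv_ne_zero hs) hw0
      · rw [Matrix.mulVec_smul, hA, smul_smul, inv_mul_cancel₀ hs, one_smul]
    · have hNg : ∀ k : ℕ, g (right U.1) *ᵥ (nilMap m (right U.1) ^ k *ᵥ w) =
          c ^ k • nilMap m (right U.1) ^ k *ᵥ (g (right U.1) *ᵥ w) := fun k => by
        induction k with
        | zero => simp
        | succ k ih => rw [pow_succ_mulVec', hg.N, ih, Matrix.mulVec_smul, smul_smul,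
            ← pow_succ_mulVec', ← pow_succ']
      have hb' : bForm m U (nilMap m (right U.1) ^ (ℓ - 1).toNat *ᵥ
          (g (right U.1) *ᵥ w - μ U ℓ • w)) = 0 := by
        have h1 := congrArg (bForm m U) (hNg (ℓ - 1).toNat)
        have h2 : c ^ (ℓ - 1).toNat * μ U ℓ = μ U 1 := by
          rw [hg.pow_mul]; congr 1; omega
        rw [hg.b, bForm_smul, ← h2] at h1
        rw [Matrix.mulVec_sub, bForm_sub, Matrix.mulVec_smul, bForm_smul, sub_eq_zero]
        refine mul_left_cancel₀ (pow_ne_zero (ℓ - 1).toNat hg.ne_zero) ?_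
        rw [← h1]; ring
      have heig := sub_eq_zero.1 (hg.eq_zero_of_bForm hm hS hE hA' hb')
      rw [wing_base_of_pos U hℓ, smul_zero] at hA
      have hβ : bForm m U (nilMap m (right U.1) ^ (ℓ - 1).toNat *ᵥ w) ≠ 0 := fun h0 =>
        hw0 (hg.eq_zero_of_bForm hm hS hw hA h0)
      refine ⟨-(bForm m U (nilMap m (right U.1) ^ (ℓ - 1).toNat *ᵥ w))⁻¹,
        neg_ne_zero.2 (inv_ne_zero hβ), ?_, ?_, ?_, fun _ _ => ?_⟩
      · rw [Matrix.mulVec_smul, heig, smul_comm]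
      · exact smul_ne_zero (neg_ne_zero.2 (inv_ne_zero hβ)) hw0
      · rw [Matrix.mulVec_smul, hA, smul_zero, wing_base_of_pos U hℓ]
      · rw [Matrix.mulVec_smul, bForm_smul, neg_mul, inv_mul_cancel₀ hβ]
  obtain ⟨d, hd, hd'⟩ := hlift
  have h1 := wing_mem_wingSpan (m := m) (μ := μ) (g := g) U (right U.1) ℓ
  rw [wing_right_self_eq hg hm hS hd'] at h1
  have h2 := Submodule.smul_mem _ d⁻¹ h1
  rwa [smul_smul, inv_mul_cancel₀ hd, one_smul] at h2

/-- The inverse image of the span under `A` is stable under `g`, hence the sum of its weight parts.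
On a weight `μ U ℓ` the span at `U'⁻` is at most a line; on a weight that belongs to no butterfly it
is zero and `A` is injective. -/
lemma mem_wingSpan_of_A (hg : IsGrading m c μ g) (hm : IsMomentZero m) (hS : S1 m) (hS2 : S2 m)
    (U' : 𝓓.D5) {w : 𝓓.W (right U'.1) → ℂ} (hA : m.A U' *ᵥ w ∈ wingSpan m μ g (left U'.1)) :
    w ∈ wingSpan m μ g (right U'.1) := by
  let Q := (wingSpan m μ g (left U'.1)).comap (m.A U').mulVecLin
  have hQ : ∀ w ∈ Q, Matrix.toLin' (g (right U'.1)) w ∈ Q := fun w hw => by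
    change m.A U' *ᵥ (g (right U'.1) *ᵥ w) ∈ wingSpan m μ g (left U'.1)
    rw [← hg.A]
    refine map_wingSpan (fun U ℓ _ => ?_) _ hw
    rw [wing_eigen hg]
    exact Submodule.smul_mem _ _ (wing_mem_wingSpan _ _ _)
  have hdec : Q ≤ ⨆ ν, Q ⊓ genEig (g (right U'.1)) ν := by
    have h1 := Submodule.inf_iSup_genEigenspace hQ ⊤
    have h2 := Module.End.iSup_maxGenEigenspace_eq_top (Matrix.toLin' (g (right U'.1)))
    simp only [Module.End.maxGenEigenspace] at h2
    rw [h2, inf_top_eq] at h1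
    exact h1.le
  have hle : ⨆ ν, Q ⊓ genEig (g (right U'.1)) ν ≤ wingSpan m μ g (right U'.1) := by
    refine iSup_le fun ν w hw => ?_
    obtain ⟨hwQ, hwE⟩ := hw
    have hAE := hg.A_mem U' hwE
    by_cases hν : ∃ U ℓ, μ U ℓ = ν
    · obtain ⟨U, ℓ, rfl⟩ := hν
      have hs : m.A U' *ᵥ w ∈ Submodule.span ℂ {wing m μ g U (left U'.1) ℓ} := by
        refine mem_genEig_wingSpan hg hAE hwQ (fun U₁ ℓ₁ e => ?_) ?_
        · obtain ⟨rfl, rfl⟩ := hg.inj _ _ _ _ e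
          exact Submodule.mem_span_singleton_self _
        · rw [Submodule.span_singleton_le_iff_mem]
          exact wing_mem hg U _ ℓ
      obtain ⟨s, hs⟩ := Submodule.mem_span_singleton.1 hs
      by_cases hU : U = U'
      · subst hU
        exact mem_wingSpan_of_A_self hg hm hS hwE hs.symm
      · have h0 : w - s • wing m μ g U (right U'.1) ℓ = 0 := by
          refine hg.eq_zero_of_A_of_ne hm hS (Submodule.sub_mem _ hwE
            (Submodule.smul_mem _ _ (wing_mem hg U _ ℓ))) (fun e => absurd e hU) ?_
          rw [Matrix.mulVec_sub, Matrix.mulVec_smul, A_wing_of_ne hg hm hS hS2 hU, hs, sub_self]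
        rw [sub_eq_zero.1 h0]
        exact Submodule.smul_mem _ _ (wing_mem_wingSpan _ _ _)
    · push Not at hν
      have h0 : m.A U' *ᵥ w ∈ (⊥ : Submodule ℂ (𝓓.W (left U'.1) → ℂ)) :=
        mem_genEig_wingSpan hg hAE hwQ (fun U ℓ e => absurd e (hν U ℓ)) bot_le
      have hw0 : w = 0 := by
        refine hg.eq_zero_of_A hm hS hwE (fun k hk => hν U' (1 + k) ?_) ((Submodule.mem_bot ℂ).1 h0)
        refine mul_left_cancel₀ (pow_ne_zero k hg.ne_zero) ?_
        rw [hk, hg.pow_mul, add_sub_cancel_right]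
      rw [hw0]
      exact Submodule.zero_mem _
  exact hle (hdec hA)

lemma wingSpan_eq_top (hg : IsGrading m c μ g) (hm : IsMomentZero m) (hS : S1 m) (hS2 : S2 m)
    (hc : Costable m) (j : ℕ) : wingSpan m μ g j = ⊤ := by
  have hN : ∀ j, ∀ w ∈ wingSpan m μ g j, nilMap m j *ᵥ w ∈ wingSpan m μ g j := fun j =>
    map_wingSpan fun U ℓ h => N_wing hg hm hS hS2 U j ℓ h ▸ wing_mem_wingSpan _ _ _
  refine hc (wingSpan m μ g) ⟨fun U w => ?_, fun U' => ?_, fun U' w hw => ?_, fun U' w hw => ?_,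
    fun U' w hw => ?_, fun V => ?_, fun V => ?_⟩ j
  · rw [a_mulVec, ← wing_base_zero (μ := μ) (g := g)]
    exact Submodule.smul_mem _ _ (wing_mem_wingSpan _ _ _)
  · exact map_wingSpan fun U ℓ h => A_wing hg hm hS hS2 h ▸ wing_mem_wingSpan _ _ _
  · exact mem_wingSpan_of_A hg hm hS hS2 U' hw
  · rw [← neg_neg (m.B U'), ← nilMap_left_D5, Matrix.neg_mulVec]
    exact Submodule.neg_mem _ (hN _ _ hw)
  · rw [← neg_neg (m.B' U'), ← nilMap_right_D5 hm, Matrix.neg_mulVec]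
    exact Submodule.neg_mem _ (hN _ _ hw)
  · exact map_wingSpan fun U ℓ h => C_wing hg hm hS hS2 h ▸ wing_mem_wingSpan _ _ _
  · exact map_wingSpan fun U ℓ h => D_wing hg hm hS hS2 h ▸ wing_mem_wingSpan _ _ _

end

section

/-! ### The dots of a fixed point -/

/-! ### Intervals of integers -/

/-- A set of integers is the interval of length `h` that starts at `β`. -/
def IsInterval (S : Set ℤ) (β : ℤ) (h : ℕ) : Prop := ∀ ℓ, ℓ ∈ S ↔ β ≤ ℓ ∧ ℓ < β + h

lemma IsInterval.ncard {S : Set ℤ} {β : ℤ} {h : ℕ} (hS : IsInterval S β h) : S.ncard = h := by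
  have : S = ↑(Finset.Ico β (β + h)) := by
    ext ℓ; rw [hS ℓ, Finset.coe_Ico, Set.mem_Ico]
  rw [this, Set.ncard_coe_finset]
  simp

lemma isInterval_empty (β : ℤ) : IsInterval ∅ β 0 := fun ℓ =>
  iff_of_false (Set.notMem_empty ℓ) (by push_cast; omega)

lemma exists_isInterval_of_top {S : Set ℤ} (hf : S.Finite) (h0 : ∀ ℓ ∈ S, ℓ ≤ 0)
    (hS : ∀ ℓ ≤ 0, ℓ - 1 ∈ S → ℓ ∈ S) : ∃ h : ℕ, IsInterval S (1 - h) h := by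
  rcases S.eq_empty_or_nonempty with rfl | hne
  · exact ⟨0, isInterval_empty _⟩
  · obtain ⟨β, hβ, hmin⟩ := Set.exists_min_image S id hf hne
    have hβ0 := h0 β hβ
    refine ⟨(1 - β).toNat, fun ℓ => ⟨fun h => ?_, fun h => ?_⟩⟩
    · have := h0 ℓ h
      have := hmin ℓ h
      simp only [id] at this
      omega
    · have key : ∀ k : ℕ, β + k ≤ 0 → β + k ∈ S := fun k => by
        induction k with
        | zero => intro _; simpa using hβ
        | succ k ih =>
          intro hk
          push_cast at hk ⊢
          refine hS _ (by omega) ?_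
          rw [show β + (k + 1 : ℤ) - 1 = β + k by ring]
          exact ih (by omega)
      have := key (ℓ - β).toNat (by omega)
      rwa [show β + ((ℓ - β).toNat : ℤ) = ℓ by omega] at this

lemma exists_isInterval_of_bottom {S : Set ℤ} (hf : S.Finite) {β : ℤ}
    (hS : ∀ ℓ ∈ S, ℓ - 1 ∉ S → ℓ = β) : ∃ h : ℕ, IsInterval S β h := by
  rcases S.eq_empty_or_nonempty with rfl | hne
  · exact ⟨0, isInterval_empty _⟩
  · obtain ⟨b, hb, hmin⟩ := Set.exists_min_image S id hf hne
    obtain ⟨t, ht, hmax⟩ := Set.exists_max_image S id hf hne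
    simp only [id] at hmin hmax
    obtain rfl : b = β := hS b hb fun h => by have := hmin _ h; omega
    refine ⟨(t + 1 - b).toNat, fun ℓ => ⟨fun h => ?_, fun h => ?_⟩⟩
    · have := hmin ℓ h
      have := hmax ℓ h
      omega
    · have key : ∀ k : ℕ, b ≤ t - k → t - k ∈ S := fun k => by
        induction k with
        | zero => intro _; simpa using ht
        | succ k ih =>
          intro hk
          push_cast at hk ⊢
          by_contra hn
          rw [show t - (k + 1 : ℤ) = t - k - 1 by ring] at hn
          have := hS _ (ih (by omega)) hn
          omega
      have := key (t - ℓ).toNat (by omega)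
      rwa [show t - ((t - ℓ).toNat : ℤ) = ℓ by omega] at this

/-- A subset of an interval that misses at most its first element is an interval. -/
lemma IsInterval.exists_of_subset {S T : Set ℤ} {β : ℤ} {h : ℕ} (hS : IsInterval S β h)
    (hTS : T ⊆ S) (hT : ∀ ℓ ∈ S, ℓ ∉ T → ℓ - 1 ∉ S) :
    ∃ x k : ℕ, x ≤ 1 ∧ h = k + x ∧ IsInterval T (β + x) k := by
  have key : ∀ ℓ, ℓ ≠ β → (ℓ ∈ T ↔ ℓ ∈ S) := fun ℓ hℓ => by
    refine ⟨fun h => hTS h, fun h => ?_⟩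
    by_contra hn
    have h1 := hT ℓ h hn
    rw [hS] at h h1
    omega
  by_cases hβ : β ∈ S ∧ β ∉ T
  · have h1 := (hS β).1 hβ.1
    refine ⟨1, h - 1, le_rfl, by omega, fun ℓ => ?_⟩
    by_cases hℓ : ℓ = β
    · subst hℓ
      refine iff_of_false hβ.2 ?_
      push_cast; omega
    · rw [key ℓ hℓ, hS]
      omega
  · refine ⟨0, h, zero_le_one, rfl, fun ℓ => ?_⟩
    have : ℓ ∈ T ↔ ℓ ∈ S := by
      by_cases hℓ : ℓ = β
      · subst hℓ
        exact ⟨fun h => hTS h, fun h => by by_contra hn; exact hβ ⟨h, hn⟩⟩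
      · exact key ℓ hℓ
    rw [this, hS]; simp

lemma IsInterval.sub_one {S T : Set ℤ} {β : ℤ} {h : ℕ} (hS : IsInterval S β h)
    (hT : ∀ ℓ, ℓ ∈ T ↔ ℓ + 1 ∈ S) : IsInterval T (β - 1) h := fun ℓ => by
  rw [hT, hS]; omega

variable (m : Rep 𝓓) (μ : 𝓓.D5 → ℤ → ℂ) (g : ∀ j, Matrix (𝓓.W j) (𝓓.W j) ℂ)

/-- The levels of the nonzero vectors in a column of a butterfly. -/
def wingLevels (U : 𝓓.D5) (j : ℕ) : Set ℤ := {ℓ | wing m μ g U j ℓ ≠ 0}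

/-- The number of nonzero vectors in a column of a butterfly. -/
def wingHeight (U : 𝓓.D5) (j : ℕ) : ℕ := (wingLevels m μ g U j).ncard

lemma wingLevels_of_mult (U : 𝓓.D5) {j : ℕ} (h : 𝓓.mult j = 0) : wingLevels m μ g U j = ∅ := by
  have := subsingleton_of_mult h
  exact Set.eq_empty_of_forall_notMem fun ℓ hℓ => hℓ (Subsingleton.elim _ _)

lemma wingHeight_of_mult (U : 𝓓.D5) {j : ℕ} (h : 𝓓.mult j = 0) : wingHeight m μ g U j = 0 := by
  rw [wingHeight, wingLevels_of_mult m μ g U h, Set.ncard_empty]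

/-- The ties of a fixed point. -/
def wingTies : Finset (𝓓.NS5 × 𝓓.D5) :=
  Finset.univ.filter fun p =>
    wingHeight m μ g p.2 (left p.1.1) ≠ wingHeight m μ g p.2 (right p.1.1)

variable {m μ g} {c : ℂ}

lemma mem_wingLevels {U : 𝓓.D5} {j : ℕ} {ℓ : ℤ} :
    ℓ ∈ wingLevels m μ g U j ↔ wing m μ g U j ℓ ≠ 0 := Iff.rfl

lemma linearIndependent_wing (hg : IsGrading m c μ g) {ι : Type*} (j : ℕ) (u : ι → 𝓓.D5)
    (l : ι → ℤ) (hul : ∀ i i', u i = u i' → l i = l i' → i = i')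
    (hne : ∀ i, wing m μ g (u i) j (l i) ≠ 0) :
    LinearIndependent ℂ fun i => wing m μ g (u i) j (l i) := by
  refine Module.End.eigenvectors_linearIndependent' (Matrix.toLin' (g j))
    (fun i => μ (u i) (l i)) (fun i i' h => ?_) _ fun i => ?_
  · obtain ⟨h1, h2⟩ := hg.inj _ _ _ _ h
    exact hul i i' h1 h2
  · exact ⟨Module.End.mem_eigenspace_iff.2 (wing_eigen hg _ j _), hne i⟩

lemma finite_wingLevels (hg : IsGrading m c μ g) (U : 𝓓.D5) (j : ℕ) :
    (wingLevels m μ g U j).Finite := by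
  have h := linearIndependent_wing hg j (fun _ : wingLevels m μ g U j => U) (fun ℓ => ℓ.1)
    (fun _ _ _ h => Subtype.ext h) fun ℓ => ℓ.2
  exact Set.finite_coe_iff.1 h.finite

/-- The nonzero vectors of all butterflies at a D3 brane span and have distinct eigenvalues, so they
form a basis. -/
lemma sum_wingHeight (hg : IsGrading m c μ g) (hm : IsMomentZero m) (hS : S1 m) (hS2 : S2 m)
    (hc : Costable m) (j : ℕ) : ∑ U, wingHeight m μ g U j = 𝓓.mult j := by
  have hfin := fun U => (finite_wingLevels hg U j).to_subtype
  have hli := linearIndependent_wing hg j (fun p : Σ U, wingLevels m μ g U j => p.1)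
    (fun p => p.2.1) (by
      rintro ⟨U, ℓ⟩ ⟨U', ℓ'⟩ h1 h2
      obtain rfl : U = U' := h1
      obtain rfl : ℓ = ℓ' := Subtype.ext h2
      rfl) fun p => p.2.2
  have hsp : ⊤ ≤ Submodule.span ℂ (Set.range fun p : Σ U, wingLevels m μ g U j =>
      wing m μ g p.1 j p.2.1) := by
    rw [← wingSpan_eq_top hg hm hS hS2 hc j, wingSpan, Submodule.span_le]
    rintro _ ⟨⟨U, ℓ⟩, rfl⟩
    by_cases h : wing m μ g U j ℓ = 0
    · simp only [h]; exact Submodule.zero_mem _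
    · exact Submodule.subset_span ⟨⟨U, ℓ, h⟩, rfl⟩
  have h := Module.finrank_eq_nat_card_basis (Module.Basis.mk hli hsp)
  rw [Module.finrank_fintype_fun_eq_card, Fintype.card_fin, Nat.card_sigma] at h
  exact h.symm

/-! The columns of a butterfly are intervals. -/

lemma isInterval_left_self (hg : IsGrading m c μ g) (U : 𝓓.D5) :
    IsInterval (wingLevels m μ g U (left U.1)) (1 - wingHeight m μ g U (left U.1))
      (wingHeight m μ g U (left U.1)) := by
  have h0 : ∀ ℓ ∈ wingLevels m μ g U (left U.1), ℓ ≤ 0 := fun ℓ hℓ => by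
    by_contra h1
    exact hℓ (wing_base_of_pos U (by omega))
  have h1 : ∀ ℓ ≤ 0, ℓ - 1 ∈ wingLevels m μ g U (left U.1) → ℓ ∈ wingLevels m μ g U (left U.1) :=
    fun ℓ hℓ h e => by
      rw [mem_wingLevels, ← N_wing_base U hℓ, e, Matrix.mulVec_zero] at h
      exact h rfl
  obtain ⟨h, hh⟩ := exists_isInterval_of_top (finite_wingLevels hg U (left U.1)) h0 h1
  rwa [wingHeight, hh.ncard]

/-- A lowest vector `w` at `U⁺` is killed by `N`. At a level below `1`, `A w` is nonzero and killed
by `N`, so it is the bottom of the column at `U⁻`. At level `1` the relation between `A` and `N`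
gives `a_U(1) = 0`, and the column at `U⁻` is empty. Above level `1`, `b N ^ (ℓ - 1) w = -1`
excludes `N w = 0`. -/
lemma isInterval_right_self (hg : IsGrading m c μ g) (hm : IsMomentZero m) (hS : S1 m)
    (hS2 : S2 m) (U : 𝓓.D5) :
    IsInterval (wingLevels m μ g U (right U.1)) (1 - wingHeight m μ g U (left U.1))
      (wingHeight m μ g U (right U.1)) := by
  have hl := isInterval_left_self hg U
  suffices hb : ∀ ℓ ∈ wingLevels m μ g U (right U.1), ℓ - 1 ∉ wingLevels m μ g U (right U.1) →
      ℓ = 1 - wingHeight m μ g U (left U.1) by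
    obtain ⟨h, hh⟩ := exists_isInterval_of_bottom (finite_wingLevels hg U (right U.1)) hb
    have hk : wingHeight m μ g U (right U.1) = h := hh.ncard
    rwa [hk]
  intro ℓ hℓ hℓ'
  rw [mem_wingLevels] at hℓ
  have hN := N_wing hg hm hS hS2 U _ ℓ hℓ
  rw [not_not.1 hℓ'] at hN
  have hA := A_nilMap hm U (wing m μ g U (right U.1) ℓ)
  rw [hN, Matrix.mulVec_zero, A_wing hg hm hS hS2 hℓ] at hA
  rcases lt_trichotomy ℓ 1 with h1 | rfl | h1
  · rw [bForm_wing_of_ne hg (fun e => h1.ne e.2), zero_smul, sub_zero,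
      N_wing_base U (by omega)] at hA
    have h2 : ℓ ∈ wingLevels m μ g U (left U.1) := fun e =>
      hℓ (hg.eq_zero_of_A_of_ne hm hS (wing_mem hg U _ ℓ) (fun _ => by omega)
        ((A_wing hg hm hS hS2 hℓ).trans e))
    have h3 : ℓ - 1 ∉ wingLevels m μ g U (left U.1) := fun e => e hA.symm
    rw [hl] at h2 h3
    omega
  · rw [bForm_wing_one hℓ, wing_base_of_pos U one_pos, ← wing_base_zero (μ := μ) (g := g)] at hA
    have h3 : (0 : ℤ) ∉ wingLevels m μ g U (left U.1) := fun e => e (by simpa using hA.symm)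
    rw [hl] at h3
    omega
  · have hb := (wing_right_self_of_ne_zero hℓ).b rfl h1.le
    rw [show (ℓ - 1).toNat = (ℓ - 2).toNat + 1 by omega, pow_succ_mulVec, hN,
      Matrix.mulVec_zero, bForm_zero] at hb
    norm_num at hb

lemma wingLevels_D5 (hg : IsGrading m c μ g) (hm : IsMomentZero m) (hS : S1 m) (hS2 : S2 m)
    {U U' : 𝓓.D5} (h : U' ≠ U) :
    wingLevels m μ g U (right U'.1) = wingLevels m μ g U (left U'.1) := by
  ext ℓ
  have hA := A_wing_of_ne hg hm hS hS2 h.symm ℓ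
  refine not_congr ⟨fun e => ?_, fun e => ?_⟩
  · rw [← hA, e, Matrix.mulVec_zero]
  · exact hg.eq_zero_of_A_of_ne hm hS (wing_mem hg U _ ℓ) (fun e => absurd e.symm h)
      (hA.trans e)

/-- A vector killed by `D` is killed by `N = C D`, so only the bottom vector of the column can be
lost. -/
lemma exists_isInterval_right_NS5 (hg : IsGrading m c μ g) (hm : IsMomentZero m) (hS : S1 m)
    (hS2 : S2 m) {U : 𝓓.D5} {V : 𝓓.NS5} (h : U.1.1 < V.1.1) {β : ℤ} {k : ℕ}
    (hI : IsInterval (wingLevels m μ g U (left V.1)) β k) :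
    ∃ x k' : ℕ, x ≤ 1 ∧ k = k' + x ∧ IsInterval (wingLevels m μ g U (right V.1)) (β + x) k' := by
  refine hI.exists_of_subset (fun ℓ hℓ e => hℓ ?_) fun ℓ hℓ hℓ' => ?_
  · rw [wing_right_NS5 m μ g h, e, Matrix.mulVec_zero]
  · rw [mem_wingLevels, wing_right_NS5 m μ g h, not_not] at hℓ'
    rw [mem_wingLevels, ← N_wing hg hm hS hS2 U _ ℓ hℓ, ← C_D_mulVec, hℓ', Matrix.mulVec_zero,
      not_not]

lemma exists_isInterval_left_NS5 (hg : IsGrading m c μ g) (hm : IsMomentZero m) (hS : S1 m)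
    (hS2 : S2 m) {U : 𝓓.D5} {V : 𝓓.NS5} (h : V.1.1 < U.1.1) {β : ℤ} {k : ℕ}
    (hI : IsInterval (wingLevels m μ g U (right V.1)) β k) :
    ∃ x k' : ℕ, x ≤ 1 ∧ k = k' + x ∧
      IsInterval (wingLevels m μ g U (left V.1)) (β + x - 1) k' := by
  obtain ⟨x, k', hx, hk, hI'⟩ := hI.exists_of_subset
    (T := {ℓ | m.C V *ᵥ wing m μ g U (right V.1) ℓ ≠ 0})
    (fun ℓ hℓ e => hℓ (by rw [e, Matrix.mulVec_zero])) fun ℓ hℓ hℓ' => by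
      rw [Set.mem_ofPred_eq, not_not] at hℓ'
      rw [mem_wingLevels, ← N_wing hg hm hS hS2 U _ ℓ hℓ, ← D_C_mulVec hm, hℓ',
        Matrix.mulVec_zero, not_not]
  refine ⟨x, k', hx, hk, hI'.sub_one fun ℓ => ?_⟩
  rw [mem_wingLevels, wing_left_NS5 m μ g h]; rfl

lemma exists_isInterval (hg : IsGrading m c μ g) (hm : IsMomentZero m) (hS : S1 m) (hS2 : S2 m)
    (U : 𝓓.D5) (j : ℕ) : ∃ β k, IsInterval (wingLevels m μ g U j) β k := by
  refine induction_from (P := fun j => ∃ β k, IsInterval (wingLevels m μ g U j) β k) U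
    ⟨_, _, isInterval_left_self hg U⟩ ?_ ?_ ?_ ?_ ?_ j
  · intro U' h ih
    rwa [← wingLevels_D5 hg hm hS hS2 (fun e => by rw [e] at h; exact lt_irrefl _ h)]
  · rintro V h ⟨β, k, ih⟩
    obtain ⟨x, k', -, -, h'⟩ := exists_isInterval_left_NS5 hg hm hS hS2 h ih
    exact ⟨_, _, h'⟩
  · intro U' h ih
    by_cases hU : U' = U
    · subst hU
      exact ⟨_, _, isInterval_right_self hg hm hS hS2 U'⟩
    · rwa [wingLevels_D5 hg hm hS hS2 hU]
  · rintro V h ⟨β, k, ih⟩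
    obtain ⟨x, k', -, -, h'⟩ := exists_isInterval_right_NS5 hg hm hS hS2 h ih
    exact ⟨_, _, h'⟩
  · intro j hj
    rw [wingLevels_of_mult m μ g U (𝓓.mult_of_size_le j hj)]
    exact ⟨0, 0, isInterval_empty 0⟩

lemma wingHeight_right_NS5 (hg : IsGrading m c μ g) (hm : IsMomentZero m) (hS : S1 m)
    (hS2 : S2 m) {U : 𝓓.D5} {V : 𝓓.NS5} (h : U.1.1 < V.1.1) :
    wingHeight m μ g U (left V.1) = wingHeight m μ g U (right V.1) +
      if (V, U) ∈ wingTies m μ g then 1 else 0 := by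
  obtain ⟨β, k, hI⟩ := exists_isInterval hg hm hS hS2 U (left V.1)
  obtain ⟨x, k', hx, hk, hI'⟩ := exists_isInterval_right_NS5 hg hm hS hS2 h hI
  have h1 : wingHeight m μ g U (left V.1) = k := hI.ncard
  have h2 : wingHeight m μ g U (right V.1) = k' := hI'.ncard
  simp only [wingTies, Finset.mem_filter, Finset.mem_univ, true_and, h1, h2]
  split_ifs <;> omega

lemma wingHeight_left_NS5 (hg : IsGrading m c μ g) (hm : IsMomentZero m) (hS : S1 m)
    (hS2 : S2 m) {U : 𝓓.D5} {V : 𝓓.NS5} (h : V.1.1 < U.1.1) :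
    wingHeight m μ g U (right V.1) = wingHeight m μ g U (left V.1) +
      if (V, U) ∈ wingTies m μ g then 1 else 0 := by
  obtain ⟨β, k, hI⟩ := exists_isInterval hg hm hS hS2 U (right V.1)
  obtain ⟨x, k', hx, hk, hI'⟩ := exists_isInterval_left_NS5 hg hm hS hS2 h hI
  have h1 : wingHeight m μ g U (right V.1) = k := hI.ncard
  have h2 : wingHeight m μ g U (left V.1) = k' := hI'.ncard
  simp only [wingTies, Finset.mem_filter, Finset.mem_univ, true_and, h1, h2]
  split_ifs <;> omega

/-- Both sides vanish at the outer D3 branes and have the same jumps. The induction runs inwards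
from each end and never crosses `U`, where the jump is not governed by ties. -/
lemma tieHeight_wingTies (hg : IsGrading m c μ g) (hm : IsMomentZero m) (hS : S1 m)
    (hS2 : S2 m) (U : 𝓓.D5) (j : ℕ) :
    tieHeight (wingTies m μ g) U j = wingHeight m μ g U j := by
  have hD : ∀ U' : 𝓓.D5, U' ≠ U → wingHeight m μ g U (right U'.1) =
      wingHeight m μ g U (left U'.1) := fun U' h => by
    rw [wingHeight, wingLevels_D5 hg hm hS hS2 h, wingHeight]
  have hout : ∀ j, 𝓓.size ≤ j → tieHeight (wingTies m μ g) U j = wingHeight m μ g U j :=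
    fun j hj => by
      rw [tieHeight_of_size_le _ U hj, wingHeight_of_mult m μ g U (𝓓.mult_of_size_le j hj)]
  rcases le_or_gt j U.1.1 with hj | hj
  · revert hj
    refine induction_right (𝓓 := 𝓓) (P := fun j => j ≤ U.1.1 →
      tieHeight (wingTies m μ g) U j = wingHeight m μ g U j) ?_ ?_ ?_ j
    · rintro j (rfl | hj) -
      · rw [tieHeight_zero, wingHeight_of_mult m μ g U 𝓓.mult_zero]
      · exact hout j hj
    · intro U' ih h
      have hlt : U'.1.1 < U.1.1 := h
      have hne : U' ≠ U := fun e => by rw [e] at hlt; exact lt_irrefl _ hlt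
      rw [tieHeight_D5 _ hne, hD _ hne, ih hlt.le]
    · intro V ih h
      have hlt : V.1.1 < U.1.1 := h
      rw [tieHeight_left_NS5 _ hlt, wingHeight_left_NS5 hg hm hS hS2 hlt, ih hlt.le]
  · revert hj
    refine induction_left (𝓓 := 𝓓) (P := fun j => U.1.1 < j →
      tieHeight (wingTies m μ g) U j = wingHeight m μ g U j) (fun j hj _ => hout j hj) ?_ ?_ j
    · intro U' ih h
      have hlt : U.1.1 < U'.1.1 := h
      have hne : U' ≠ U := fun e => by rw [e] at hlt; exact lt_irrefl _ hlt
      rw [← tieHeight_D5 _ hne, ← hD _ hne, ih (Nat.lt_succ_of_lt hlt)]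
    · intro V ih h
      have hlt : U.1.1 < V.1.1 := h
      rw [tieHeight_right_NS5 _ hlt, wingHeight_right_NS5 hg hm hS hS2 hlt,
        ih (Nat.lt_succ_of_lt hlt)]

/-- The tie diagram of a fixed point. -/
def wingDiagram (hg : IsGrading m c μ g) (hm : IsMomentZero m) (hS : S1 m) (hS2 : S2 m)
    (hc : Costable m) : TieDiagram 𝓓 where
  ties := wingTies m μ g
  card_covers j := by
    rw [← sum_wingHeight hg hm hS hS2 hc j]
    simp only [← tieHeight_wingTies hg hm hS hS2]
    exact (sum_tieHeight (wingTies m μ g) j).symm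

/-! ### The frame of a fixed point -/

section

variable (hg : IsGrading m c μ g) (hm : IsMomentZero m) (hS : S1 m) (hS2 : S2 m)
  (hc : Costable m)

lemma height_wingDiagram (U : 𝓓.D5) (j : ℕ) :
    (wingDiagram hg hm hS hS2 hc).height U j = wingHeight m μ g U j :=
  tieHeight_wingTies hg hm hS hS2 U j

/-- The shift by `wingHeight - 1` moves `a_U(1)` from level `0` to the top of a column with bottom
`0`. From `U⁻` outwards the levels obey the alignment rules of `bottom`. -/
lemma isInterval_wingLevels (U : 𝓓.D5) (j : ℕ) :
    IsInterval (wingLevels m μ g U j)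
      ((wingDiagram hg hm hS hS2 hc).bottom U j - (wingHeight m μ g U (left U.1) - 1))
      ((wingDiagram hg hm hS hS2 hc).height U j) := by
  set τ := wingDiagram hg hm hS hS2 hc with hτ
  have hh : ∀ U j, τ.height U j = wingHeight m μ g U j := height_wingDiagram hg hm hS hS2 hc
  refine induction_from (P := fun j => IsInterval (wingLevels m μ g U j)
    (τ.bottom U j - (wingHeight m μ g U (left U.1) - 1)) (τ.height U j)) U ?_ ?_ ?_ ?_ ?_ ?_ j
  · rw [hh, τ.bottom_left_self, zero_sub, neg_sub]
    exact isInterval_left_self hg U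
  · intro U' h ih
    have hne : U' ≠ U := fun e => by rw [e] at h; exact lt_irrefl _ h
    rwa [← wingLevels_D5 hg hm hS hS2 hne, ← τ.height_D5 hne, ← τ.bottom_D5 hne]
  · intro V h ih
    obtain ⟨x, k, hx, hk, hI⟩ := exists_isInterval_left_NS5 hg hm hS hS2 h ih
    obtain ⟨y, hy, hy1, hy2⟩ := τ.exists_left_NS5 h
    have h1 : τ.height U (left V.1) = k := (hh U _).trans hI.ncard
    -- Both numbers are the drop of the height across `V`.
    obtain rfl : x = y := by omega
    rw [h1, hy2]
    convert hI using 1; ring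
  · intro U' h ih
    by_cases hU : U' = U
    · subst hU
      rw [hh, τ.bottom_right_self, zero_sub, neg_sub]
      exact isInterval_right_self hg hm hS hS2 U'
    · rwa [wingLevels_D5 hg hm hS hS2 hU, τ.height_D5 hU, τ.bottom_D5 hU]
  · intro V h ih
    obtain ⟨x, k, hx, hk, hI⟩ := exists_isInterval_right_NS5 hg hm hS hS2 h ih
    obtain ⟨y, hy, hy1, hy2⟩ := τ.exists_right_NS5 h
    have h1 : τ.height U (right V.1) = k := (hh U _).trans hI.ncard
    obtain rfl : x = y := by omega
    rw [h1, hy2]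
    convert hI using 1; ring
  · intro j hj
    have hmult := 𝓓.mult_of_size_le j hj
    rw [hh, wingHeight_of_mult m μ g U (j := j) hmult, wingLevels_of_mult m μ g U hmult]
    exact isInterval_empty _

/-- The vectors of the butterflies form a frame. -/
lemma isFrame_wing : IsFrame m (wingDiagram hg hm hS hS2 hc)
    fun U j ℓ => wing m μ g U j (ℓ - (wingHeight m μ g U (left U.1) - 1)) := by
  have hd : ∀ U j ℓ, (wingDiagram hg hm hS hS2 hc).HasDot U j ℓ ↔
      wing m μ g U j (ℓ - (wingHeight m μ g U (left U.1) - 1)) ≠ 0 := fun U j ℓ => by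
    rw [← mem_wingLevels, isInterval_wingLevels hg hm hS hS2 hc U j, TieDiagram.HasDot]
    omega
  constructor
  · intro U j ℓ h
    rwa [hd, not_not] at h
  · intro U' U ℓ h
    exact A_wing hg hm hS hS2 ((hd _ _ _).1 h)
  · intro U' U ℓ h
    rw [hd] at h
    rw [mulVec_eq_bForm, height_wingDiagram]
    split_ifs with h1
    · obtain ⟨rfl, h2⟩ := h1
      have h3 : ℓ - (wingHeight m μ g U (left U.1) - 1 : ℤ) = 1 := by omega
      rw [h3] at h ⊢
      rw [bForm_wing_one h]; rfl
    · rw [bForm_wing_of_ne hg fun e => h1 ⟨e.1, by omega⟩]; rfl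
  · intro U
    rw [height_wingDiagram, sub_self, wing_base_zero]; rfl
  · intro U' U ℓ h
    rw [← neg_neg (m.B U'), ← nilMap_left_D5, Matrix.neg_mulVec,
      N_wing hg hm hS hS2 _ _ _ ((hd _ _ _).1 h), sub_right_comm]
  · intro U' U ℓ h
    rw [← neg_neg (m.B' U'), ← nilMap_right_D5 hm, Matrix.neg_mulVec,
      N_wing hg hm hS hS2 _ _ _ ((hd _ _ _).1 h), sub_right_comm]
  · intro V U ℓ h
    rw [C_wing hg hm hS hS2 ((hd _ _ _).1 h), sub_right_comm]
  · intro V U ℓ h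
    exact D_wing hg hm hS hS2 ((hd _ _ _).1 h)
  · intro j
    refine linearIndependent_wing hg j (fun p => p.1)
      (fun p => TieDiagram.level p - (wingHeight m μ g p.1 (left p.1.1) - 1))
      (fun p q h1 h2 => TieDiagram.dot_ext h1 ?_)
      fun p => (hd _ _ _).1 (TieDiagram.hasDot_level p)
    simp only [h1] at h2
    omega

end

/-! ### Fixed points have gradings -/

/-- An element of the torus with weights that are pairwise distinct. -/
def genericTorus (𝓓 : BraneDiagram) : Torus 𝓓 :=
  (fun U => (Units.mk0 3 three_ne_zero ^ U.1.1)⁻¹, Units.mk0 2 two_ne_zero)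

/-- The weights of the generic element of the torus. -/
def genericWeight (U : 𝓓.D5) (ℓ : ℤ) : ℂ := 3 ^ U.1.1 * 2 ^ (-ℓ)

/-- The 2-adic valuation recovers the level, and the remaining power of `3` the brane. -/
lemma genericWeight_inj {U U' : 𝓓.D5} {ℓ ℓ' : ℤ} (h : genericWeight U ℓ = genericWeight U' ℓ') :
    U = U' ∧ ℓ = ℓ' := by
  have h1 : (3 : ℚ) ^ U.1.1 * 2 ^ (-ℓ) = 3 ^ U'.1.1 * 2 ^ (-ℓ') := by
    refine (Rat.cast_injective : Function.Injective ((↑) : ℚ → ℂ)) ?_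
    simpa [genericWeight] using h
  have hv : ∀ (k : ℕ) (n : ℤ), padicValRat 2 ((3 : ℚ) ^ k * 2 ^ n) = n := fun k n => by
    have h3 : padicValRat 2 (3 : ℚ) = 0 := by
      have : padicValRat 2 ((3 : ℕ) : ℚ) = 0 := by
        rw [padicValRat.of_nat, padicValNat.eq_zero_of_not_dvd (by norm_num)]; rfl
      exact_mod_cast this
    have h2 : padicValRat 2 (2 : ℚ) = 1 := by
      exact_mod_cast padicValRat.self (p := 2) one_lt_two
    rw [padicValRat.mul (by positivity) (by positivity), padicValRat.pow, h3,
      padicValRat.zpow, h2]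
    simp
  have h2 := congrArg (padicValRat 2) h1
  rw [hv, hv, neg_inj] at h2
  subst h2
  refine ⟨pos_injective_D5 ?_, rfl⟩
  have h3 := mul_right_cancel₀ (zpow_ne_zero _ two_ne_zero) h1
  have h4 : 3 ^ U.1.1 = 3 ^ U'.1.1 := by exact_mod_cast h3
  exact Nat.pow_right_injective (by norm_num) h4

/-- Here `ħ = 2` and `t U = 3 ^ (-U)`: the equations for `a` and `b` give the weights `3 ^ U` at
level `0` and `3 ^ U / 2` at level `1`, as prescribed by `genericWeight`. -/
lemma isGrading_of_smul_eq {m : Rep 𝓓} {g : Gauge 𝓓}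
    (h : g • m = genericTorus 𝓓 • m) : IsGrading m 2 genericWeight fun j => (g j).val := by
  have hmul : ∀ {κ : Type} {j : ℕ} {M N : Matrix κ (𝓓.W j) ℂ}, M * (g j)⁻¹.val = N →
      M = N * (g j).val := fun {κ j M N} e => by
    rw [← e, Matrix.mul_assoc, Units.inv_mul, Matrix.mul_one]
  have hA := fun U => hmul (congrFun (congrArg Rep.A h) U)
  have hb := fun U => hmul (congrFun (congrArg Rep.b h) U)
  have ha := fun U => congrFun (congrArg Rep.a h) U
  have hB := fun U => hmul (congrFun (congrArg Rep.B h) U)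
  have hC := fun V => hmul (congrFun (congrArg Rep.C h) V)
  have hD := fun V => hmul (congrFun (congrArg Rep.D h) V)
  simp only [gauge_smul_def, torus_smul_def, gaugeAct_a, torusAct_A, torusAct_b, torusAct_a,
    torusAct_B, torusAct_C, torusAct_D, genericTorus, Units.val_mk0] at hA hb ha hB hC hD
  have hC' : ∀ V w, (g (left V.1)).val *ᵥ (m.C V *ᵥ w) =
      (2 : ℂ) • m.C V *ᵥ ((g (right V.1)).val *ᵥ w) := fun V w => by
    rw [Matrix.mulVec_mulVec, hC, Matrix.smul_mul, Matrix.smul_mulVec, Matrix.mulVec_mulVec]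
  have hD' : ∀ V w, (g (right V.1)).val *ᵥ (m.D V *ᵥ w) =
      m.D V *ᵥ ((g (left V.1)).val *ᵥ w) := fun V w => by
    rw [Matrix.mulVec_mulVec, hD, Matrix.mulVec_mulVec]
  refine ⟨fun _ _ _ _ => genericWeight_inj, fun U ℓ => ?_, two_ne_zero, fun U w => ?_, hC', hD',
    fun j w => ?_, fun U => ?_, fun U w => ?_⟩
  · rw [genericWeight, genericWeight, neg_sub, sub_eq_add_neg, zpow_add₀ two_ne_zero, zpow_one]
    ring
  · rw [Matrix.mulVec_mulVec, hA, Matrix.mulVec_mulVec]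
  · rcases lt_or_ge j 𝓓.size with hj | hj
    · rcases hk : 𝓓.kind ⟨j, hj⟩ with _ | _
      · have hn : nilMap m j = -m.B ⟨_, hk⟩ := nilMap_left_D5 m ⟨_, hk⟩
        have hB' := congrArg (fun M => M *ᵥ w) (hB ⟨_, hk⟩)
        simp only [Matrix.smul_mul, Matrix.smul_mulVec, ← Matrix.mulVec_mulVec] at hB'
        rw [hn, Matrix.neg_mulVec, Matrix.neg_mulVec, Matrix.mulVec_neg, smul_neg]
        exact congrArg Neg.neg hB'
      · have hn : ∀ w, nilMap m j *ᵥ w = m.C ⟨_, hk⟩ *ᵥ (m.D ⟨_, hk⟩ *ᵥ w) := fun w =>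
          (C_D_mulVec (m := m) ⟨_, hk⟩ w).symm
        rw [hn, hn]
        refine (hC' ⟨_, hk⟩ _).trans ?_
        rw [hD' ⟨_, hk⟩]
    · have := subsingleton_of_mult (𝓓.mult_of_size_le j hj)
      exact Subsingleton.elim _ _
  · rw [aVec, Matrix.mulVec_mulVec, ha, Matrix.smul_mulVec, genericWeight]
    simp
  · have h1 : (3 ^ U.1.1 : ℂ) ≠ 0 := pow_ne_zero _ three_ne_zero
    have h2 := congrFun (congrArg (fun M => M *ᵥ w) (hb U)) 0
    simp only [Matrix.smul_mul, Matrix.smul_mulVec, ← Matrix.mulVec_mulVec, Pi.smul_apply] at h2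
    rw [bForm, bForm, h2, genericWeight]
    simp only [Units.val_inv_eq_inv_val, Units.val_pow_eq_pow_val, Units.val_mk0, smul_eq_mul]
    field_simp

/-- A stable point whose class is fixed is in the orbit of a butterfly diagram. -/
lemma exists_butterfly_smul_eq (m : Stable 𝓓)
    (hf : BowVariety.mk m ∈ MulAction.fixedPoints 𝓓.Torus 𝓓.BowVariety) :
    ∃ (τ : TieDiagram 𝓓) (e : τ.Labelling) (g : Gauge 𝓓), g • τ.butterfly e = m.1.1 := by
  obtain ⟨hm, hS, hS2⟩ := m.1.2
  have hc := m.2.costable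
  obtain ⟨g, h⟩ := BowVariety.mk_eq_iff.1
    ((BowVariety.smul_mk _ m).symm.trans (hf (genericTorus 𝓓)))
  have hF := isFrame_wing (isGrading_of_smul_eq h) hm hS hS2 hc
  obtain ⟨e⟩ : Nonempty (wingDiagram (isGrading_of_smul_eq h) hm hS hS2 hc).Labelling :=
    inferInstance
  exact ⟨_, e, hF.exists_gauge e⟩

/-- Every fixed point is represented by a butterfly diagram. -/
lemma exists_represents {f : BowVariety 𝓓}
    (hf : f ∈ MulAction.fixedPoints 𝓓.Torus 𝓓.BowVariety) :
    ∃ (τ : TieDiagram 𝓓) (e : τ.Labelling), Represents (τ.butterfly e) f := by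
  obtain ⟨m, hmf⟩ : ∃ m, BowVariety.mk m = f := Quotient.exists_rep f
  obtain ⟨τ, e, g, hg⟩ := exists_butterfly_smul_eq m (hmf ▸ hf)
  have h : BowVariety.mk m = BowVariety.mk (butterflyStable e) := BowVariety.mk_eq_iff.2 ⟨g, hg⟩
  exact ⟨τ, e, butterflyStable e, rfl, h.symm.trans hmf⟩

end

end BraneDiagram

end

theorem mainTheorem1 (𝓓 : BraneDiagram) :
    (∀ f ∈ MulAction.fixedPoints 𝓓.Torus 𝓓.BowVariety,
      ∃ (τ : 𝓓.TieDiagram) (e : τ.Labelling), BraneDiagram.Represents (τ.butterfly e) f) ∧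
    (∀ (τ : 𝓓.TieDiagram) (e : τ.Labelling),
      ∃ f ∈ MulAction.fixedPoints 𝓓.Torus 𝓓.BowVariety,
        BraneDiagram.Represents (τ.butterfly e) f) ∧
    Set.BijOn (BraneDiagram.TieDiagram.table (𝓓 := 𝓓)) Set.univ 𝓓.BCT ∧
    ∃ Φ : MulAction.fixedPoints 𝓓.Torus 𝓓.BowVariety ≃ 𝓓.BCT,
      ∀ (τ : 𝓓.TieDiagram) (e : τ.Labelling) (f : MulAction.fixedPoints 𝓓.Torus 𝓓.BowVariety),
        BraneDiagram.Represents (τ.butterfly e) f.1 → (Φ f).1 = τ.table := by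
  refine ⟨fun f hf => BraneDiagram.exists_represents hf, fun τ e => ?_,
    BraneDiagram.bijOn_table, BraneDiagram.exists_equiv_BCT fun f hf =>
      BraneDiagram.exists_represents hf⟩
  exact ⟨_, BraneDiagram.butterfly_mem_fixedPoints e, BraneDiagram.butterflyStable e, rfl, rfl⟩
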